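/- Let $\xi_{std}=\ker(dz-y\,dx)$ on $\mathbb R^3$, and let $1\le r\le\infty$. A Legendrian knot of class $C^r$ is a $C^r$ immersed and embedded closed curve $L$, parametrized by $\varphi=(x,y,z):\mathbb R/\mathbb Z\to\mathbb R^3$, which is everywhere tangent to $\xi_{std}$. Its front projection is the curve $(x,z)$ and its Lagrangian projection is the curve $(x,y)$. Assume that the front of $L$ is generic in the following sense: $x'$ vanishes at only finitely many points, the front has no triple points, and no cusp lies on another strand. Here a left (right) cusp is a local minimum (maximum) of $x$. The crossings of a front are decorated so that the strand of smaller slope $dz/dx=y$ is the upper one. The crossings of a Lagrangian projection are decorated so that the strand with larger $z$ is the upper one. A resolution of the front is a diagram obtained from it as follows. Only the $z$-coordinate is changed, by a $C^r$ function, and only in small windows around the cusps. These windows are disjoint and contain no crossings of the front. The old crossings keep their decoration, and no strand is moved across another one except as described for right cusps. Each left cusp is replaced by an arc without double points which has a vertical tangent at the cusp parameter. Each right cusp is replaced by a small loop: coming from the left, the two branches cross each other transversally exactly once and then meet, to the right of that new crossing, in a vertical tangency. At the new crossing the branch that was higher in the front passes over the other one. Theorem. Resolutions of the front of $L$ exist,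 and there is a Legendrian knot $L'$, Legendrian isotopic to $L$ through $C^r$ Legendrian knots, such that the Lagrangian projection of $L'$ is a regular knot diagram (an immersed closed curve with finitely many double points, all transverse, and no triple points), and every resolution of the front of $L$ is isotopic to it as a diagram, that is, by an ambient isotopy of the plane which respects the crossing decorations and the orientation of the knot. -/

import Mathlib

open Set

/-! Closed curves are maps on `ℝ` of period `1`, that is, maps on the circle `ℝ / ℤ`.
Points of three-space are triples `(x, y, z)`. -/

/-- Two parameters give the same point of the circle `ℝ / ℤ`. -/
def SameCirclePoint (s t : ℝ) : Prop := ∃ n : ℤ, t = s + n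

/-- The standard contact structure on three-space: at `p = (x, y, z)` it is the plane spanned
by `∂/∂y` and `∂/∂x + y ∂/∂z`. -/
def xiStd (p : ℝ × ℝ × ℝ) : Submodule ℝ (ℝ × ℝ × ℝ) :=
  Submodule.span ℝ {((0 : ℝ), (1 : ℝ), (0 : ℝ)), ((1 : ℝ), (0 : ℝ), p.2.1)}

/-- A parametrized Legendrian knot of class `C^r` in the standard contact three-space:
an immersed and embedded circle that is everywhere tangent to the contact planes. -/
structure IsLegendrianKnot (r : ℕ∞) (φ : ℝ → ℝ × ℝ × ℝ) : Prop where
  contDiff : ContDiff ℝ r φ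
  periodic : Function.Periodic φ 1
  immersion : ∀ θ, deriv φ θ ≠ 0
  embedding : ∀ s t, φ s = φ t → SameCirclePoint s t
  legendrian : ∀ θ, deriv φ θ ∈ xiStd (φ θ)

/-- A Legendrian isotopy of class `C^r`: a `C^r` family of Legendrian knots. -/
def LegendrianIsotopic (r : ℕ∞) (φ ψ : ℝ → ℝ × ℝ × ℝ) : Prop :=
  ∃ Φ : ℝ → ℝ → ℝ × ℝ × ℝ,
    ContDiffOn ℝ r (fun q : ℝ × ℝ => Φ q.1 q.2) (Icc (0 : ℝ) 1 ×ˢ univ) ∧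
    (∀ τ ∈ Icc (0 : ℝ) 1, IsLegendrianKnot r (Φ τ)) ∧
    Φ 0 = φ ∧ Φ 1 = ψ

/-- The coordinate functions of a space curve. -/
def xCoord (φ : ℝ → ℝ × ℝ × ℝ) (θ : ℝ) : ℝ := (φ θ).1
def yCoord (φ : ℝ → ℝ × ℝ × ℝ) (θ : ℝ) : ℝ := (φ θ).2.1
def zCoord (φ : ℝ → ℝ × ℝ × ℝ) (θ : ℝ) : ℝ := (φ θ).2.2

/-- The front projection `(x, y, z) ↦ (x, z)`. -/
def frontProj (φ : ℝ → ℝ × ℝ × ℝ) (θ : ℝ) : ℝ × ℝ := (xCoord φ θ, zCoord φ θ)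

/-- The Lagrangian projection `(x, y, z) ↦ (x, y)`. -/
def lagrangianProj (φ : ℝ → ℝ × ℝ × ℝ) (θ : ℝ) : ℝ × ℝ := (xCoord φ θ, yCoord φ θ)

/-- A left cusp of the front: the front lies locally to the right of the point. -/
def IsLeftCusp (φ : ℝ → ℝ × ℝ × ℝ) (c : ℝ) : Prop := IsLocalMin (xCoord φ) c

/-- A right cusp of the front: the front lies locally to the left of the point. -/
def IsRightCusp (φ : ℝ → ℝ × ℝ × ℝ) (c : ℝ) : Prop := IsLocalMax (xCoord φ) c

def IsFrontCusp (φ : ℝ → ℝ × ℝ × ℝ) (c : ℝ) : Prop := IsLeftCusp φ c ∨ IsRightCusp φ c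

/-- The front is a knot diagram with cusps: it is an immersion away from finitely many points,
it has no triple points, and no cusp lies on another strand. (At a double point the two slopes
`y` are different because the knot is embedded, so double points are transverse.) -/
structure HasGenericFront (φ : ℝ → ℝ × ℝ × ℝ) : Prop where
  finite_singular : {θ ∈ Ico (0 : ℝ) 1 | deriv (xCoord φ) θ = 0}.Finite
  no_triple : ∀ s t u, frontProj φ s = frontProj φ t → frontProj φ s = frontProj φ u →
    SameCirclePoint s t ∨ SameCirclePoint s u ∨ SameCirclePoint t u
  cusp_simple : ∀ c t, IsFrontCusp φ c → frontProj φ c = frontProj φ t → SameCirclePoint c t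

/-- A closed plane curve with crossing information: if `s` and `t` are different parameters
of one double point, `passesOver s t` says that the strand through `s` passes over the one
through `t`. At other pairs `passesOver` has no meaning. -/
structure PlaneDiagram where
  curve : ℝ → ℝ × ℝ
  passesOver : ℝ → ℝ → Prop

/-- The two parameters `s`, `t` form a crossing. -/
def PlaneDiagram.IsCrossing (D : PlaneDiagram) (s t : ℝ) : Prop :=
  ¬ SameCirclePoint s t ∧ D.curve s = D.curve t

/-- A regular knot diagram: an immersed closed curve with finitely many double points, all of
them transverse, without triple points, and with one strand over the other at each of them. -/
structure PlaneDiagram.IsRegular (D : PlaneDiagram) : Prop where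
  contDiff : ContDiff ℝ 1 D.curve
  periodic : Function.Periodic D.curve 1
  immersion : ∀ θ, deriv D.curve θ ≠ 0
  finite_crossings :
    {q : ℝ × ℝ | q.1 ∈ Ico (0 : ℝ) 1 ∧ q.2 ∈ Ico (0 : ℝ) 1 ∧ D.IsCrossing q.1 q.2}.Finite
  transverse : ∀ s t, D.IsCrossing s t →
    LinearIndependent ℝ ![deriv D.curve s, deriv D.curve t]
  no_triple : ∀ s t u, D.curve s = D.curve t → D.curve s = D.curve u →
    SameCirclePoint s t ∨ SameCirclePoint s u ∨ SameCirclePoint t u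
  over_xor : ∀ s t, D.IsCrossing s t → Xor (D.passesOver s t) (D.passesOver t s)

/-- Planar isotopy of diagrams: an ambient isotopy of the plane carries the first diagram to
the second one, up to an orientation-preserving reparametrization of the circle, and respects
the crossing information. -/
def PlanarIsotopic (D D' : PlaneDiagram) : Prop :=
  ∃ (H : unitInterval → (ℝ × ℝ) ≃ₜ (ℝ × ℝ)) (σ : ℝ → ℝ),
    Continuous (fun q : unitInterval × (ℝ × ℝ) => H q.1 q.2) ∧
    H 0 = Homeomorph.refl (ℝ × ℝ) ∧
    Continuous σ ∧ StrictMono σ ∧ (∀ θ, σ (θ + 1) = σ θ + 1) ∧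
    (∀ θ, H 1 (D.curve θ) = D'.curve (σ θ)) ∧
    (∀ s t, D.IsCrossing s t → (D.passesOver s t ↔ D'.passesOver (σ s) (σ t)))

/-- The Lagrangian projection as a diagram: the strand with the larger `z` is the upper one. -/
def lagrangianDiagram (φ : ℝ → ℝ × ℝ × ℝ) : PlaneDiagram where
  curve := lagrangianProj φ
  passesOver s t := zCoord φ t < zCoord φ s

/-- `s` and `t` lie in the `ε`-window around one right cusp of the circle. -/
def InSameRightWindow (φ : ℝ → ℝ × ℝ × ℝ) (ε s t : ℝ) : Prop :=
  ∃ (c : ℝ) (n : ℤ), IsRightCusp φ c ∧ |s - c| < ε ∧ |t - (c + n)| < ε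

/-- The front is altered into the closed plane curve `θ ↦ (x θ, w θ)` by changing only its
height function `z` to `w`, and that only in small windows around the cusps.

* The windows are disjoint, and they contain no crossing of the front.
* At each cusp the new curve is smooth with a vertical tangent.
* No strand moves across another one, except that the two branches at a right cusp are
  exchanged once. So a left cusp becomes a smooth arc without double points.
* At a right cusp the two branches cross each other transversally once, at the abscissa `a`;
  from there on to the right the branch that was upper runs below the other one until they
  meet in the vertical tangency. So a right cusp becomes a small loop that lies to the right
  of a single new crossing. -/
structure IsCuspResolution (r : ℕ∞) (φ : ℝ → ℝ × ℝ × ℝ) (w : ℝ → ℝ) : Prop where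
  contDiff : ContDiff ℝ r w
  periodic : Function.Periodic w 1
  vertical_tangent : ∀ c, IsFrontCusp φ c → deriv w c ≠ 0
  exists_windows : ∃ ε : ℝ, 0 < ε ∧
    (∀ c c', IsFrontCusp φ c → IsFrontCusp φ c' → c ≠ c' → 2 * ε ≤ |c - c'|) ∧
    (∀ c s t, IsFrontCusp φ c → |s - c| < ε → frontProj φ s = frontProj φ t →
      SameCirclePoint s t) ∧
    (∀ θ, (∀ c, IsFrontCusp φ c → ε ≤ |θ - c|) → w θ = zCoord φ θ) ∧
    (∀ s t, xCoord φ s = xCoord φ t → ¬ InSameRightWindow φ ε s t →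
      zCoord φ s < zCoord φ t → w s < w t) ∧
    (∀ c, IsRightCusp φ c → ∃ a < xCoord φ c,
      (∃ s t, |s - c| < ε ∧ |t - c| < ε ∧ xCoord φ s = a ∧ xCoord φ t = a ∧
        deriv (xCoord φ) s * deriv w t ≠ deriv (xCoord φ) t * deriv w s) ∧
      (∀ s t, |s - c| < ε → |t - c| < ε → xCoord φ s = xCoord φ t →
        zCoord φ t < zCoord φ s →
          (xCoord φ s < a → w t < w s) ∧ (xCoord φ s = a → w t = w s) ∧
          (a < xCoord φ s → w s < w t)))

/-- The diagram obtained from the front by the alteration `w`. At an old crossing (equal `z`)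
the strand with the smaller slope `y = dz/dx` is the upper one, as in every front; at the new
crossing of a right cusp the branch that was higher in the front is the upper one. -/
def resolvedDiagram (φ : ℝ → ℝ × ℝ × ℝ) (w : ℝ → ℝ) : PlaneDiagram where
  curve θ := (xCoord φ θ, w θ)
  passesOver s t := (zCoord φ s = zCoord φ t ∧ yCoord φ s < yCoord φ t) ∨ zCoord φ t < zCoord φ s

/-! Let f be a smooth function of x with derivative F. The map (x, y, z) ↦ (x, e^{f(x)}(F(x)z + y),
e^{f(x)}z) sends Legendrian curves to Legendrian curves, and replacing f by τf joins it to the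
identity (`IsLegendrianKnot.isotopic_shear`). On a vertical line of the plane, the Lagrangian
projection of the image is ordered by W = F(x)z + y, since the factor e^{f(x)} is positive and
constant there. So F has to be chosen such that W orders every vertical line in essentially the way
a resolved front does.

If F is large, W orders two strands as z does wherever their heights are not close. Heights become
close at three kinds of places. At a left cusp the higher branch has the larger slope y, so y and z
agree. At a right cusp the higher branch has the smaller slope, and the height gap is at most the
distance to the cusp times the slope gap (`height_of_arc`); hence y wins just before the cusp and
the branches are exchanged, which is the new crossing of the loop. To the left of a crossing the
higher strand also has the smaller slope, so the exchange takes place at a slightly smaller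
abscissa. Crossings and right cusps are thus treated alike, as pairs of strands called features
(`IsFeature`); `exists_featureSystem` collects them, with a bound M beyond which z decides for all
other pairs. Letting F drop exponentially, at a large rate k, to the left of each feature makes the
exchange happen exactly once and transversally (`exists_shear_crossing`, `exists_shear`). At a
double point of W, larger z is the same as smaller y, so the crossing decorations agree.

The planar isotopies rest on two facts. Closed curves with the same x and the same order on each
vertical line are isotopic by moving points vertically (`exists_isotopy_of_fiber_order`). The
exchange of two strands can be slid along them as long as no third strand runs between
(`exists_slide`). An arbitrary resolution and W order the vertical lines alike, except that the
strands of a feature may be exchanged at different abscissas. That no strand obstructs the slide is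
forced by the orders themselves: away from features the heights, z and W all order pairs alike, so a
strand between the two in height would also be between them in W, in the wrong sense. The loops are
moved first (`HasWindows.exists_move_loops`), then the old crossings (`IsShear.isotopic_of_loops`).

Resolutions exist because z + (y − y(c))/F, cut off near each cusp c, has the fibre order of W close
to the cusp (`exists_isCuspResolution`). -/

open Filter Topology

/-! ### Points of the circle -/

namespace SameCirclePoint

theorem refl (s : ℝ) : SameCirclePoint s s := ⟨0, by simp⟩

theorem of_eq {s t : ℝ} (h : s = t) : SameCirclePoint s t := h ▸ refl s

theorem symm {s t : ℝ} : SameCirclePoint s t → SameCirclePoint t s := by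
  rintro ⟨n, rfl⟩
  exact ⟨-n, by push_cast; ring⟩

theorem trans {s t u : ℝ} : SameCirclePoint s t → SameCirclePoint t u → SameCirclePoint s u := by
  rintro ⟨n, rfl⟩ ⟨m, rfl⟩
  exact ⟨n + m, by push_cast; ring⟩

theorem periodic_eq {α : Type*} {f : ℝ → α} (hf : Function.Periodic f 1) {s t : ℝ}
    (h : SameCirclePoint s t) : f s = f t := by
  obtain ⟨n, rfl⟩ := h
  have := hf.int_mul n s
  simpa using this.symm

theorem eq_of_abs_lt {s t : ℝ} (h : SameCirclePoint s t) (h1 : |s - t| < 1) : s = t := by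
  obtain ⟨n, rfl⟩ := h
  have : |(n : ℝ)| < 1 := by
    have h2 : s - (s + n) = -(n : ℝ) := by ring
    rwa [h2, abs_neg] at h1
  have hn : |n| < 1 := by exact_mod_cast this
  have : n = 0 := Int.abs_lt_one_iff.mp hn
  simp [this]

theorem eq_of_mem_Ico {s t : ℝ} (h : SameCirclePoint s t) (hs : s ∈ Ico (0 : ℝ) 1)
    (ht : t ∈ Ico (0 : ℝ) 1) : s = t :=
  h.eq_of_abs_lt (by rw [abs_lt]; constructor <;> linarith [hs.1, hs.2, ht.1, ht.2])

theorem fract (s : ℝ) : SameCirclePoint s (Int.fract s) :=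
  ⟨-⌊s⌋, by rw [Int.fract]; push_cast; ring⟩

end SameCirclePoint

/-! ### Planar isotopies -/

theorem PlanarIsotopic.trans {D D' D'' : PlaneDiagram} (h : PlanarIsotopic D D')
    (h' : PlanarIsotopic D' D'') : PlanarIsotopic D D'' := by
  obtain ⟨H, σ, hH, hH0, hσ, hσm, hσ1, hc, hp⟩ := h
  obtain ⟨H', σ', hH', hH0', hσ', hσm', hσ1', hc', hp'⟩ := h'
  refine ⟨fun τ => (H τ).trans (H' τ), σ' ∘ σ, ?_, ?_, hσ'.comp hσ, hσm'.comp hσm, ?_, ?_, ?_⟩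
  · have : Continuous fun q : unitInterval × (ℝ × ℝ) => (q.1, H q.1 q.2) :=
      continuous_fst.prodMk hH
    exact hH'.comp this
  · dsimp only
    rw [hH0, hH0']; rfl
  · intro θ; simp [hσ1, hσ1']
  · intro θ; simp [hc, hc']
  · intro s t hst
    rw [hp s t hst, hp' (σ s) (σ t)]
    · rfl
    · refine ⟨?_, ?_⟩
      · rintro ⟨n, hn⟩
        have hσn : ∀ (n : ℤ) θ, σ (θ + n) = σ θ + n := by
          intro n θ
          have hper : Function.Periodic (fun θ => σ θ - θ) 1 := by
            intro θ; simp only [hσ1]; ring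
          have := hper.int_mul n θ
          simp only [mul_one] at this
          linarith
        exact hst.1 ⟨n, hσm.injective (by rw [hn, hσn])⟩
      · rw [← hc, ← hc, hst.2]

/-- Changing the crossing relation away from crossings, and reparametrizing. -/
theorem PlanarIsotopic.of_reparam {D D' : PlaneDiagram} (σ : ℝ → ℝ) (hσ : Continuous σ)
    (hσm : StrictMono σ) (hσ1 : ∀ θ, σ (θ + 1) = σ θ + 1)
    (hc : ∀ θ, D.curve θ = D'.curve (σ θ))
    (hp : ∀ s t, D.IsCrossing s t → (D.passesOver s t ↔ D'.passesOver (σ s) (σ t))) :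
    PlanarIsotopic D D' :=
  ⟨fun _ => Homeomorph.refl _, σ, continuous_snd, rfl, hσ, hσm, hσ1, hc, hp⟩

theorem PlanarIsotopic.of_curve_eq {D D' : PlaneDiagram} (hc : ∀ θ, D.curve θ = D'.curve θ)
    (hp : ∀ s t, D.IsCrossing s t → (D.passesOver s t ↔ D'.passesOver s t)) :
    PlanarIsotopic D D' :=
  of_reparam id continuous_id strictMono_id (fun _ => rfl) hc hp

/-! ### Isotopies determined by the order on vertical lines -/

/-- A modulus of continuity for a function that is non-positive on the zero set of another. -/
theorem exists_modulus {X : Type*} [TopologicalSpace X] {K : Set X} (hK : IsCompact K)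
    (hKne : K.Nonempty) {g d : X → ℝ} (hg : Continuous g) (hd : Continuous d) (hd0 : ∀ q, 0 ≤ d q)
    (hgd : ∀ q, d q = 0 → g q ≤ 0) :
    ∃ ω : ℝ → ℝ, Continuous ω ∧ Monotone ω ∧ ω 0 = 0 ∧ (∃ C, ∀ δ, ω δ ≤ C) ∧
      ∀ q ∈ K, g q ≤ ω (d q) := by
  -- The modulus is the supremum of Ψ δ over K. The second factor is 1 for δ = d q > 0 and 0 for δ ≤
  -- 0. Where d vanishes the positive part of g vanishes too, so division by zero is harmless and Ψ
  -- is continuous there by squeezing.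
  set Ψ : ℝ → X → ℝ := fun δ q => max (g q) 0 * min 1 (max δ 0 / d q) with hΨ
  have hΨle : ∀ δ q, Ψ δ q ≤ max (g q) 0 := fun δ q =>
    mul_le_of_le_one_right (le_max_right _ _) (min_le_left _ _)
  have hΨ0 : ∀ δ q, 0 ≤ Ψ δ q := fun δ q =>
    mul_nonneg (le_max_right _ _)
      (le_min zero_le_one (div_nonneg (le_max_right _ _) (hd0 q)))
  have hΨc : Continuous (Function.uncurry Ψ) := by
    rw [continuous_iff_continuousAt]
    rintro ⟨δ, q⟩
    by_cases hq : d q = 0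
    · have hz : max (g q) 0 = 0 := max_eq_right (hgd q hq)
      have h1 : Tendsto (fun p : ℝ × X => max (g p.2) 0) (𝓝 (δ, q)) (𝓝 0) := by
        have : Continuous fun p : ℝ × X => max (g p.2) 0 := by fun_prop
        simpa [hz] using this.tendsto (δ, q)
      have h2 : Function.uncurry Ψ (δ, q) = 0 := by simp [Function.uncurry, hΨ, hz]
      rw [ContinuousAt, h2]
      exact squeeze_zero (fun p => hΨ0 p.1 p.2) (fun p => hΨle p.1 p.2) h1
    · have : ContinuousAt (fun p : ℝ × X => max (g p.2) 0 * min 1 (max p.1 0 / d p.2)) (δ, q) := by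
        refine ContinuousAt.mul (by fun_prop) ?_
        refine Tendsto.min tendsto_const_nhds ?_
        exact ContinuousAt.div (f := fun p : ℝ × X => max p.1 0) (by fun_prop) (by fun_prop) hq
      exact this
  have hbdd : ∀ δ, BddAbove (Ψ δ '' K) := by
    intro δ
    refine (hK.image ?_).bddAbove
    exact hΨc.comp (continuous_const.prodMk continuous_id)
  obtain ⟨C, hC⟩ := (hK.image (f := fun q => max (g q) 0) (by fun_prop)).bddAbove
  have hne : ∀ δ, (Ψ δ '' K).Nonempty := fun δ => hKne.image _
  refine ⟨fun δ => sSup (Ψ δ '' K), hK.continuous_sSup hΨc, ?_, ?_, ⟨C, ?_⟩, ?_⟩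
  · intro δ δ' h
    refine csSup_le (hne δ) ?_
    rintro _ ⟨q, hq, rfl⟩
    refine le_trans ?_ (le_csSup (hbdd δ') (mem_image_of_mem _ hq))
    have := hd0 q
    simp only [hΨ]
    gcongr
  · have : Ψ 0 '' K = {0} := by
      rw [show Ψ 0 = fun _ => 0 by ext q; simp [hΨ]]
      exact hKne.image_const 0
    simp [this]
  · intro δ
    refine csSup_le (hne δ) ?_
    rintro _ ⟨q, hq, rfl⟩
    exact (hΨle δ q).trans (hC (mem_image_of_mem _ hq))
  · intro q hq
    refine le_trans ?_ (le_csSup (hbdd _) (mem_image_of_mem _ hq))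
    by_cases h : d q = 0
    · exact (hgd q h).trans (hΨ0 _ _)
    · simp [hΨ, max_eq_left (hd0 q), div_self h]

/-- A function on a closed plane curve that is weakly increasing on vertical fibers extends to the
plane as a bounded function, increasing on vertical lines. -/
theorem exists_fiber_monotone_extension {a b b' : ℝ → ℝ} (ha : Continuous a) (hb : Continuous b)
    (hb' : Continuous b') (pa : Function.Periodic a 1) (pb : Function.Periodic b 1)
    (pb' : Function.Periodic b' 1) (h : ∀ s t, a s = a t → b s ≤ b t → b' s ≤ b' t) :
    ∃ g : ℝ → ℝ → ℝ, Continuous (Function.uncurry g) ∧ (∀ u, Monotone (g u)) ∧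
      (∃ C, ∀ u v, |g u v| ≤ C) ∧ ∀ θ, g (a θ) (b θ) = b' θ := by
  have hI : IsCompact (Icc (0 : ℝ) 1) := isCompact_Icc
  have hIne : (Icc (0 : ℝ) 1).Nonempty := ⟨0, by simp⟩
  -- A one-sided distance from the curve point at s to p: height is penalised only when the curve
  -- point is above p. This makes D decrease in the second coordinate of p, so the McShane-type
  -- formula `sup (b' s - ω (D s p))` increases along vertical lines. The order hypothesis is what
  -- makes the formula return b' on the curve.
  set D : ℝ → ℝ × ℝ → ℝ := fun s p => |a s - p.1| + max (b s - p.2) 0 with hD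
  have hDnn : ∀ s p, 0 ≤ D s p := fun s p => add_nonneg (abs_nonneg _) (le_max_right _ _)
  obtain ⟨ω, hω, hωm, hω0, ⟨C, hC⟩, hωd⟩ := exists_modulus (hI.prod hI) (hIne.prod hIne)
    (g := fun q : ℝ × ℝ => b' q.1 - b' q.2) (d := fun q => D q.1 (a q.2, b q.2))
    (by fun_prop) (by fun_prop) (fun q => hDnn _ _) (by
      rintro ⟨s, t⟩ hq
      simp only [hD] at hq
      have h1 := abs_nonneg (a s - a t)
      have h2 := le_max_right (b s - b t) 0
      have h3 : a s - a t = 0 := abs_eq_zero.mp (by linarith)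
      have h4 := le_max_left (b s - b t) 0
      have := h s t (by linarith) (by linarith)
      simp only; linarith)
  set G : ℝ × ℝ → ℝ → ℝ := fun p s => b' s - ω (D s p) with hG
  have hGc : Continuous (Function.uncurry G) := by
    simp only [hG, Function.uncurry_def, hD]; fun_prop
  have hbdd : ∀ p, BddAbove (G p '' Icc 0 1) := fun p =>
    (hI.image (hGc.comp (continuous_const.prodMk continuous_id))).bddAbove
  have hne : ∀ p, (G p '' Icc 0 1).Nonempty := fun p => hIne.image _
  obtain ⟨B, hB⟩ := (hI.image hb').bddAbove
  refine ⟨fun u v => sSup (G (u, v) '' Icc 0 1), ?_, ?_, ⟨max B (-(b' 0 - C)), ?_⟩, ?_⟩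
  · exact hI.continuous_sSup hGc
  · intro u v v' hv
    refine csSup_le (hne _) ?_
    rintro _ ⟨s, hs, rfl⟩
    refine le_trans ?_ (le_csSup (hbdd _) (mem_image_of_mem _ hs))
    simp only [hG]
    refine sub_le_sub_left (hωm ?_) _
    simp only [hD]
    gcongr
  · intro u v
    rw [abs_le]
    constructor
    · have : G (u, v) 0 ≤ sSup (G (u, v) '' Icc 0 1) :=
        le_csSup (hbdd _) (mem_image_of_mem _ (by simp))
      have h1 : b' 0 - C ≤ G (u, v) 0 := sub_le_sub_left (hC _) _
      have := le_max_right B (-(b' 0 - C))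
      linarith
    · refine (csSup_le (hne _) ?_).trans (le_max_left _ _)
      rintro _ ⟨s, hs, rfl⟩
      have h1 : 0 ≤ ω (D s (u, v)) := by rw [← hω0]; exact hωm (hDnn _ _)
      have h2 := hB (mem_image_of_mem b' hs)
      simp only [hG]; linarith
  · have key : ∀ t ∈ Icc (0 : ℝ) 1, sSup (G (a t, b t) '' Icc 0 1) = b' t := by
      intro t ht
      apply le_antisymm
      · refine csSup_le (hne _) ?_
        rintro _ ⟨s, hs, rfl⟩
        have := hωd (s, t) ⟨hs, ht⟩
        simp only [hG]
        simp only at this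
        linarith
      · refine le_trans ?_ (le_csSup (hbdd _) (mem_image_of_mem _ ht))
        simp [hG, hD, hω0]
    intro θ
    have hs := SameCirclePoint.fract θ
    rw [hs.periodic_eq pa, hs.periodic_eq pb, hs.periodic_eq pb']
    exact key _ ⟨Int.fract_nonneg _, (Int.fract_lt_one _).le⟩

/-- The vertical isotopy `(u, v) ↦ (u, v + τ g(u, v))` and its inverse. -/
theorem exists_vertical_isotopy {g : ℝ → ℝ → ℝ} (hg : Continuous (Function.uncurry g))
    (hm : ∀ u, Monotone (g u)) (hC : ∃ C, ∀ u v, |g u v| ≤ C) :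
    ∃ H : unitInterval → (ℝ × ℝ) ≃ₜ (ℝ × ℝ),
      Continuous (fun q : unitInterval × (ℝ × ℝ) => H q.1 q.2) ∧
      Continuous (fun q : unitInterval × (ℝ × ℝ) => (H q.1).symm q.2) ∧
      H 0 = Homeomorph.refl _ ∧ ∀ u v, H 1 (u, v) = (u, v + g u v) := by
  obtain ⟨C, hC⟩ := hC
  set k : unitInterval → ℝ → ℝ → ℝ := fun τ u v => v + τ * g u v with hk
  have hkc : Continuous fun q : unitInterval × ℝ × ℝ => k q.1 q.2.1 q.2.2 := by
    have : Continuous fun q : unitInterval × ℝ × ℝ => g q.2.1 q.2.2 :=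
      hg.comp (continuous_snd)
    simp only [hk]; fun_prop
  -- The maps do not shrink vertical distances. This gives injectivity, and a 1-Lipschitz inverse on
  -- each vertical line, from which joint continuity of the inverse in all variables follows.
  have hexp : ∀ τ u v v', v ≤ v' → v' - v ≤ k τ u v' - k τ u v := by
    intro τ u v v' h
    have h1 := mul_le_mul_of_nonneg_left (hm u h) τ.2.1
    simp only [hk]; linarith
  have habs : ∀ τ u v v', |v - v'| ≤ |k τ u v - k τ u v'| := by
    intro τ u v v'
    rcases le_total v v' with h | h
    · have := hexp τ u v v' h
      rw [abs_sub_comm, abs_of_nonneg (by linarith), abs_sub_comm]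
      exact this.trans (le_abs_self _)
    · have := hexp τ u v' v h
      rw [abs_of_nonneg (by linarith)]
      exact this.trans (le_abs_self _)
  have hinj : ∀ τ u, Function.Injective (k τ u) := by
    intro τ u v v' h
    have := habs τ u v v'
    rw [h, sub_self, abs_zero] at this
    exact sub_eq_zero.mp (abs_nonpos_iff.mp this)
  have hkb : ∀ (τ : unitInterval) u v, |(τ : ℝ) * g u v| ≤ C := by
    intro τ u v
    rw [abs_mul, abs_of_nonneg τ.2.1]
    calc (τ : ℝ) * |g u v| ≤ 1 * |g u v| :=
          mul_le_mul_of_nonneg_right τ.2.2 (abs_nonneg _)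
      _ ≤ C := by rw [one_mul]; exact hC u v
  have hsurj : ∀ τ u, Function.Surjective (k τ u) := by
    intro τ u y
    have hc : Continuous (k τ u) := hkc.comp (by fun_prop : Continuous fun v : ℝ => (τ, u, v))
    have hC0 : 0 ≤ C := (abs_nonneg _).trans (hC 0 0)
    have h1 : k τ u (y - C) ≤ y := by
      have := (abs_le.mp (hkb τ u (y - C))).2
      simp only [hk]; linarith
    have h2 : y ≤ k τ u (y + C) := by
      have := (abs_le.mp (hkb τ u (y + C))).1
      simp only [hk]; linarith
    obtain ⟨v, -, hv⟩ := intermediate_value_Icc (by linarith : y - C ≤ y + C)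
      hc.continuousOn ⟨h1, h2⟩
    exact ⟨v, hv⟩
  choose j hj using hsurj
  have hj' : ∀ τ u v, j τ u (k τ u v) = v := fun τ u v => hinj τ u (hj τ u _)
  have hjc : Continuous fun q : unitInterval × ℝ × ℝ => j q.1 q.2.1 q.2.2 := by
    rw [continuous_iff_continuousAt]
    rintro ⟨τ, u, y⟩
    set v := j τ u y with hv
    have hcont : Continuous fun q : unitInterval × ℝ × ℝ => |q.2.2 - k q.1 q.2.1 v| := by
      have : Continuous fun q : unitInterval × ℝ × ℝ => k q.1 q.2.1 v :=
        hkc.comp (by fun_prop : Continuous fun q : unitInterval × ℝ × ℝ => (q.1, q.2.1, v))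
      fun_prop
    have h0 : Tendsto (fun q : unitInterval × ℝ × ℝ => |q.2.2 - k q.1 q.2.1 v|) (𝓝 (τ, u, y))
        (𝓝 0) := by
      have := hcont.tendsto (τ, u, y)
      simpa [hv, hj] using this
    rw [ContinuousAt, tendsto_iff_dist_tendsto_zero]
    refine squeeze_zero (fun _ => dist_nonneg) (fun q => ?_) h0
    rw [Real.dist_eq]
    have := habs q.1 q.2.1 (j q.1 q.2.1 q.2.2) v
    rwa [hj] at this
  have c1 : Continuous fun q : unitInterval × (ℝ × ℝ) => (q.2.1, k q.1 q.2.1 q.2.2) := by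
    fun_prop
  have c2 : Continuous fun q : unitInterval × (ℝ × ℝ) => (q.2.1, j q.1 q.2.1 q.2.2) := by
    fun_prop
  refine ⟨fun τ =>
    { toFun := fun p => (p.1, k τ p.1 p.2)
      invFun := fun p => (p.1, j τ p.1 p.2)
      left_inv := fun p => by simp [hj']
      right_inv := fun p => by simp [hj]
      continuous_toFun := c1.comp (by fun_prop : Continuous fun p : ℝ × ℝ => (τ, p))
      continuous_invFun := c2.comp (by fun_prop : Continuous fun p : ℝ × ℝ => (τ, p)) },
    c1, c2, ?_, ?_⟩
  · ext p <;> simp [hk]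
  · intro u v; simp [hk]

/-- Two closed curves with the same first coordinate and the same order on every vertical line
are carried to each other by an ambient isotopy. -/
theorem exists_isotopy_of_fiber_order {a b b' : ℝ → ℝ} (ha : Continuous a) (hb : Continuous b)
    (hb' : Continuous b') (pa : Function.Periodic a 1) (pb : Function.Periodic b 1)
    (pb' : Function.Periodic b' 1) (h : ∀ s t, a s = a t → (b s < b t ↔ b' s < b' t)) :
    ∃ H : unitInterval → (ℝ × ℝ) ≃ₜ (ℝ × ℝ),
      Continuous (fun q : unitInterval × (ℝ × ℝ) => H q.1 q.2) ∧
      H 0 = Homeomorph.refl _ ∧ ∀ θ, H 1 (a θ, b θ) = (a θ, b' θ) := by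
  have hle : ∀ s t, a s = a t → (b s ≤ b t ↔ b' s ≤ b' t) := by
    intro s t hst
    rw [← not_lt, ← not_lt, h t s hst.symm]
  obtain ⟨g, hg, gm, gC, gv⟩ := exists_fiber_monotone_extension ha hb hb' pa pb pb'
    (fun s t hst => (hle s t hst).1)
  obtain ⟨g', hg', gm', gC', gv'⟩ := exists_fiber_monotone_extension ha hb' hb pa pb' pb
    (fun s t hst => (hle s t hst).2)
  obtain ⟨H, H1, -, H0, Hv⟩ := exists_vertical_isotopy hg gm gC
  obtain ⟨H', -, H1', H0', Hv'⟩ := exists_vertical_isotopy hg' gm' gC'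
  -- The two curves meet halfway: adding the extension of b' to height b, and that of b to height
  -- b', both give b + b'.
  refine ⟨fun τ => (H τ).trans (H' τ).symm, ?_, ?_, ?_⟩
  · have : Continuous fun q : unitInterval × (ℝ × ℝ) => (q.1, H q.1 q.2) :=
      continuous_fst.prodMk H1
    exact H1'.comp this
  · dsimp only
    rw [H0, H0']; rfl
  · intro θ
    simp only [Homeomorph.trans_apply]
    rw [Hv, gv, Homeomorph.symm_apply_eq, Hv', gv', add_comm]

/-- The order hypothesis makes both curves have the same double points, so the two crossing
relations need to be compared only there. -/
theorem PlanarIsotopic.of_vertical_order {a b b' : ℝ → ℝ} (ha : Continuous a) (hb : Continuous b)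
    (hb' : Continuous b') (pa : Function.Periodic a 1) (pb : Function.Periodic b 1)
    (pb' : Function.Periodic b' 1) (h : ∀ s t, a s = a t → (b s < b t ↔ b' s < b' t))
    {R R' : ℝ → ℝ → Prop}
    (hR : ∀ s t, ¬ SameCirclePoint s t → a s = a t → b s = b t → (R s t ↔ R' s t)) :
    PlanarIsotopic ⟨fun θ => (a θ, b θ), R⟩ ⟨fun θ => (a θ, b' θ), R'⟩ := by
  obtain ⟨H, h1, h2, h3⟩ := exists_isotopy_of_fiber_order ha hb hb' pa pb pb' h
  exact ⟨H, id, h1, h2, continuous_id, strictMono_id, fun _ => rfl, h3,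
    fun s t hst => hR s t hst.1 (Prod.ext_iff.mp hst.2).1 (Prod.ext_iff.mp hst.2).2⟩

/-- The same isotopy with the coordinates interchanged; it moves strands sideways at constant height
when a crossing is slid. -/
theorem PlanarIsotopic.of_horizontal_order {a b b' : ℝ → ℝ} (ha : Continuous a)
    (hb : Continuous b) (hb' : Continuous b') (pa : Function.Periodic a 1)
    (pb : Function.Periodic b 1) (pb' : Function.Periodic b' 1)
    (h : ∀ s t, a s = a t → (b s < b t ↔ b' s < b' t)) (R : ℝ → ℝ → Prop) :
    PlanarIsotopic ⟨fun θ => (b θ, a θ), R⟩ ⟨fun θ => (b' θ, a θ), R⟩ := by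
  obtain ⟨H, h1, h2, h3⟩ := exists_isotopy_of_fiber_order ha hb hb' pa pb pb' h
  refine ⟨fun τ => ((Homeomorph.prodComm ℝ ℝ).trans (H τ)).trans (Homeomorph.prodComm ℝ ℝ), id,
    ?_, ?_, continuous_id, strictMono_id, fun _ => rfl, ?_, fun s t _ => Iff.rfl⟩
  · have : Continuous fun q : unitInterval × (ℝ × ℝ) => H q.1 q.2.swap :=
      h1.comp (continuous_fst.prodMk (continuous_swap.comp continuous_snd))
    exact continuous_swap.comp this
  · dsimp only
    rw [h2]; ext p <;> rfl
  · intro θ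
    simp [Homeomorph.prodComm, Equiv.prodComm, h3]

/-! ### Sliding a crossing along two strands -/

/-- `s` is a continuous section of `x` over `I`: a strand of the curve that is a graph over `I`. -/
structure IsStrand (x s : ℝ → ℝ) (I : Set ℝ) : Prop where
  continuousOn : ContinuousOn s I
  section_eq : ∀ u ∈ I, x (s u) = u

namespace IsStrand

variable {x s : ℝ → ℝ} {I J : Set ℝ}

theorem mono (h : IsStrand x s I) (hJ : J ⊆ I) : IsStrand x s J :=
  ⟨h.continuousOn.mono hJ, fun u hu => h.section_eq u (hJ hu)⟩

theorem eq_of_sameCirclePoint (px : Function.Periodic x 1) (h : IsStrand x s I) {u v : ℝ}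
    (hu : u ∈ I) (hv : v ∈ I) (huv : SameCirclePoint (s u) (s v)) : u = v := by
  have := huv.periodic_eq px
  rwa [h.section_eq u hu, h.section_eq v hv] at this

theorem injOn (h : IsStrand x s I) : InjOn s I := fun u hu v hv huv => by
  rw [← h.section_eq u hu, ← h.section_eq v hv, huv]

/-- A strand over a compact interval is a monotone parametrization of an arc of length `< 1`. -/
theorem image_Icc {p q : ℝ} (hpq : p ≤ q) (px : Function.Periodic x 1)
    (h : IsStrand x s (Icc p q)) :
    ∃ b e, b ≤ e ∧ e < b + 1 ∧ s '' Icc p q = Icc b e ∧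
      ((StrictMonoOn s (Icc p q) ∧ s p = b ∧ s q = e) ∨
        (StrictAntiOn s (Icc p q) ∧ s p = e ∧ s q = b)) := by
  have hp : p ∈ Icc p q := left_mem_Icc.mpr hpq
  have hq : q ∈ Icc p q := right_mem_Icc.mpr hpq
  have hlt : ∀ b e, s '' Icc p q = Icc b e → b ≤ e → e < b + 1 := by
    intro b e him hbe
    by_contra hcon
    push Not at hcon
    have h1 : b + 1 ∈ s '' Icc p q := by rw [him]; exact ⟨by linarith, hcon⟩
    have h2 : b ∈ s '' Icc p q := by rw [him]; exact ⟨le_rfl, hbe⟩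
    obtain ⟨u, hu, hu'⟩ := h1
    obtain ⟨v, hv, hv'⟩ := h2
    -- Parameters that differ by 1 have the same abscissa, and a section takes only one value over
    -- it.
    have : SameCirclePoint (s v) (s u) := ⟨1, by rw [hu', hv']; simp⟩
    have := h.eq_of_sameCirclePoint px hv hu this
    subst this
    linarith
  rcases h.continuousOn.strictMonoOn_of_injOn_Icc' hpq h.injOn with hm | hm
  · have hb : s p ≤ s q := hm.monotoneOn hp hq hpq
    have him : s '' Icc p q = Icc (s p) (s q) := by
      apply Subset.antisymm
      · rintro _ ⟨u, hu, rfl⟩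
        exact ⟨hm.monotoneOn hp hu hu.1, hm.monotoneOn hu hq hu.2⟩
      · exact intermediate_value_Icc hpq h.continuousOn
    exact ⟨s p, s q, hb, hlt _ _ him hb, him, Or.inl ⟨hm, rfl, rfl⟩⟩
  · have hb : s q ≤ s p := hm.antitoneOn hp hq hpq
    have him : s '' Icc p q = Icc (s q) (s p) := by
      apply Subset.antisymm
      · rintro _ ⟨u, hu, rfl⟩
        exact ⟨hm.antitoneOn hu hq hu.2, hm.antitoneOn hp hu hu.1⟩
      · exact intermediate_value_Icc' hpq h.continuousOn
    exact ⟨s q, s p, hb, hlt _ _ him hb, him, Or.inr ⟨hm, rfl, rfl⟩⟩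

end IsStrand

/-- A self-homeomorphism of a short interval extends to the circle by the identity. -/
theorem exists_circle_extension {τ : ℝ → ℝ} {b e : ℝ} (hbe : b ≤ e) (he : e < b + 1)
    (hτ : ContinuousOn τ (Icc b e)) (hm : StrictMonoOn τ (Icc b e)) (hb : τ b = b)
    (hτe : τ e = e) :
    ∃ σ : ℝ ≃o ℝ, (∀ θ, σ (θ + 1) = σ θ + 1) ∧
      (∀ θ ∈ Icc b e, ∀ n : ℤ, σ (θ + n) = τ θ + n) ∧
      ∀ θ : ℝ, (∀ n : ℤ, θ + n ∉ Icc b e) → σ θ = θ := by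
  set cl : ℝ → ℝ := fun θ => max b (min e θ) with hcl
  have hclm : ∀ θ, cl θ ∈ Icc b e := fun θ => ⟨le_max_left _ _, max_le hbe (min_le_left _ _)⟩
  have hclc : Continuous cl := by fun_prop
  have hclid : ∀ θ ∈ Icc b e, cl θ = θ := fun θ h => by
    simp only [hcl]; rw [min_eq_right h.2, max_eq_right h.1]
  set D : ℝ → ℝ := fun θ => τ (cl θ) - cl θ with hD
  have hDc : Continuous D := (hτ.comp_continuous hclc hclm).sub hclc
  have hDb : D b = 0 := by simp [hD, hclid b ⟨le_rfl, hbe⟩, hb]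
  have hDe : ∀ θ, e ≤ θ → D θ = 0 := by
    intro θ h
    have : cl θ = e := by simp only [hcl]; rw [min_eq_left h, max_eq_right hbe]
    simp [hD, this, hτe]
  have hσ0 : StrictMono fun θ => θ + D θ := by
    intro θ θ' h
    have h1 : cl θ ≤ cl θ' := by simp only [hcl]; gcongr
    have h2 : θ - cl θ ≤ θ' - cl θ' := by
      simp only [hcl]
      rcases le_total e θ' with h3 | h3
      · rw [min_eq_left h3, max_eq_right hbe]
        rcases le_total e θ with h4 | h4
        · rw [min_eq_left h4, max_eq_right hbe]; linarith
        · rw [min_eq_right h4]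
          have := le_max_right b θ; linarith
      · rw [min_eq_right h3, min_eq_right (h.le.trans h3)]
        rcases le_total b θ with h4 | h4
        · rw [max_eq_right h4, max_eq_right (h4.trans h.le)]; linarith
        · rw [max_eq_left h4]
          rcases le_total b θ' with h5 | h5
          · rw [max_eq_right h5]; linarith
          · rw [max_eq_left h5]; linarith
    simp only [hD]
    rcases h1.eq_or_lt with h3 | h3
    · rw [← h3]; linarith
    · have := hm (hclm θ) (hclm θ') h3
      linarith
  -- The displacement τ − id vanishes at b and e. Continued by zero up to b + 1 and then
  -- periodically, it stays continuous, and adding it to the identity gives the wanted circle map.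
  set E : ℝ → ℝ := fun θ => D (b + Int.fract (θ - b)) with hE
  have hEc : Continuous E := by
    have h1 : ContinuousOn (fun r => D (b + r)) (Icc (0 : ℝ) 1) := by fun_prop
    have h2 := h1.comp_fract'' (by simp [hDb, hDe (b + 1) he.le])
    exact h2.comp (by fun_prop : Continuous fun θ : ℝ => θ - b)
  have hEper : Function.Periodic E 1 := by
    intro θ
    simp only [hE]
    rw [show θ + 1 - b = θ - b + 1 by ring, Int.fract_add_one]
  have hEeq : ∀ θ, b ≤ θ → θ < b + 1 → ∀ n : ℤ, E (θ + n) = D θ := by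
    intro θ h1 h2 n
    simp only [hE]
    rw [show θ + n - b = θ - b + n by ring, Int.fract_add_intCast,
      Int.fract_eq_self.mpr ⟨by linarith, by linarith⟩]
    congr 1; ring
  have hrep : ∀ θ : ℝ, ∃ r, b ≤ r ∧ r < b + 1 ∧ ∃ n : ℤ, θ = r + n := fun θ =>
    ⟨b + Int.fract (θ - b), by have := Int.fract_nonneg (θ - b); linarith,
      by have := Int.fract_lt_one (θ - b); linarith, ⌊θ - b⌋, by
        have := Int.fract_add_floor (θ - b); linarith⟩
  have hbd : ∀ r, b ≤ r → r < b + 1 → b ≤ r + D r ∧ r + D r < b + 1 := by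
    intro r h1 h2
    have h3 := hσ0.monotone h1
    have h4 := hσ0 h2
    simp only [hDb, hDe (b + 1) he.le] at h3 h4
    exact ⟨by linarith, by linarith⟩
  have hmono : StrictMono fun θ => θ + E θ := by
    intro θ θ' h
    obtain ⟨r, h1, h2, n, rfl⟩ := hrep θ
    obtain ⟨r', h1', h2', n', rfl⟩ := hrep θ'
    simp only [hEeq r h1 h2, hEeq r' h1' h2']
    have h3 : n ≤ n' := by
      have : (n : ℝ) < n' + 1 := by linarith
      exact_mod_cast Int.lt_add_one_iff.mp (by exact_mod_cast this)
    rcases h3.eq_or_lt with h4 | h4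
    · subst h4
      have := @hσ0 r r' (by linarith)
      simp only at this; linarith
    · have h5 : (n : ℝ) + 1 ≤ n' := by exact_mod_cast h4
      have := (hbd r h1 h2).2
      have := (hbd r' h1' h2').1
      linarith
  have hcont : Continuous fun θ => θ + E θ := by fun_prop
  have hsurj : Function.Surjective fun θ => θ + E θ := by
    intro y
    have hb' : ∀ θ, θ - 1 ≤ θ + E θ ∧ θ + E θ ≤ θ + 1 := by
      intro θ
      obtain ⟨r, h1, h2, n, rfl⟩ := hrep θ
      rw [hEeq r h1 h2]
      have := hbd r h1 h2
      exact ⟨by linarith [this.1], by linarith [this.2]⟩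
    exact mem_range_of_exists_le_of_exists_ge hcont ⟨y - 1, by have := (hb' (y - 1)).2; linarith⟩
      ⟨y + 1, by have := (hb' (y + 1)).1; linarith⟩
  refine ⟨hmono.orderIsoOfSurjective _ hsurj, ?_, ?_, ?_⟩
  · intro θ
    simp only [StrictMono.coe_orderIsoOfSurjective, hEper θ]; ring
  · intro θ hθ n
    simp only [StrictMono.coe_orderIsoOfSurjective]
    rw [hEeq θ hθ.1 (hθ.2.trans_lt he)]
    simp only [hD, hclid θ hθ]; ring
  · intro θ hθ
    simp only [StrictMono.coe_orderIsoOfSurjective]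
    obtain ⟨r, h1, h2, n, rfl⟩ := hrep θ
    rw [hEeq r h1 h2]
    have h3 : r ∉ Icc b e := by have := hθ (-n); simpa using this
    have h4 : e ≤ r := by
      by_contra h4
      exact h3 ⟨h1, by linarith⟩
    rw [hDe r h4]; ring

/-- Moving the points of one strand by a homeomorphism `γ` of the base. -/
theorem exists_strand_shift {x s γ : ℝ → ℝ} {p q : ℝ} (hpq : p ≤ q) (hx : Continuous x)
    (px : Function.Periodic x 1) (hs : IsStrand x s (Icc p q)) (hγ : Continuous γ)
    (hγm : StrictMono γ) (hp : γ p = p) (hq : γ q = q) :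
    ∃ σ : ℝ ≃o ℝ, (∀ θ, σ (θ + 1) = σ θ + 1) ∧
      (∀ u ∈ Icc p q, ∀ n : ℤ, σ (s u + n) = s (γ u) + n) ∧
      ∀ θ, (∀ u ∈ Icc p q, ¬ SameCirclePoint (s u) θ) → σ θ = θ := by
  have hpm : p ∈ Icc p q := left_mem_Icc.mpr hpq
  have hqm : q ∈ Icc p q := right_mem_Icc.mpr hpq
  have hγI : ∀ u ∈ Icc p q, γ u ∈ Icc p q := fun u hu =>
    ⟨hp ▸ hγm.monotone hu.1, hq ▸ hγm.monotone hu.2⟩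
  obtain ⟨b, e, hbe, he, him, hmono⟩ := hs.image_Icc hpq px
  have hxI : ∀ θ ∈ Icc b e, x θ ∈ Icc p q ∧ s (x θ) = θ := by
    intro θ hθ
    rw [← him] at hθ
    obtain ⟨u, hu, rfl⟩ := hθ
    rw [hs.section_eq u hu]; exact ⟨hu, rfl⟩
  -- In the coordinate x the strand is an interval, so γ acts on the arc as s ∘ γ ∘ x. The conjugate
  -- is increasing whether s increases or decreases.
  have hτc : ContinuousOn (fun θ => s (γ (x θ))) (Icc b e) :=
    hs.continuousOn.comp (hγ.comp hx).continuousOn fun θ hθ => hγI _ (hxI θ hθ).1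
  have key : StrictMonoOn (fun θ => s (γ (x θ))) (Icc b e) ∧ s (γ (x b)) = b ∧
      s (γ (x e)) = e := by
    rcases hmono with ⟨hm, h1, h2⟩ | ⟨hm, h1, h2⟩
    · refine ⟨?_, ?_, ?_⟩
      · intro θ hθ θ' hθ' hlt
        have h3 : x θ < x θ' := by
          rw [← hm.lt_iff_lt (hxI θ hθ).1 (hxI θ' hθ').1, (hxI θ hθ).2, (hxI θ' hθ').2]
          exact hlt
        exact hm (hγI _ (hxI θ hθ).1) (hγI _ (hxI θ' hθ').1) (hγm h3)
      · rw [← h1, hs.section_eq p hpm, hp]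
      · rw [← h2, hs.section_eq q hqm, hq]
    · refine ⟨?_, ?_, ?_⟩
      · intro θ hθ θ' hθ' hlt
        have h3 : x θ' < x θ := by
          rw [← hm.lt_iff_gt (hxI θ hθ).1 (hxI θ' hθ').1, (hxI θ hθ).2, (hxI θ' hθ').2]
          exact hlt
        exact hm (hγI _ (hxI θ' hθ').1) (hγI _ (hxI θ hθ).1) (hγm h3)
      · rw [← h2, hs.section_eq q hqm, hq]
      · rw [← h1, hs.section_eq p hpm, hp]
  obtain ⟨σ, h1, h2, h3⟩ := exists_circle_extension hbe he hτc key.1 key.2.1 key.2.2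
  refine ⟨σ, h1, ?_, ?_⟩
  · intro u hu n
    have hu' : s u ∈ Icc b e := him ▸ mem_image_of_mem s hu
    rw [h2 _ hu', hs.section_eq u hu]
  · intro θ hθ
    refine h3 θ fun n hn => ?_
    rw [← him] at hn
    obtain ⟨u, hu, hun⟩ := hn
    exact hθ u hu ⟨-n, by rw [hun]; push_cast; ring⟩

/-- A homeomorphism of the line that moves `a` to `a'` and fixes everything outside `(p, q)`. -/
theorem exists_line_shift {p q a a' : ℝ} (ha : a ∈ Ioo p q) (ha' : a' ∈ Ioo p q) :
    ∃ γ : ℝ → ℝ, Continuous γ ∧ StrictMono γ ∧ γ a = a' ∧ ∀ u, u ∉ Ioo p q → γ u = u := by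
  obtain ⟨h1, h2⟩ := ha
  obtain ⟨h1', h2'⟩ := ha'
  -- A tent with peak 1 at a and zeros at p and q. Then u + (a' − a) f(u) is piecewise affine with
  -- positive slopes because a' also lies in (p, q).
  set f : ℝ → ℝ := fun u => max 0 (min ((u - p) / (a - p)) ((q - u) / (q - a))) with hf
  have hap : 0 < a - p := by linarith
  have hqa : 0 < q - a := by linarith
  have hleft : ∀ u, p ≤ u → u ≤ a → f u = (u - p) / (a - p) := by
    intro u hu hua
    have : (u - p) / (a - p) ≤ (q - u) / (q - a) := by
      calc (u - p) / (a - p) ≤ 1 := by rw [div_le_one hap]; linarith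
        _ ≤ _ := by rw [one_le_div hqa]; linarith
    simp only [hf]
    rw [min_eq_left this, max_eq_right (div_nonneg (by linarith) hap.le)]
  have hright : ∀ u, a ≤ u → u ≤ q → f u = (q - u) / (q - a) := by
    intro u hu hua
    have : (q - u) / (q - a) ≤ (u - p) / (a - p) := by
      calc (q - u) / (q - a) ≤ 1 := by rw [div_le_one hqa]; linarith
        _ ≤ _ := by rw [one_le_div hap]; linarith
    simp only [hf]
    rw [min_eq_right this, max_eq_right (div_nonneg (by linarith) hqa.le)]
  have hout : ∀ u, u ≤ p ∨ q ≤ u → f u = 0 := by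
    rintro u (hu | hu)
    · simp only [hf]
      exact max_eq_left ((min_le_left _ _).trans (div_nonpos_of_nonpos_of_nonneg (by linarith) hap.le))
    · simp only [hf]
      exact max_eq_left ((min_le_right _ _).trans (div_nonpos_of_nonpos_of_nonneg (by linarith) hqa.le))
  have e1 : ∀ u, p ≤ u → u ≤ a → u + (a' - a) * f u = p + (u - p) * ((a' - p) / (a - p)) := by
    intro u hu hua
    rw [hleft u hu hua]; field_simp; ring
  have e2 : ∀ u, a ≤ u → u ≤ q → u + (a' - a) * f u = q - (q - u) * ((q - a') / (q - a)) := by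
    intro u hu hua
    rw [hright u hu hua]; field_simp; ring
  have c1 : 0 < (a' - p) / (a - p) := div_pos (by linarith) hap
  have c2 : 0 < (q - a') / (q - a) := div_pos (by linarith) hqa
  refine ⟨fun u => u + (a' - a) * f u, by fun_prop, ?_, ?_, ?_⟩
  · have m0 : StrictMonoOn (fun u => u + (a' - a) * f u) (Iic p) := by
      intro u hu v hv huv
      simp only [hout u (Or.inl hu), hout v (Or.inl hv)]; linarith
    have m1 : StrictMonoOn (fun u => u + (a' - a) * f u) (Icc p a) := by
      intro u hu v hv huv
      simp only [e1 u hu.1 hu.2, e1 v hv.1 hv.2]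
      have := mul_lt_mul_of_pos_right (by linarith : u - p < v - p) c1
      linarith
    have m2 : StrictMonoOn (fun u => u + (a' - a) * f u) (Icc a q) := by
      intro u hu v hv huv
      simp only [e2 u hu.1 hu.2, e2 v hv.1 hv.2]
      have := mul_lt_mul_of_pos_right (by linarith : q - v < q - u) c2
      linarith
    have m3 : StrictMonoOn (fun u => u + (a' - a) * f u) (Ici q) := by
      intro u hu v hv huv
      simp only [hout u (Or.inr hu), hout v (Or.inr hv)]; linarith
    have m01 := m0.union m1 isGreatest_Iic (isLeast_Icc h1.le)
    rw [Iic_union_Icc_eq_Iic h1.le] at m01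
    have m012 := m01.union m2 isGreatest_Iic (isLeast_Icc h2.le)
    rw [Iic_union_Icc_eq_Iic h2.le] at m012
    exact m012.Iic_union_Ici m3
  · simp only [hleft a h1.le le_rfl, div_self hap.ne']; ring
  · intro u hu
    have : f u = 0 := by
      apply hout
      by_contra hcon
      push Not at hcon
      exact hu ⟨hcon.1, hcon.2⟩
    simp [this]

/-- Over `I` the strand `A` is above `B` before `a`, meets it at `a`, and is below it after `a`. -/
def CrossesAt (w A B : ℝ → ℝ) (I : Set ℝ) (a : ℝ) : Prop :=
  ∀ u ∈ I, (u < a → w (B u) < w (A u)) ∧ (u = a → w (A u) = w (B u)) ∧ (a < u → w (A u) < w (B u))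

/-- The parameters `s` and `t` lie over the same point of `I` on the strands `A` and `B`. -/
def OnStrands (x A B : ℝ → ℝ) (I : Set ℝ) (s t : ℝ) : Prop :=
  x s ∈ I ∧ x s = x t ∧ SameCirclePoint (A (x s)) s ∧ SameCirclePoint (B (x s)) t

theorem IsStrand.isOpen_image {x s : ℝ → ℝ} {p q : ℝ} (hpq : p ≤ q)
    (px : Function.Periodic x 1) (h : IsStrand x s (Icc p q)) : IsOpen (s '' Ioo p q) := by
  have hpm : p ∈ Icc p q := left_mem_Icc.mpr hpq
  have hqm : q ∈ Icc p q := right_mem_Icc.mpr hpq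
  obtain ⟨b, e, -, -, him, ⟨hm, h1, h2⟩ | ⟨hm, h1, h2⟩⟩ := h.image_Icc hpq px
  · have : s '' Ioo p q = Ioo b e := by
      apply Subset.antisymm
      · rintro _ ⟨u, hu, rfl⟩
        have hu' := Ioo_subset_Icc_self hu
        exact ⟨h1 ▸ hm hpm hu' hu.1, h2 ▸ hm hu' hqm hu.2⟩
      · intro θ hθ
        obtain ⟨u, hu, rfl⟩ : θ ∈ s '' Icc p q := him ▸ Ioo_subset_Icc_self hθ
        rw [← h1, ← h2] at hθ
        exact ⟨u, ⟨(hm.lt_iff_lt hpm hu).1 hθ.1, (hm.lt_iff_lt hu hqm).1 hθ.2⟩, rfl⟩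
    rw [this]; exact isOpen_Ioo
  · have : s '' Ioo p q = Ioo b e := by
      apply Subset.antisymm
      · rintro _ ⟨u, hu, rfl⟩
        have hu' := Ioo_subset_Icc_self hu
        exact ⟨h2 ▸ hm hu' hqm hu.2, h1 ▸ hm hpm hu' hu.1⟩
      · intro θ hθ
        obtain ⟨u, hu, rfl⟩ : θ ∈ s '' Icc p q := him ▸ Ioo_subset_Icc_self hθ
        rw [← h1, ← h2] at hθ
        exact ⟨u, ⟨(hm.lt_iff_gt hu hpm).1 hθ.2, (hm.lt_iff_gt hqm hu).1 hθ.1⟩, rfl⟩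
    rw [this]; exact isOpen_Ioo

theorem isOpen_sameCirclePoint {U : Set ℝ} (hU : IsOpen U) :
    IsOpen {θ | ∃ s ∈ U, SameCirclePoint s θ} := by
  have : {θ | ∃ s ∈ U, SameCirclePoint s θ} = ⋃ n : ℤ, (fun θ : ℝ => θ - n) ⁻¹' U := by
    ext θ
    simp only [mem_ofPred_eq, mem_iUnion, mem_preimage]
    constructor
    · rintro ⟨s, hs, n, rfl⟩
      exact ⟨n, by simpa using hs⟩
    · rintro ⟨n, hn⟩
      exact ⟨_, hn, n, by ring⟩
  rw [this]
  exact isOpen_iUnion fun n => hU.preimage (by fun_prop)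

/-- If no other strand lies between two strands `A`, `B` over the interval from `a` to `a'`, then
their crossing can be moved from `a` to `a'` by an ambient isotopy. -/
theorem exists_slide {x w A B : ℝ → ℝ} (hx : Continuous x) (px : Function.Periodic x 1)
    (hw : Continuous w) (pw : Function.Periodic w 1) {p q a a' : ℝ}
    (hA : IsStrand x A (Icc p q)) (hB : IsStrand x B (Icc p q)) (ha : a ∈ Ioo p q)
    (ha' : a' ∈ Ioo p q) (hAB : ∀ u ∈ Icc p q, ¬ SameCirclePoint (A u) (B u))
    (hcr : CrossesAt w A B (Icc p q) a)
    (hfree : ∀ u ∈ uIcc a a', ∀ θ, x θ = u → w θ ∈ uIcc (w (A u)) (w (B u)) →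
      SameCirclePoint (A u) θ ∨ SameCirclePoint (B u) θ)
    {R : ℝ → ℝ → Prop}
    (hR : ∀ s t s' t', OnStrands x A B (Icc p q) s t → OnStrands x A B (Icc p q) s' t' →
      (R s t ↔ R s' t') ∧ (R t s ↔ R t' s')) :
    ∃ w' : ℝ → ℝ, Continuous w' ∧ Function.Periodic w' 1 ∧ CrossesAt w' A B (Icc p q) a' ∧
      (∀ s t, x s = x t → ¬ OnStrands x A B (Icc p q) s t → ¬ OnStrands x A B (Icc p q) t s →
        (w s < w t ↔ w' s < w' t)) ∧
      PlanarIsotopic ⟨fun θ => (x θ, w θ), R⟩ ⟨fun θ => (x θ, w' θ), R⟩ := by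
  -- Heights are first normalised vertically so that, over an interval slightly larger than the one
  -- from a to a', the strands A and B lie in the band |w1| < 1 and everything else lies in |w1| >
  -- 1. Then A and B are moved sideways by γ. At each height this keeps the horizontal order: a
  -- point of the closed band that does not move lies over a point fixed by γ. A reparametrization σ
  -- finally restores the abscissas.
  have hpq : p ≤ q := (ha.1.trans ha.2).le
  -- straightening functions
  set cl : ℝ → ℝ := fun u => max p (min q u) with hcl
  have hclm : ∀ u, cl u ∈ Icc p q := fun u => ⟨le_max_left _ _, max_le hpq (min_le_left _ _)⟩
  have hclc : Continuous cl := by fun_prop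
  have hclid : ∀ u ∈ Icc p q, cl u = u := fun u h => by
    simp only [hcl]; rw [min_eq_right h.2, max_eq_right h.1]
  have hAc : Continuous fun u => w (A (cl u)) := hw.comp (hA.continuousOn.comp_continuous hclc hclm)
  have hBc : Continuous fun u => w (B (cl u)) := hw.comp (hB.continuousOn.comp_continuous hclc hclm)
  set m : ℝ → ℝ := fun u => (w (A (cl u)) + w (B (cl u))) / 2 with hm
  set d : ℝ → ℝ := fun u => |w (A (cl u)) - w (B (cl u))| / 2 with hd
  have hmc : Continuous m := (hAc.add hBc).div_const 2
  have hdc : Continuous d := (hAc.sub hBc).abs.div_const 2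
  have hd0 : ∀ u, 0 ≤ d u := fun u => by positivity
  have hdA : ∀ u ∈ Icc p q, |w (A u) - m u| ≤ d u := by
    intro u hu
    simp only [hm, hd, hclid u hu]
    rw [show w (A u) - (w (A u) + w (B u)) / 2 = (w (A u) - w (B u)) / 2 by ring, abs_div,
      abs_two]
  have hdB : ∀ u ∈ Icc p q, |w (B u) - m u| ≤ d u := by
    intro u hu
    simp only [hm, hd, hclid u hu]
    rw [show w (B u) - (w (A u) + w (B u)) / 2 = -((w (A u) - w (B u)) / 2) by ring, abs_neg,
      abs_div, abs_two]
  have huIcc : ∀ u ∈ Icc p q, ∀ v, |v - m u| ≤ d u → v ∈ uIcc (w (A u)) (w (B u)) := by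
    intro u hu v hv
    simp only [hm, hd, hclid u hu] at hv
    rw [mem_uIcc]
    rw [abs_le] at hv
    rcases le_total (w (A u)) (w (B u)) with h | h
    · rw [abs_of_nonpos (by linarith)] at hv
      left; constructor <;> linarith [hv.1, hv.2]
    · rw [abs_of_nonneg (by linarith)] at hv
      right; constructor <;> linarith [hv.1, hv.2]
  -- points on the two strands
  set On : Set ℝ := {θ | ∃ s ∈ A '' Ioo p q ∪ B '' Ioo p q, SameCirclePoint s θ} with hOn
  have hOno : IsOpen On :=
    isOpen_sameCirclePoint ((hA.isOpen_image hpq px).union (hB.isOpen_image hpq px))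
  have hOnper : ∀ θ θ', SameCirclePoint θ θ' → θ ∈ On → θ' ∈ On := by
    rintro θ θ' h ⟨s, hs, hs'⟩
    exact ⟨s, hs, hs'.trans h⟩
  have hOnmem : ∀ u ∈ Ioo p q, ∀ θ, SameCirclePoint (A u) θ ∨ SameCirclePoint (B u) θ →
      θ ∈ On := by
    rintro u hu θ (h | h)
    · exact ⟨A u, Or.inl ⟨u, hu, rfl⟩, h⟩
    · exact ⟨B u, Or.inr ⟨u, hu, rfl⟩, h⟩
  have hxeq : ∀ u ∈ Icc p q, ∀ θ, SameCirclePoint (A u) θ ∨ SameCirclePoint (B u) θ →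
      x θ = u := by
    rintro u hu θ (h | h)
    · rw [← h.periodic_eq px, hA.section_eq u hu]
    · rw [← h.periodic_eq px, hB.section_eq u hu]
  have hOnx : ∀ θ ∈ On, x θ ∈ Ioo p q ∧
      (SameCirclePoint (A (x θ)) θ ∨ SameCirclePoint (B (x θ)) θ) := by
    rintro θ ⟨s, (⟨u, hu, rfl⟩ | ⟨u, hu, rfl⟩), h⟩
    · have := hxeq u (Ioo_subset_Icc_self hu) θ (Or.inl h)
      rw [this]; exact ⟨hu, Or.inl h⟩
    · have := hxeq u (Ioo_subset_Icc_self hu) θ (Or.inr h)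
      rw [this]; exact ⟨hu, Or.inr h⟩
  have hothc : IsCompact (Icc (0 : ℝ) 1 ∩ Onᶜ) := isCompact_Icc.inter_right hOno.isClosed_compl
  have haa : uIcc a a' ⊆ Ioo p q := (ordConnected_Ioo).uIcc_subset ha ha'
  have hbadc : IsCompact (x '' ((Icc (0 : ℝ) 1 ∩ Onᶜ) ∩ {θ | |w θ - m (x θ)| ≤ d (x θ)})) :=
    (hothc.inter_right (isClosed_le (by fun_prop) (by fun_prop))).image hx
  -- The abscissas at which a third strand enters the closed region between A and B. This set is
  -- compact and misses the interval from a to a', hence also a neighbourhood of it.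
  set T := x '' ((Icc (0 : ℝ) 1 ∩ Onᶜ) ∩ {θ | |w θ - m (x θ)| ≤ d (x θ)}) with hT
  have hsub : uIcc a a' ⊆ Ioo p q ∩ Tᶜ := by
    intro u hu
    refine ⟨haa hu, ?_⟩
    rintro ⟨θ, ⟨⟨-, h1⟩, h2⟩, rfl⟩
    have hxI := haa hu
    exact h1 (hOnmem _ hxI θ (hfree _ hu θ rfl (huIcc _ (Ioo_subset_Icc_self hxI) _ h2)))
  obtain ⟨δ, hδ, hδs⟩ := isCompact_uIcc.exists_cthickening_subset_open
    (isOpen_Ioo.inter hbadc.isClosed.isOpen_compl) hsub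
  set p1 := min a a' - δ with hp1
  set q1 := max a a' + δ with hq1
  have hle : min a a' ≤ max a a' := min_le_max
  have hI1 : Icc p1 q1 ⊆ Ioo p q ∩ Tᶜ := by
    intro u hu
    apply hδs
    rcases le_total u (min a a') with h1 | h1
    · refine Metric.mem_cthickening_of_dist_le u (min a a') δ _ ⟨le_rfl, hle⟩ ?_
      rw [Real.dist_eq, abs_le]; constructor <;> linarith [hu.1]
    rcases le_total (max a a') u with h2 | h2
    · refine Metric.mem_cthickening_of_dist_le u (max a a') δ _ ⟨hle, le_rfl⟩ ?_
      rw [Real.dist_eq, abs_le]; constructor <;> linarith [hu.2]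
    · exact Metric.mem_cthickening_of_dist_le u u δ _ ⟨h1, h2⟩ (by simp [hδ.le])
  have ha1 : a ∈ Ioo p1 q1 := ⟨by linarith [min_le_left a a'], by linarith [le_max_left a a']⟩
  have ha1' : a' ∈ Ioo p1 q1 := ⟨by linarith [min_le_right a a'], by linarith [le_max_right a a']⟩
  have hpq1 : p1 ≤ q1 := (ha1.1.trans ha1.2).le
  have hIoo : ∀ u ∈ Icc p1 q1, u ∈ Ioo p q := fun u hu => (hI1 hu).1
  have hIcc : ∀ u ∈ Icc p1 q1, u ∈ Icc p q := fun u hu => Ioo_subset_Icc_self (hIoo u hu)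
  -- the gap
  obtain ⟨η, hη, hgap⟩ : ∃ η > 0, ∀ θ ∈ (Icc (0 : ℝ) 1 ∩ Onᶜ) ∩ x ⁻¹' Icc p1 q1,
      η ≤ |w θ - m (x θ)| - d (x θ) := by
    refine (hothc.inter_right (isClosed_Icc.preimage hx)).exists_forall_le'
      (f := fun θ => |w θ - m (x θ)| - d (x θ)) (by fun_prop) ?_
    rintro θ ⟨h1, h2⟩
    by_contra h3
    exact (hI1 h2).2 ⟨θ, ⟨h1, by simp only [mem_ofPred_eq]; linarith⟩, rfl⟩
  -- The summand η/2 keeps the denominator positive at the crossing, where d = 0, and lies strictly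
  -- between the bound d for A and B and the bound d + η for all other strands.
  set w1 : ℝ → ℝ := fun θ => (w θ - m (x θ)) / (d (x θ) + η / 2) with hw1
  have hden : ∀ u, 0 < d u + η / 2 := fun u => by have := hd0 u; linarith
  have hw1c : Continuous w1 := by
    simp only [hw1]
    exact Continuous.div (by fun_prop) (by fun_prop) fun θ => (hden _).ne'
  have pw1 : Function.Periodic w1 1 := fun θ => by simp only [hw1, px θ, pw θ]
  have horder : ∀ s t, x s = x t → (w s < w t ↔ w1 s < w1 t) := by
    intro s t hst
    simp only [hw1, hst]
    rw [div_lt_div_iff_of_pos_right (hden _)]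
    constructor <;> intro h <;> linarith
  have hin : ∀ u ∈ Icc p q, ∀ θ, SameCirclePoint (A u) θ ∨ SameCirclePoint (B u) θ →
      |w1 θ| < 1 := by
    intro u hu θ h
    have h1 := hxeq u hu θ h
    have h2 : |w θ - m (x θ)| ≤ d (x θ) := by
      rw [h1]
      rcases h with h | h
      · rw [← h.periodic_eq pw]; exact hdA u hu
      · rw [← h.periodic_eq pw]; exact hdB u hu
    simp only [hw1]
    rw [abs_div, abs_of_pos (hden _), div_lt_one (hden _)]
    linarith
  have hout : ∀ θ, x θ ∈ Icc p1 q1 → θ ∉ On → 1 < |w1 θ| := by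
    intro θ h1 h2
    have hs := SameCirclePoint.fract θ
    rw [hs.periodic_eq pw1]
    rw [hs.periodic_eq px] at h1
    have := hgap (Int.fract θ) ⟨⟨⟨Int.fract_nonneg _, (Int.fract_lt_one _).le⟩,
      fun h3 => h2 (hOnper _ _ hs.symm h3)⟩, h1⟩
    simp only [hw1]
    rw [abs_div, abs_of_pos (hden _), one_lt_div (hden _)]
    linarith
  -- the shift
  obtain ⟨γ, hγ, hγm, hγa, hγout⟩ := exists_line_shift ha1 ha1'
  have hγp : γ p1 = p1 := hγout p1 (by simp)
  have hγq : γ q1 = q1 := hγout q1 (by simp)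
  have hγI : ∀ u ∈ Icc p1 q1, γ u ∈ Icc p1 q1 := fun u hu =>
    ⟨hγp ▸ hγm.monotone hu.1, hγq ▸ hγm.monotone hu.2⟩
  have hγsurj : ∀ u ∈ Icc p1 q1, ∃ v ∈ Icc p1 q1, γ v = u := by
    intro u hu
    have := intermediate_value_Icc hpq1 hγ.continuousOn
    rw [hγp, hγq] at this
    exact this hu
  have hIs : Icc p1 q1 ⊆ Icc p q := fun u hu => hIcc u hu
  obtain ⟨σA, hA1, hA2, hA3⟩ := exists_strand_shift hpq1 hx px (hA.mono hIs) hγ hγm hγp hγq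
  obtain ⟨σB, hB1, hB2, hB3⟩ := exists_strand_shift hpq1 hx px (hB.mono hIs) hγ hγm hγp hγq
  have hABne : ∀ u ∈ Icc p q, ∀ v ∈ Icc p q, ∀ θ, SameCirclePoint (A u) θ →
      ¬ SameCirclePoint (B v) θ := by
    intro u hu v hv θ h1 h2
    have : u = v := by rw [← hxeq u hu θ (Or.inl h1), hxeq v hv θ (Or.inr h2)]
    subst this
    exact hAB u hu (h1.trans h2.symm)
  -- The strands are disjoint on the circle, so each factor fixes the points moved by the other.
  set σ : ℝ ≃o ℝ := σA.trans σB with hσ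
  have hσ1 : ∀ θ, σ (θ + 1) = σ θ + 1 := fun θ => by simp [hσ, hA1, hB1]
  have hσA : ∀ u ∈ Icc p1 q1, ∀ n : ℤ, σ (A u + n) = A (γ u) + n := by
    intro u hu n
    simp only [hσ, OrderIso.trans_apply]
    rw [hA2 u hu n]
    exact hB3 _ fun v hv => hABne (γ u) (hIcc _ (hγI u hu)) v (hIcc v hv) _ ⟨n, rfl⟩
  have hσB : ∀ u ∈ Icc p1 q1, ∀ n : ℤ, σ (B u + n) = B (γ u) + n := by
    intro u hu n
    simp only [hσ, OrderIso.trans_apply]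
    rw [hA3 (B u + n) fun v hv h => hABne v (hIcc v hv) u (hIcc u hu) _ h ⟨n, rfl⟩]
    exact hB2 u hu n
  set Mv : Set ℝ := {θ | x θ ∈ Icc p1 q1 ∧ θ ∈ On} with hMv
  have hMvmem : ∀ u ∈ Icc p1 q1, ∀ θ, SameCirclePoint (A u) θ ∨ SameCirclePoint (B u) θ →
      θ ∈ Mv := fun u hu θ h =>
    ⟨by rw [hxeq u (hIcc u hu) θ h]; exact hu, hOnmem u (hIoo u hu) θ h⟩
  have hσfix : ∀ θ, θ ∉ Mv → σ θ = θ := by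
    intro θ hθ
    simp only [hσ, OrderIso.trans_apply]
    rw [hA3 θ fun u hu h => hθ (hMvmem u hu θ (Or.inl h))]
    exact hB3 θ fun u hu h => hθ (hMvmem u hu θ (Or.inr h))
  have hσMvA : ∀ θ ∈ Mv, SameCirclePoint (A (x θ)) θ →
      SameCirclePoint (A (γ (x θ))) (σ θ) := by
    rintro θ hθ ⟨n, hn⟩
    exact ⟨n, by conv_lhs => rw [hn, hσA _ hθ.1]⟩
  have hσMvB : ∀ θ ∈ Mv, SameCirclePoint (B (x θ)) θ →
      SameCirclePoint (B (γ (x θ))) (σ θ) := by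
    rintro θ hθ ⟨n, hn⟩
    exact ⟨n, by conv_lhs => rw [hn, hσB _ hθ.1]⟩
  have hσMv : ∀ θ ∈ Mv, x (σ θ) = γ (x θ) ∧ σ θ ∈ Mv := by
    intro θ hθ
    have h1 : SameCirclePoint (A (γ (x θ))) (σ θ) ∨ SameCirclePoint (B (γ (x θ))) (σ θ) :=
      (hOnx θ hθ.2).2.imp (hσMvA θ hθ) (hσMvB θ hθ)
    have h2 := hγI _ hθ.1
    exact ⟨hxeq _ (hIcc _ h2) _ h1, hMvmem _ h2 _ h1⟩
  have hσMv' : ∀ θ, σ θ ∈ Mv → θ ∈ Mv := by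
    intro θ h
    by_contra h1
    rw [hσfix θ h1] at h
    exact h1 h
  have hMv1 : ∀ θ ∈ Mv, |w1 θ| < 1 := fun θ hθ =>
    hin _ (hIcc _ hθ.1) θ (hOnx θ hθ.2).2
  -- Every point either follows γ or is at rest outside the closed band. Two points at the same
  -- height are therefore of the same kind or both at rest.
  have hdich : ∀ θ, x (σ θ) = γ (x θ) ∨ (θ ∉ Mv ∧ 1 < |w1 θ|) := by
    intro θ
    by_cases h1 : θ ∈ Mv
    · exact Or.inl (hσMv θ h1).1
    by_cases h2 : x θ ∈ Icc p1 q1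
    · exact Or.inr ⟨h1, hout θ h2 fun h3 => h1 ⟨h2, h3⟩⟩
    · left
      rw [hσfix θ h1, hγout _ fun h3 => h2 (Ioo_subset_Icc_self h3)]
  have hhor : ∀ s t, w1 s = w1 t → (x s < x t ↔ x (σ s) < x (σ t)) := by
    intro s t hst
    have hfixes : ∀ s t, w1 s = w1 t → (t ∉ Mv ∧ 1 < |w1 t|) →
        (x (σ s) = x s ∧ x (σ t) = x t) := by
      intro s t hst h
      have : s ∉ Mv := fun h1 => by
        have := hMv1 s h1
        rw [hst] at this; linarith [h.2]
      rw [hσfix s this, hσfix t h.1]; exact ⟨rfl, rfl⟩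
    rcases hdich t with ht | ht
    · rcases hdich s with hs | hs
      · rw [hs, ht, hγm.lt_iff_lt]
      · have := hfixes t s hst.symm hs
        rw [this.1, this.2]
    · have := hfixes s t hst ht
      rw [this.1, this.2]
  have hσcont : Continuous σ := σ.continuous
  have hσscont : Continuous σ.symm := σ.symm.continuous
  have hσs1 : ∀ θ, σ.symm (θ + 1) = σ.symm θ + 1 := by
    intro θ
    rw [OrderIso.symm_apply_eq, hσ1, OrderIso.apply_symm_apply]
  have hσssMv : ∀ θ ∈ Mv, σ.symm θ ∈ Mv := fun θ h => hσMv' _ (by simpa using h)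
  have hσsfix : ∀ θ, θ ∉ Mv → σ.symm θ = θ := fun θ h => by
    rw [OrderIso.symm_apply_eq, hσfix θ h]
  have pxσ : Function.Periodic (fun θ => x (σ θ)) 1 := fun θ => by simp only [hσ1, px (σ θ)]
  have pw' : Function.Periodic (fun θ => w1 (σ.symm θ)) 1 := fun θ => by
    simp only [hσs1, pw1 (σ.symm θ)]
  -- The moved curve is (x ∘ σ, w1); reparametrizing by the inverse of σ gives back the abscissa x
  -- and puts σ⁻¹ into the height.
  refine ⟨fun θ => w1 (σ.symm θ), hw1c.comp hσscont, pw', ?_, ?_, ?_⟩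
  · intro u hu
    by_cases hu1 : u ∈ Icc p1 q1
    · obtain ⟨v, hv, rfl⟩ := hγsurj u hu1
      have e1 : σ.symm (A (γ v)) = A v := by
        rw [OrderIso.symm_apply_eq]; simpa using (hσA v hv 0).symm
      have e2 : σ.symm (B (γ v)) = B v := by
        rw [OrderIso.symm_apply_eq]; simpa using (hσB v hv 0).symm
      have hvI := hIcc v hv
      have hxAB : x (A v) = x (B v) := by rw [hA.section_eq v hvI, hB.section_eq v hvI]
      have h3 := hcr v hvI
      dsimp only
      rw [e1, e2, ← hγa, hγm.lt_iff_lt, hγm.lt_iff_lt, hγm.injective.eq_iff,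
        ← horder _ _ hxAB, ← horder _ _ hxAB.symm]
      refine ⟨h3.1, fun h => ?_, h3.2.2⟩
      have := h3.2.1 h
      simp only [hw1, hxAB, this]
    · have h1 : A u ∉ Mv := fun h => hu1 (by have := h.1; rwa [hA.section_eq u hu] at this)
      have h2 : B u ∉ Mv := fun h => hu1 (by have := h.1; rwa [hB.section_eq u hu] at this)
      have hxAB : x (A u) = x (B u) := by rw [hA.section_eq u hu, hB.section_eq u hu]
      have h3 := hcr u hu
      dsimp only
      rw [hσsfix _ h1, hσsfix _ h2, ← horder _ _ hxAB, ← horder _ _ hxAB.symm]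
      have h4 : u < p1 ∨ q1 < u := by
        by_contra h; push Not at h; exact hu1 h
      refine ⟨fun h => h3.1 ?_, fun h => ?_, fun h => h3.2.2 ?_⟩
      · rcases h4 with h4 | h4
        · linarith [ha1.1]
        · linarith [ha1'.2]
      · exfalso
        rw [h] at hu1
        exact hu1 (Ioo_subset_Icc_self ha1')
      · rcases h4 with h4 | h4
        · linarith [ha1'.1]
        · linarith [ha1.2]
  · intro s t hst h1 h2
    rw [horder s t hst]
    have mixed : ∀ s t, x s = x t → s ∈ Mv → t ∉ Mv → |w1 s| < 1 ∧ |w1 (σ.symm s)| < 1 ∧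
        σ.symm t = t ∧ 1 < |w1 t| := by
      intro s t hst hs ht
      refine ⟨hMv1 s hs, hMv1 _ (hσssMv s hs), hσsfix t ht, ?_⟩
      have : x t ∈ Icc p1 q1 := hst ▸ hs.1
      exact hout t this fun h => ht ⟨this, h⟩
    by_cases hs : s ∈ Mv <;> by_cases ht : t ∈ Mv
    · have hsame : SameCirclePoint s t := by
        rcases (hOnx s hs.2).2 with h3 | h3 <;> rcases (hOnx t ht.2).2 with h4 | h4
        · rw [← hst] at h4; exact h3.symm.trans h4
        · rw [← hst] at h4
          exact absurd ⟨hIcc _ hs.1, hst, h3, h4⟩ h1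
        · rw [hst] at h3
          exact absurd ⟨hIcc _ ht.1, hst.symm, h4, h3⟩ h2
        · rw [← hst] at h4; exact h3.symm.trans h4
      have e1 := hsame.periodic_eq pw1
      have e2 := hsame.periodic_eq pw'
      dsimp only at e2 ⊢
      rw [e1, e2]
      simp
    · obtain ⟨h3, h4, h5, h6⟩ := mixed s t hst hs ht
      simp only [h5]
      rw [abs_lt] at h3 h4
      rcases lt_abs.mp h6 with h7 | h7
      · exact ⟨fun _ => by linarith [h4.2], fun _ => by linarith [h3.2]⟩
      · exact ⟨fun _ => by linarith [h3.1], fun _ => by linarith [h4.1]⟩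
    · obtain ⟨h3, h4, h5, h6⟩ := mixed t s hst.symm ht hs
      simp only [h5]
      rw [abs_lt] at h3 h4
      rcases lt_abs.mp h6 with h7 | h7
      · exact ⟨fun _ => by linarith [h3.2], fun _ => by linarith [h4.2]⟩
      · exact ⟨fun _ => by linarith [h4.1], fun _ => by linarith [h3.1]⟩
    · simp only [hσsfix s hs, hσsfix t ht]
  · refine (PlanarIsotopic.of_vertical_order hx hw hw1c px pw pw1 horder
      (fun s t _ _ _ => Iff.rfl)).trans ?_
    refine (PlanarIsotopic.of_horizontal_order hw1c hx (hx.comp hσcont) pw1 px pxσ hhor R).trans ?_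
    refine PlanarIsotopic.of_reparam σ hσcont σ.strictMono hσ1 (fun θ => by simp) ?_
    rintro s t ⟨hne, hc⟩
    have hc1 : x (σ s) = x (σ t) := (Prod.ext_iff.mp hc).1
    have hc2 : w1 s = w1 t := (Prod.ext_iff.mp hc).2
    have hst : x s = x t := by
      apply le_antisymm
      · rw [← not_lt, hhor t s hc2.symm, hc1]; simp
      · rw [← not_lt, hhor s t hc2, hc1]; simp
    have hiff : ∀ s t, x s = x t → w1 s = w1 t → s ∈ Mv → t ∈ Mv := by
      intro s t hst hw hs
      have h1 : x t ∈ Icc p1 q1 := hst ▸ hs.1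
      refine ⟨h1, ?_⟩
      by_contra h2
      have := hout t h1 h2
      have := hMv1 s hs
      rw [hw] at this; linarith
    by_cases hs : s ∈ Mv
    · have ht := hiff s t hst hc2 hs
      have hγx := hIcc _ (hγI _ hs.1)
      have hγx' := hIcc _ (hγI _ ht.1)
      rcases (hOnx s hs.2).2 with h3 | h3 <;> rcases (hOnx t ht.2).2 with h4 | h4
      · rw [← hst] at h4; exact absurd (h3.symm.trans h4) hne
      · refine (hR s t (σ s) (σ t) ⟨hIcc _ hs.1, hst, h3, hst ▸ h4⟩ ?_).1
        rw [OnStrands, (hσMv s hs).1]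
        refine ⟨hγx, by rw [(hσMv t ht).1, hst], hσMvA s hs h3, ?_⟩
        rw [hst]; exact hσMvB t ht h4
      · refine (hR t s (σ t) (σ s) ⟨hIcc _ ht.1, hst.symm, h4, hst ▸ h3⟩ ?_).2
        rw [OnStrands, (hσMv t ht).1]
        refine ⟨hγx', by rw [(hσMv s hs).1, hst], hσMvA t ht h4, ?_⟩
        rw [← hst]; exact hσMvB s hs h3
      · rw [← hst] at h4; exact absurd (h3.symm.trans h4) hne
    · have ht : t ∉ Mv := fun ht => hs (hiff t s hst.symm hc2.symm ht)
      rw [hσfix s hs, hσfix t ht]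

/-- Two strands over a compact interval along which a crossing is to be moved from `a` to `a'`. -/
structure IsSlide (x w A B : ℝ → ℝ) (R : ℝ → ℝ → Prop) (p q a a' : ℝ) : Prop where
  strandA : IsStrand x A (Icc p q)
  strandB : IsStrand x B (Icc p q)
  mem : a ∈ Ioo p q
  mem' : a' ∈ Ioo p q
  ne : ∀ u ∈ Icc p q, ¬ SameCirclePoint (A u) (B u)
  crosses : CrossesAt w A B (Icc p q) a
  free : ∀ u ∈ uIcc a a', ∀ θ, x θ = u → w θ ∈ uIcc (w (A u)) (w (B u)) →
    SameCirclePoint (A u) θ ∨ SameCirclePoint (B u) θ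
  rel : ∀ s t s' t', OnStrands x A B (Icc p q) s t → OnStrands x A B (Icc p q) s' t' →
    (R s t ↔ R s' t') ∧ (R t s ↔ R t' s')

/-- Several crossings on disjoint pairs of strands can be moved. -/
theorem exists_slides {x w : ℝ → ℝ} (hx : Continuous x) (px : Function.Periodic x 1)
    (hw : Continuous w) (pw : Function.Periodic w 1) {ι : Type*} (S : Finset ι)
    {A B : ι → ℝ → ℝ} {p q a a' : ι → ℝ} {R : ℝ → ℝ → Prop}
    (hS : ∀ i ∈ S, IsSlide x w (A i) (B i) R (p i) (q i) (a i) (a' i))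
    (hdisj : ∀ i ∈ S, ∀ j ∈ S, ∀ θ, x θ ∈ Icc (p i) (q i) → x θ ∈ Icc (p j) (q j) →
      (SameCirclePoint (A i (x θ)) θ ∨ SameCirclePoint (B i (x θ)) θ) →
      (SameCirclePoint (A j (x θ)) θ ∨ SameCirclePoint (B j (x θ)) θ) → i = j) :
    ∃ w' : ℝ → ℝ, Continuous w' ∧ Function.Periodic w' 1 ∧
      (∀ i ∈ S, CrossesAt w' (A i) (B i) (Icc (p i) (q i)) (a' i)) ∧
      (∀ s t, x s = x t → (∀ i ∈ S, ¬ OnStrands x (A i) (B i) (Icc (p i) (q i)) s t ∧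
          ¬ OnStrands x (A i) (B i) (Icc (p i) (q i)) t s) → (w s < w t ↔ w' s < w' t)) ∧
      PlanarIsotopic ⟨fun θ => (x θ, w θ), R⟩ ⟨fun θ => (x θ, w' θ), R⟩ := by
  classical
  induction S using Finset.induction_on with
  | empty =>
    exact ⟨w, hw, pw, by simp, fun _ _ _ _ => Iff.rfl,
      PlanarIsotopic.of_curve_eq (fun _ => rfl) fun _ _ _ => Iff.rfl⟩
  | insert i S hi ih =>
    obtain ⟨w1, hw1, pw1, hc1, ho1, hiso1⟩ := ih
      (fun j hj => hS j (Finset.mem_insert_of_mem hj))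
      (fun j hj k hk => hdisj j (Finset.mem_insert_of_mem hj) k (Finset.mem_insert_of_mem hk))
    have hi' := hS i (Finset.mem_insert_self i S)
    -- a point on a strand of `i` is on no strand of `j`
    have hoff : ∀ s t, x s = x t → x s ∈ Icc (p i) (q i) →
        (SameCirclePoint (A i (x s)) s ∨ SameCirclePoint (B i (x s)) s) →
        ∀ j ∈ S, ¬ OnStrands x (A j) (B j) (Icc (p j) (q j)) s t ∧
          ¬ OnStrands x (A j) (B j) (Icc (p j) (q j)) t s := by
      intro s t hst hI hs j hj
      have hne : i ≠ j := fun h => hi (h ▸ hj)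
      have hd := hdisj i (Finset.mem_insert_self i S) j (Finset.mem_insert_of_mem hj) s hI
      constructor
      · rintro ⟨h1, -, h2, -⟩
        exact hne (hd h1 hs (Or.inl h2))
      · rintro ⟨h1, h2, -, h3⟩
        rw [h2] at h1 h3
        exact hne (hd h1 hs (Or.inr h3))
    have hxA : ∀ u ∈ Icc (p i) (q i), x (A i u) = u := hi'.strandA.section_eq
    have hxB : ∀ u ∈ Icc (p i) (q i), x (B i u) = u := hi'.strandB.section_eq
    -- Since the pairs are disjoint, the earlier slides change no comparison that involves a strand
    -- of i, so the hypotheses on i survive from w to w1.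
    have hordA : ∀ u ∈ Icc (p i) (q i), ∀ θ, x θ = u →
        (w (A i u) < w θ ↔ w1 (A i u) < w1 θ) ∧ (w θ < w (A i u) ↔ w1 θ < w1 (A i u)) := by
      intro u hu θ hθ
      have h1 := hoff (A i u) θ (by rw [hxA u hu, hθ]) (by rwa [hxA u hu])
        (Or.inl (by rw [hxA u hu]; exact SameCirclePoint.refl _))
      exact ⟨ho1 _ _ (by rw [hxA u hu, hθ]) h1,
        ho1 _ _ (by rw [hxA u hu, hθ]) fun j hj => (h1 j hj).symm⟩
    have hordB : ∀ u ∈ Icc (p i) (q i), ∀ θ, x θ = u →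
        (w (B i u) < w θ ↔ w1 (B i u) < w1 θ) ∧ (w θ < w (B i u) ↔ w1 θ < w1 (B i u)) := by
      intro u hu θ hθ
      have h1 := hoff (B i u) θ (by rw [hxB u hu, hθ]) (by rwa [hxB u hu])
        (Or.inr (by rw [hxB u hu]; exact SameCirclePoint.refl _))
      exact ⟨ho1 _ _ (by rw [hxB u hu, hθ]) h1,
        ho1 _ _ (by rw [hxB u hu, hθ]) fun j hj => (h1 j hj).symm⟩
    have hcr1 : CrossesAt w1 (A i) (B i) (Icc (p i) (q i)) (a i) := by
      intro u hu
      have h1 := hordA u hu (B i u) (hxB u hu)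
      have h2 := hi'.crosses u hu
      refine ⟨fun h => h1.2.1 (h2.1 h), fun h => ?_, fun h => h1.1.1 (h2.2.2 h)⟩
      have h3 := h2.2.1 h
      apply le_antisymm
      · rw [← not_lt, ← h1.2, h3]; simp
      · rw [← not_lt, ← h1.1, h3]; simp
    have hfree1 : ∀ u ∈ uIcc (a i) (a' i), ∀ θ, x θ = u →
        w1 θ ∈ uIcc (w1 (A i u)) (w1 (B i u)) →
        SameCirclePoint (A i u) θ ∨ SameCirclePoint (B i u) θ := by
      intro u hu θ hθ hm
      have huI : u ∈ Icc (p i) (q i) := ordConnected_Icc.uIcc_subset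
        (Ioo_subset_Icc_self hi'.mem) (Ioo_subset_Icc_self hi'.mem') hu
      refine hi'.free u hu θ hθ ?_
      have h1 := hordA u huI θ hθ
      have h2 := hordB u huI θ hθ
      rw [mem_uIcc] at hm ⊢
      simp only [← not_lt] at hm ⊢
      rw [h1.1, h1.2, h2.1, h2.2]
      exact hm
    obtain ⟨w2, hw2, pw2, hc2, ho2, hiso2⟩ := exists_slide hx px hw1 pw1 hi'.strandA hi'.strandB
      hi'.mem hi'.mem' hi'.ne hcr1 hfree1 hi'.rel
    refine ⟨w2, hw2, pw2, ?_, ?_, hiso1.trans hiso2⟩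
    · intro j hj
      rcases Finset.mem_insert.mp hj with rfl | hj
      · exact hc2
      · have hne : j ≠ i := fun h => hi (h ▸ hj)
        have hj' := hS j (Finset.mem_insert_of_mem hj)
        intro u hu
        have hxA' := hj'.strandA.section_eq u hu
        have hxB' := hj'.strandB.section_eq u hu
        have hoffi : ¬ OnStrands x (A i) (B i) (Icc (p i) (q i)) (A j u) (B j u) ∧
            ¬ OnStrands x (A i) (B i) (Icc (p i) (q i)) (B j u) (A j u) := by
          constructor
          · rintro ⟨h1, h2, h3, h4⟩
            refine hne (hdisj j (Finset.mem_insert_of_mem hj) i (Finset.mem_insert_self i S)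
              (A j u) (by rwa [hxA']) h1 (Or.inl ?_) (Or.inl h3))
            rw [hxA']; exact SameCirclePoint.refl _
          · rintro ⟨h1, h2, h3, h4⟩
            refine hne (hdisj j (Finset.mem_insert_of_mem hj) i (Finset.mem_insert_self i S)
              (B j u) (by rwa [hxB']) h1 (Or.inr ?_) (Or.inl h3))
            rw [hxB']; exact SameCirclePoint.refl _
        have hxx : x (A j u) = x (B j u) := by rw [hxA', hxB']
        have h5 := ho2 _ _ hxx hoffi.1 hoffi.2
        have h6 := ho2 _ _ hxx.symm hoffi.2 hoffi.1
        have h7 := hc1 j hj u hu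
        refine ⟨fun h => h6.1 (h7.1 h), fun h => ?_, fun h => h5.1 (h7.2.2 h)⟩
        have h8 := h7.2.1 h
        apply le_antisymm
        · rw [← not_lt, ← h6, h8]; simp
        · rw [← not_lt, ← h5, h8]; simp
    · intro s t hst h
      rw [ho1 s t hst fun j hj => h j (Finset.mem_insert_of_mem hj)]
      have := h i (Finset.mem_insert_self i S)
      exact ho2 s t hst this.1 this.2

/-! ### Local structure of a front -/

/-- The coordinate functions of a Legendrian knot with generic front, at class `C^1`. -/
structure FrontCurve (x y z : ℝ → ℝ) : Prop where
  hx : ContDiff ℝ 1 x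
  hy : ContDiff ℝ 1 y
  hz : ContDiff ℝ 1 z
  px : Function.Periodic x 1
  py : Function.Periodic y 1
  pz : Function.Periodic z 1
  leg : ∀ θ, deriv z θ = y θ * deriv x θ
  imm : ∀ θ, deriv x θ = 0 → deriv y θ ≠ 0
  emb : ∀ s t, x s = x t → y s = y t → z s = z t → SameCirclePoint s t
  fin : {θ ∈ Ico (0 : ℝ) 1 | deriv x θ = 0}.Finite
  no_triple : ∀ s t u, x s = x t → z s = z t → x s = x u → z s = z u →
    SameCirclePoint s t ∨ SameCirclePoint s u ∨ SameCirclePoint t u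
  cusp_simple : ∀ c t, IsLocalExtr x c → x c = x t → z c = z t → SameCirclePoint c t

theorem deriv_periodic {f : ℝ → ℝ} (hf : Function.Periodic f 1) :
    Function.Periodic (deriv f) 1 := by
  intro θ
  have : f = fun t => f (t + 1) := by ext t; exact (hf t).symm
  conv_rhs => rw [this]
  rw [deriv_comp_add_const]

theorem isLocalExtr_of_sameCirclePoint {f : ℝ → ℝ} (hf : Function.Periodic f 1) {s t : ℝ}
    (h : SameCirclePoint s t) :
    (IsLocalMax f s → IsLocalMax f t) ∧ (IsLocalMin f s → IsLocalMin f t) := by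
  obtain ⟨n, rfl⟩ := h
  have hn : ∀ θ, f (θ - n) = f θ := fun θ =>
    SameCirclePoint.periodic_eq hf ⟨n, by ring⟩
  have ht : Tendsto (fun θ : ℝ => θ - n) (𝓝 (s + n)) (𝓝 s) := by
    have : Continuous fun θ : ℝ => θ - n := by fun_prop
    simpa using this.tendsto (s + n)
  have hs : f (s + n) = f s := by rw [← hn (s + n)]; simp
  constructor
  · intro h
    have := ht.eventually h
    filter_upwards [this] with θ hθ
    rw [hs, ← hn θ]; exact hθ
  · intro h
    have := ht.eventually h
    filter_upwards [this] with θ hθ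
    rw [hs, ← hn θ]; exact hθ

/-- Rolle: two points with equal value enclose a local extremum. -/
theorem injOn_Icc_of_no_extr {x : ℝ → ℝ} (hx : Continuous x) {α β : ℝ}
    (h : ∀ θ ∈ Ioo α β, ¬ IsLocalExtr x θ) : InjOn x (Icc α β) := by
  have key : ∀ s ∈ Icc α β, ∀ t ∈ Icc α β, s < t → x s ≠ x t := by
    intro s hs t ht hst heq
    obtain ⟨c, hc, hc'⟩ := exists_isLocalExtr_Ioo hst hx.continuousOn heq
    exact h c ⟨hs.1.trans_lt hc.1, hc.2.trans_le ht.2⟩ hc'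
  intro s hs t ht heq
  rcases lt_trichotomy s t with h1 | h1 | h1
  · exact absurd heq (key s hs t ht h1)
  · exact h1
  · exact absurd heq.symm (key t ht s hs h1)

/-- An arc on which `x` is injective is a strand. -/
theorem exists_strand {x : ℝ → ℝ} (hx : Continuous x) {α β : ℝ} (h : InjOn x (Icc α β)) :
    ∃ s, IsStrand x s (x '' Icc α β) ∧ (∀ u ∈ x '' Icc α β, s u ∈ Icc α β) ∧
      ∀ θ ∈ Icc α β, s (x θ) = θ := by
  set s := Function.invFunOn x (Icc α β) with hs
  have h1 : ∀ u ∈ x '' Icc α β, s u ∈ Icc α β ∧ x (s u) = u := fun u hu =>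
    Function.invFunOn_pos hu
  have h2 : ∀ θ ∈ Icc α β, s (x θ) = θ := fun θ hθ => h.leftInvOn_invFunOn hθ
  refine ⟨s, ⟨?_, fun u hu => (h1 u hu).2⟩, fun u hu => (h1 u hu).1, h2⟩
  rw [continuousOn_iff_isClosed]
  intro C hC
  refine ⟨x '' (Icc α β ∩ C), ((isCompact_Icc.inter_right hC).image hx).isClosed, ?_⟩
  ext u
  constructor
  · rintro ⟨hu, hu'⟩
    exact ⟨⟨s u, ⟨(h1 u hu').1, hu⟩, (h1 u hu').2⟩, hu'⟩
  · rintro ⟨⟨θ, hθ, rfl⟩, hu'⟩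
    refine ⟨?_, hu'⟩
    rw [mem_preimage, h2 θ hθ.1]; exact hθ.2

/-- Height against slope over an arc whose endpoints have the same abscissa. -/
theorem height_of_arc {x y z : ℝ → ℝ} (hx : ContDiff ℝ 1 x) (hy : ContDiff ℝ 1 y)
    (hz : ContDiff ℝ 1 z) (leg : ∀ θ, deriv z θ = y θ * deriv x θ) {s t xc : ℝ} (hst : s < t)
    (hy' : ∀ θ ∈ Icc s t, 0 < deriv y θ) (he : x s = x t) (hlt : ∀ θ ∈ Ioo s t, x s < x θ)
    (hle : ∀ θ ∈ Ioo s t, x θ ≤ xc) :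
    y s < y t ∧ z t < z s ∧ z s - z t ≤ (xc - x s) * (y t - y s) := by
  have dx := hx.differentiable one_ne_zero
  have dy := hy.differentiable one_ne_zero
  have dz := hz.differentiable one_ne_zero
  have hys : StrictMonoOn y (Icc s t) := by
    refine strictMonoOn_of_deriv_pos (convex_Icc _ _) hy.continuous.continuousOn ?_
    intro θ hθ
    exact hy' θ (interior_subset hθ)
  have hsm : s ∈ Icc s t := left_mem_Icc.mpr hst.le
  have htm : t ∈ Icc s t := right_mem_Icc.mpr hst.le
  -- Integration by parts turns dz = y dx into d(z − y(x − K)) = −(x − K) dy. The base K = x s gives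
  -- the sign of the height difference, K = xc its size. No second derivative of x occurs, which is
  -- why class C^1 suffices at a cusp.
  have hk : ∀ K θ, HasDerivAt (fun θ => z θ - y θ * (x θ - K)) (-(deriv y θ * (x θ - K))) θ := by
    intro K θ
    have := (dz θ).hasDerivAt.sub ((dy θ).hasDerivAt.mul ((dx θ).hasDerivAt.sub_const K))
    refine this.congr_deriv ?_
    rw [leg]; ring
  refine ⟨hys hsm htm hst, ?_, ?_⟩
  · have : StrictAntiOn (fun θ => z θ - y θ * (x θ - x s)) (Icc s t) := by
      refine strictAntiOn_of_deriv_neg (convex_Icc _ _)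
        (fun θ _ => (hk _ θ).continuousAt.continuousWithinAt) ?_
      intro θ hθ
      rw [interior_Icc] at hθ
      rw [(hk _ θ).deriv, neg_lt_zero]
      exact mul_pos (hy' θ (Ioo_subset_Icc_self hθ)) (sub_pos.mpr (hlt θ hθ))
    have := this hsm htm hst
    simp only [he, sub_self, mul_zero, sub_zero] at this
    exact this
  · have : MonotoneOn (fun θ => z θ - y θ * (x θ - xc)) (Icc s t) := by
      refine monotoneOn_of_deriv_nonneg (convex_Icc _ _)
        (fun θ _ => (hk _ θ).continuousAt.continuousWithinAt)
        (fun θ _ => (hk _ θ).differentiableAt.differentiableWithinAt) ?_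
      intro θ hθ
      rw [interior_Icc] at hθ
      rw [(hk _ θ).deriv, neg_nonneg]
      exact mul_nonpos_of_nonneg_of_nonpos (hy' θ (Ioo_subset_Icc_self hθ)).le
        (sub_nonpos.mpr (hle θ hθ))
    have := this hsm htm hst.le
    simp only [← he] at this
    nlinarith

/-- The height along a monotone arc, in terms of bounds for the slope. -/
theorem height_of_monotone {x y z : ℝ → ℝ} (hx : ContDiff ℝ 1 x)
    (hz : ContDiff ℝ 1 z) (leg : ∀ θ, deriv z θ = y θ * deriv x θ) {α β K L : ℝ}
    (hinj : InjOn x (Icc α β)) (hy : ∀ θ ∈ Icc α β, K ≤ y θ ∧ y θ ≤ L) {s t : ℝ}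
    (hs : s ∈ Icc α β) (ht : t ∈ Icc α β) (hst : x s ≤ x t) :
    K * (x t - x s) ≤ z t - z s ∧ z t - z s ≤ L * (x t - x s) := by
  have dx := hx.differentiable one_ne_zero
  have dz := hz.differentiable one_ne_zero
  -- The function z − Kx has derivative (y − K)x', of constant sign because x is monotone on the
  -- arc.
  have hk : ∀ K θ, HasDerivAt (fun θ => z θ - K * x θ) ((y θ - K) * deriv x θ) θ := by
    intro K θ
    have := (dz θ).hasDerivAt.sub ((dx θ).hasDerivAt.const_mul K)
    refine this.congr_deriv ?_
    rw [leg]; ring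
  have hmono : ∀ K, (∀ θ ∈ Ioo α β, 0 ≤ (y θ - K) * deriv x θ) →
      MonotoneOn (fun θ => z θ - K * x θ) (Icc α β) := by
    intro K h
    refine monotoneOn_of_deriv_nonneg (convex_Icc _ _)
      (fun θ _ => (hk _ θ).continuousAt.continuousWithinAt)
      (fun θ _ => (hk _ θ).differentiableAt.differentiableWithinAt) ?_
    intro θ hθ
    rw [interior_Icc] at hθ
    rw [(hk _ θ).deriv]; exact h θ hθ
  have hanti : ∀ K, (∀ θ ∈ Ioo α β, (y θ - K) * deriv x θ ≤ 0) →
      AntitoneOn (fun θ => z θ - K * x θ) (Icc α β) := by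
    intro K h
    refine antitoneOn_of_deriv_nonpos (convex_Icc _ _)
      (fun θ _ => (hk _ θ).continuousAt.continuousWithinAt)
      (fun θ _ => (hk _ θ).differentiableAt.differentiableWithinAt) ?_
    intro θ hθ
    rw [interior_Icc] at hθ
    rw [(hk _ θ).deriv]; exact h θ hθ
  have hαβ : α ≤ β := hs.1.trans hs.2
  have hnhds : ∀ θ ∈ Ioo α β, Icc α β ∈ 𝓝 θ := fun θ hθ => Icc_mem_nhds hθ.1 hθ.2
  rcases hx.continuous.continuousOn.strictMonoOn_of_injOn_Icc' hαβ hinj with hm | hm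
  · have hle : s ≤ t := (hm.le_iff_le hs ht).1 hst
    have hd : ∀ θ ∈ Ioo α β, 0 ≤ deriv x θ := by
      intro θ hθ
      have := hm.monotoneOn.derivWithin_nonneg (x := θ)
      rwa [derivWithin_of_mem_nhds (hnhds θ hθ)] at this
    have h1 := hmono K (fun θ hθ => mul_nonneg
      (sub_nonneg.mpr (hy θ (Ioo_subset_Icc_self hθ)).1) (hd θ hθ)) hs ht hle
    have h2 := hanti L (fun θ hθ => mul_nonpos_of_nonpos_of_nonneg
      (sub_nonpos.mpr (hy θ (Ioo_subset_Icc_self hθ)).2) (hd θ hθ)) hs ht hle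
    simp only at h1 h2
    constructor <;> linarith
  · have hle : t ≤ s := (hm.le_iff_ge hs ht).1 hst
    have hd : ∀ θ ∈ Ioo α β, deriv x θ ≤ 0 := by
      intro θ hθ
      have := hm.antitoneOn.derivWithin_nonpos (x := θ)
      rwa [derivWithin_of_mem_nhds (hnhds θ hθ)] at this
    have h1 := hanti K (fun θ hθ => mul_nonpos_of_nonneg_of_nonpos
      (sub_nonneg.mpr (hy θ (Ioo_subset_Icc_self hθ)).1) (hd θ hθ)) ht hs hle
    have h2 := hmono L (fun θ hθ => mul_nonneg_of_nonpos_of_nonpos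
      (sub_nonpos.mpr (hy θ (Ioo_subset_Icc_self hθ)).2) (hd θ hθ)) ht hs hle
    simp only at h1 h2
    constructor <;> linarith

namespace FrontCurve

variable {x y z : ℝ → ℝ}

/-- Reflection `(x, y, z) ↦ (x, -y, -z)`. -/
theorem neg_yz (h : FrontCurve x y z) :
    FrontCurve x (fun θ => -y θ) (fun θ => -z θ) where
  hx := h.hx
  hy := h.hy.neg
  hz := h.hz.neg
  px := h.px
  py θ := by simp [h.py θ]
  pz θ := by simp [h.pz θ]
  leg θ := by simp [deriv.fun_neg, h.leg]
  imm θ hθ := by simpa [deriv.fun_neg] using h.imm θ hθ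
  emb s t h1 h2 h3 := h.emb s t h1 (neg_injective h2) (neg_injective h3)
  fin := h.fin
  no_triple s t u h1 h2 h3 h4 := h.no_triple s t u h1 (neg_injective h2) h3 (neg_injective h4)
  cusp_simple c t h1 h2 h3 := h.cusp_simple c t h1 h2 (neg_injective h3)

/-- Critical points of `x` are isolated. -/
theorem exists_no_critical (h : FrontCurve x y z) (θ₀ : ℝ) :
    ∃ δ > 0, ∀ θ, |θ - θ₀| < δ → θ ≠ θ₀ → deriv x θ ≠ 0 := by
  -- Near θ₀ only translates of the critical points in [0, 1) by a few integers around ⌊θ₀⌋ can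
  -- occur.
  have hfin : {θ | deriv x θ = 0 ∧ |θ - θ₀| < 1 ∧ θ ≠ θ₀}.Finite := by
    have h1 : (⋃ n ∈ Icc (⌊θ₀⌋ - 2) (⌊θ₀⌋ + 2),
        (fun θ : ℝ => θ + n) '' {θ ∈ Ico (0 : ℝ) 1 | deriv x θ = 0}).Finite :=
      (Set.finite_Icc _ _).biUnion fun n _ => h.fin.image _
    refine h1.subset ?_
    rintro θ ⟨h2, h3, -⟩
    simp only [mem_iUnion]
    refine ⟨⌊θ⌋, ?_, Int.fract θ, ⟨⟨Int.fract_nonneg _, Int.fract_lt_one _⟩, ?_⟩,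
      Int.fract_add_floor θ⟩
    · rw [abs_lt] at h3
      have a1 := Int.floor_le θ₀
      have a2 := Int.lt_floor_add_one θ₀
      constructor
      · rw [Int.le_floor]; push_cast; linarith
      · have : ⌊θ⌋ < ⌊θ₀⌋ + 3 := by rw [Int.floor_lt]; push_cast; linarith
        omega
    · rw [← h2]; exact ((SameCirclePoint.fract θ).periodic_eq (deriv_periodic h.px)).symm
  have hopen : {θ | deriv x θ = 0 ∧ |θ - θ₀| < 1 ∧ θ ≠ θ₀}ᶜ ∈ 𝓝 θ₀ :=
    hfin.isClosed.isOpen_compl.mem_nhds (by simp)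
  obtain ⟨δ, hδ, hb⟩ := Metric.mem_nhds_iff.mp hopen
  refine ⟨min δ 1, lt_min hδ one_pos, fun θ h1 h2 h3 => ?_⟩
  exact hb (show θ ∈ Metric.ball θ₀ δ from by
    rw [Metric.mem_ball, Real.dist_eq]; exact h1.trans_le (min_le_left _ _))
    ⟨h3, h1.trans_le (min_le_right _ _), h2⟩

/-- Genericity allows critical points of x that are not cusps. Since critical points are isolated,
no nearby point is an extremum, and x is still injective across such a point. -/
theorem exists_injOn_of_not_extr (h : FrontCurve x y z) {θ₀ : ℝ} (h0 : ¬ IsLocalExtr x θ₀) :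
    ∃ δ > 0, InjOn x (Icc (θ₀ - δ) (θ₀ + δ)) := by
  obtain ⟨δ, hδ, hb⟩ := h.exists_no_critical θ₀
  refine ⟨δ, hδ, injOn_Icc_of_no_extr h.hx.continuous ?_⟩
  intro θ hθ he
  by_cases h1 : θ = θ₀
  · exact h0 (h1 ▸ he)
  · exact hb θ (by rw [abs_lt]; constructor <;> linarith [hθ.1, hθ.2]) h1 he.deriv_eq_zero

end FrontCurve

theorem strictMonoOn_left_of_isLocalMax {x : ℝ → ℝ} (hx : Continuous x) {α c : ℝ} (hα : α < c)
    (h : ∀ θ ∈ Ioo α c, ¬ IsLocalExtr x θ) (hc : IsLocalMax x c) : StrictMonoOn x (Icc α c) := by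
  refine (hx.continuousOn.strictMonoOn_of_injOn_Icc' hα.le
    (injOn_Icc_of_no_extr hx h)).resolve_right fun hm => ?_
  have h1 : ∀ᶠ θ in 𝓝[<] c, θ ∈ Ioo α c := Ioo_mem_nhdsLT hα
  have h2 : ∀ᶠ θ in 𝓝[<] c, x θ ≤ x c := hc.filter_mono nhdsWithin_le_nhds
  obtain ⟨θ, h3, h4⟩ := (h1.and h2).exists
  exact absurd h4 (not_le.mpr (hm (Ioo_subset_Icc_self h3) (right_mem_Icc.mpr hα.le) h3.2))

theorem strictAntiOn_right_of_isLocalMax {x : ℝ → ℝ} (hx : Continuous x) {c β : ℝ} (hβ : c < β)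
    (h : ∀ θ ∈ Ioo c β, ¬ IsLocalExtr x θ) (hc : IsLocalMax x c) : StrictAntiOn x (Icc c β) := by
  refine (hx.continuousOn.strictMonoOn_of_injOn_Icc' hβ.le
    (injOn_Icc_of_no_extr hx h)).resolve_left fun hm => ?_
  have h1 : ∀ᶠ θ in 𝓝[>] c, θ ∈ Ioo c β := Ioo_mem_nhdsGT hβ
  have h2 : ∀ᶠ θ in 𝓝[>] c, x θ ≤ x c := hc.filter_mono nhdsWithin_le_nhds
  obtain ⟨θ, h3, h4⟩ := (h1.and h2).exists
  exact absurd h4 (not_le.mpr (hm (left_mem_Icc.mpr hβ.le) (Ioo_subset_Icc_self h3) h3.1))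

/-! ### Crossings and right cusps as features -/

/-- Two strands `A`, `B` of a front over `[p, q)`, with the slope of `A` smaller, which meet
over `e`, in a crossing (`e < q`) or in a right cusp (`e = q`). -/
structure IsFeature (x y z : ℝ → ℝ) (e p q : ℝ) (A B : ℝ → ℝ) : Prop where
  lt : p < e
  le : e ≤ q
  strandA : IsStrand x A (Ico p q)
  strandB : IsStrand x B (Ico p q)
  y_lt : ∀ u ∈ Ico p q, y (A u) < y (B u)
  crosses : CrossesAt z A B (Ico p q) e
  steep : ∀ K : ℝ, ∀ᶠ u in 𝓝[<] e, K * (z (A u) - z (B u)) < y (B u) - y (A u)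

theorem IsFeature.restrict {x y z : ℝ → ℝ} {e p q : ℝ} {A B : ℝ → ℝ}
    (h : IsFeature x y z e p q A B) {p' : ℝ} (h1 : p ≤ p') (h2 : p' < e) :
    IsFeature x y z e p' q A B := by
  have hs : Ico p' q ⊆ Ico p q := Ico_subset_Ico_left h1
  exact ⟨h2, h.le, h.strandA.mono hs, h.strandB.mono hs, fun u hu => h.y_lt u (hs hu),
    fun u hu => h.crosses u (hs hu), h.steep⟩

/-- The height gap is at most e − u times the slope gap, so `steep` holds once e − u < 1/(|K| + 1).
The interval ends at e, so nothing is required at or after the cusp. -/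
theorem IsFeature.of_cusp {x y z : ℝ → ℝ} {e p : ℝ} {A B : ℝ → ℝ} (hp : p < e)
    (hA : IsStrand x A (Ico p e)) (hB : IsStrand x B (Ico p e))
    (H : ∀ u ∈ Ico p e, y (A u) < y (B u) ∧ z (B u) < z (A u) ∧
      z (A u) - z (B u) ≤ (e - u) * (y (B u) - y (A u))) : IsFeature x y z e p e A B := by
  refine ⟨hp, le_rfl, hA, hB, fun u hu => (H u hu).1, fun u hu => ⟨fun _ => (H u hu).2.1,
    fun h => absurd hu.2 (by simp [h]), fun h => absurd hu.2 (by simp [h.le])⟩, fun K => ?_⟩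
  have h1 : ∀ᶠ u in 𝓝[<] e, u ∈ Ioo (max p (e - 1 / (|K| + 1))) e := by
    refine Ioo_mem_nhdsLT (max_lt hp ?_)
    have : 0 < 1 / (|K| + 1) := by positivity
    linarith
  filter_upwards [h1] with u hu
  obtain ⟨h2, h3, h4⟩ := H u ⟨(le_max_left _ _).trans hu.1.le, hu.2⟩
  have h5 : e - u < 1 / (|K| + 1) := by
    have := (le_max_right p (e - 1 / (|K| + 1))).trans_lt hu.1
    linarith
  rw [lt_div_iff₀ (by positivity)] at h5
  have h6 : 0 < y (B u) - y (A u) := by linarith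
  have h7 : 0 < e - u := by linarith [hu.2]
  calc K * (z (A u) - z (B u)) ≤ |K| * (z (A u) - z (B u)) :=
        mul_le_mul_of_nonneg_right (le_abs_self K) (by linarith)
    _ ≤ |K| * ((e - u) * (y (B u) - y (A u))) := mul_le_mul_of_nonneg_left h4 (abs_nonneg _)
    _ = (|K| * (e - u)) * (y (B u) - y (A u)) := by ring
    _ < 1 * (y (B u) - y (A u)) := mul_lt_mul_of_pos_right (by nlinarith) h6
    _ = _ := one_mul _

/-- The slopes stay apart by at least K' − L, while the height gap is at most linear in the distance
to e; close to e the slopes dominate. -/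
theorem IsFeature.of_crossing {x y z : ℝ → ℝ} {e p q : ℝ} {A B : ℝ → ℝ} (hp : p < e) (hq : e < q)
    (hA : IsStrand x A (Ico p q)) (hB : IsStrand x B (Ico p q)) {K L K' L' : ℝ} (hL : L < K')
    (hyA : ∀ u ∈ Ico p q, K ≤ y (A u) ∧ y (A u) ≤ L)
    (hyB : ∀ u ∈ Ico p q, K' ≤ y (B u) ∧ y (B u) ≤ L')
    (hzA : ∀ u ∈ Ico p q, ∀ v ∈ Ico p q, u ≤ v →
      K * (v - u) ≤ z (A v) - z (A u) ∧ z (A v) - z (A u) ≤ L * (v - u))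
    (hzB : ∀ u ∈ Ico p q, ∀ v ∈ Ico p q, u ≤ v →
      K' * (v - u) ≤ z (B v) - z (B u) ∧ z (B v) - z (B u) ≤ L' * (v - u))
    (he : z (A e) = z (B e)) : IsFeature x y z e p q A B := by
  have hem : e ∈ Ico p q := ⟨hp.le, hq⟩
  refine ⟨hp, hq.le, hA, hB, fun u hu => ?_, fun u hu => ⟨fun h => ?_, fun h => h ▸ he,
    fun h => ?_⟩, fun C => ?_⟩
  · linarith [(hyA u hu).2, (hyB u hu).1]
  · have := (hzA u hu e hem h.le).2
    have := (hzB u hu e hem h.le).1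
    nlinarith
  · have := (hzA e hem u hu h.le).2
    have := (hzB e hem u hu h.le).1
    nlinarith
  · set D := |C| * (|L' - K| + 1) + 1 with hD
    have hDpos : 0 < D := by positivity
    have h1 : ∀ᶠ u in 𝓝[<] e, u ∈ Ioo (max p (e - (K' - L) / D)) e := by
      refine Ioo_mem_nhdsLT (max_lt hp ?_)
      have : 0 < (K' - L) / D := div_pos (by linarith) hDpos
      linarith
    filter_upwards [h1] with u hu
    have hum : u ∈ Ico p q := ⟨(le_max_left _ _).trans hu.1.le, hu.2.trans hq⟩
    have h2 := (hzA u hum e hem hu.2.le)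
    have h3 := (hzB u hum e hem hu.2.le)
    have h4 := (hyA u hum).2
    have h5 := (hyB u hum).1
    have h6 : (e - u) * D < K' - L := by
      have := (le_max_right p (e - (K' - L) / D)).trans_lt hu.1
      rw [← lt_div_iff₀ hDpos]; linarith
    have h7 : 0 < e - u := by linarith [hu.2]
    have h8 : 0 ≤ z (A u) - z (B u) := by nlinarith
    have h9 : z (A u) - z (B u) ≤ (|L' - K| + 1) * (e - u) := by
      have := le_abs_self (L' - K)
      nlinarith
    calc C * (z (A u) - z (B u)) ≤ |C| * (z (A u) - z (B u)) :=
          mul_le_mul_of_nonneg_right (le_abs_self C) h8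
      _ ≤ |C| * ((|L' - K| + 1) * (e - u)) := mul_le_mul_of_nonneg_left h9 (abs_nonneg _)
      _ < y (B u) - y (A u) := by nlinarith

theorem exists_pos_of_eventually_nhds {P : ℝ → Prop} {a : ℝ} (h : ∀ᶠ θ in 𝓝 a, P θ) :
    ∃ δ > 0, ∀ θ, |θ - a| < δ → P θ := by
  obtain ⟨δ, hδ, hb⟩ := Metric.eventually_nhds_iff.mp h
  exact ⟨δ, hδ, fun θ hθ => hb (by rwa [Real.dist_eq])⟩

theorem exists_pos_of_eventually_nhds_Icc {P : ℝ → Prop} {a : ℝ} (h : ∀ᶠ θ in 𝓝 a, P θ) :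
    ∃ δ > 0, ∀ θ ∈ Icc (a - δ) (a + δ), P θ := by
  obtain ⟨δ, hδ, hb⟩ := exists_pos_of_eventually_nhds h
  exact ⟨δ / 2, by positivity, fun θ hθ => hb θ (by
    rw [abs_lt]; constructor <;> linarith [hθ.1, hθ.2])⟩

namespace FrontCurve

variable {x y z : ℝ → ℝ}

/-- The pairs of branches at a right cusp. -/
theorem exists_right_cusp_window (h : FrontCurve x y z) {c : ℝ} (hc : IsLocalMax x c) {ρ : ℝ}
    (hρ : 0 < ρ) :
    ∃ δ > 0, δ < ρ ∧ StrictMonoOn x (Icc (c - δ) c) ∧ StrictAntiOn x (Icc c (c + δ)) ∧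
      ((∀ s ∈ Icc (c - δ) c, ∀ t ∈ Icc c (c + δ), x s = x t → x s < x c →
          y s < y t ∧ z t < z s ∧ z s - z t ≤ (x c - x s) * (y t - y s)) ∨
        (∀ s ∈ Icc (c - δ) c, ∀ t ∈ Icc c (c + δ), x s = x t → x s < x c →
          y t < y s ∧ z s < z t ∧ z t - z s ≤ (x c - x s) * (y s - y t))) := by
  have key : ∀ {y z : ℝ → ℝ}, FrontCurve x y z → 0 < deriv y c →
    ∃ δ > 0, δ < ρ ∧ StrictMonoOn x (Icc (c - δ) c) ∧ StrictAntiOn x (Icc c (c + δ)) ∧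
      (∀ s ∈ Icc (c - δ) c, ∀ t ∈ Icc c (c + δ), x s = x t → x s < x c →
          y s < y t ∧ z t < z s ∧ z s - z t ≤ (x c - x s) * (y t - y s)) := by
    intro y z h hy'
    obtain ⟨δ₁, hδ₁, h1⟩ := h.exists_no_critical c
    have hcont : Continuous (deriv y) := h.hy.continuous_deriv le_rfl
    obtain ⟨δ₂, hδ₂, h2⟩ := exists_pos_of_eventually_nhds_Icc
      (hcont.continuousAt.eventually_const_lt hy')
    set δ := min (min δ₁ δ₂) (ρ / 2) with hδ
    have hδ1 : δ ≤ δ₁ := (min_le_left _ _).trans (min_le_left _ _)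
    have hδ2 : δ ≤ δ₂ := (min_le_left _ _).trans (min_le_right _ _)
    have hδ0 : 0 < δ := lt_min (lt_min hδ₁ hδ₂) (by linarith)
    have hm : StrictMonoOn x (Icc (c - δ) c) := by
      refine strictMonoOn_left_of_isLocalMax h.hx.continuous (by linarith) ?_ hc
      intro θ hθ he
      exact h1 θ (by rw [abs_lt]; constructor <;> linarith [hθ.1, hθ.2]) hθ.2.ne he.deriv_eq_zero
    have ha : StrictAntiOn x (Icc c (c + δ)) := by
      refine strictAntiOn_right_of_isLocalMax h.hx.continuous (by linarith) ?_ hc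
      intro θ hθ he
      exact h1 θ (by rw [abs_lt]; constructor <;> linarith [hθ.1, hθ.2]) hθ.1.ne' he.deriv_eq_zero
    refine ⟨δ, hδ0, lt_of_le_of_lt (min_le_right _ _) (by linarith), hm, ha, ?_⟩
    intro s hs t ht hst hsc
    have hcl : c ∈ Icc (c - δ) c := ⟨by linarith, le_rfl⟩
    have hcr : c ∈ Icc c (c + δ) := ⟨le_rfl, by linarith⟩
    have hs' : s < c := lt_of_le_of_ne hs.2 fun h => by rw [h] at hsc; exact lt_irrefl _ hsc
    refine height_of_arc h.hx h.hy h.hz h.leg (hs'.trans_le ht.1) ?_ hst ?_ ?_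
    · intro θ hθ
      exact h2 θ ⟨by linarith [hs.1, hθ.1], by linarith [ht.2, hθ.2]⟩
    · intro θ hθ
      rcases le_total θ c with h3 | h3
      · exact hm hs ⟨hs.1.trans hθ.1.le, h3⟩ hθ.1
      · rw [hst]; exact ha ⟨h3, hθ.2.le.trans ht.2⟩ ht hθ.2
    · intro θ hθ
      rcases le_total θ c with h3 | h3
      · exact hm.monotoneOn ⟨hs.1.trans hθ.1.le, h3⟩ hcl h3
      · exact ha.antitoneOn hcr ⟨h3, hθ.2.le.trans ht.2⟩ h3
  -- At a cusp x' = 0, so the immersion condition gives y' ≠ 0. The reflection `neg_yz` reduces the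
  -- negative sign to the positive one.
  have h0 : deriv y c ≠ 0 := h.imm c hc.deriv_eq_zero
  rcases h0.lt_or_gt with h0 | h0
  · obtain ⟨δ, h1, h2, h3, h4, h5⟩ := key h.neg_yz (by simpa [deriv.fun_neg] using h0)
    refine ⟨δ, h1, h2, h3, h4, Or.inr fun s hs t ht hst hsc => ?_⟩
    obtain ⟨h6, h7, h8⟩ := h5 s hs t ht hst hsc
    exact ⟨by linarith, by linarith, by linarith⟩
  · obtain ⟨δ, h1, h2, h3, h4, h5⟩ := key h h0
    exact ⟨δ, h1, h2, h3, h4, Or.inl h5⟩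

/-- Reflection `(x, y, z) ↦ (-x, y, -z)`. -/
theorem neg_xz (h : FrontCurve x y z) :
    FrontCurve (fun θ => -x θ) y (fun θ => -z θ) where
  hx := h.hx.neg
  hy := h.hy
  hz := h.hz.neg
  px θ := by simp [h.px θ]
  py := h.py
  pz θ := by simp [h.pz θ]
  leg θ := by simp [deriv.fun_neg, h.leg]
  imm θ hθ := h.imm θ (by simpa [deriv.fun_neg] using hθ)
  emb s t h1 h2 h3 := h.emb s t (neg_injective h1) h2 (neg_injective h3)
  fin := by simpa [deriv.fun_neg] using h.fin
  no_triple s t u h1 h2 h3 h4 := h.no_triple s t u (neg_injective h1) (neg_injective h2)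
    (neg_injective h3) (neg_injective h4)
  cusp_simple c t h1 h2 h3 := by
    refine h.cusp_simple c t ?_ (neg_injective h2) (neg_injective h3)
    rcases h1 with h1 | h1
    · right; simpa using h1.neg
    · left; simpa using h1.neg

/-- Near the diagonal, points of the front on one vertical line have different heights, and away
from right cusps the higher one has the larger slope. -/
theorem exists_diagonal_window (h : FrontCurve x y z) (θ₀ : ℝ) :
    ∃ η > 0, ∀ s t, |s - θ₀| < η → |t - θ₀| < η → x s = x t → s ≠ t →
      z s ≠ z t ∧ (¬ IsLocalMax x θ₀ → z s < z t → y s < y t) := by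
  by_cases h0 : IsLocalExtr x θ₀
  swap
  · obtain ⟨δ, hδ, hi⟩ := h.exists_injOn_of_not_extr h0
    refine ⟨δ, hδ, fun s t hs ht hst hne => absurd (hi ?_ ?_ hst) hne⟩
    · rw [abs_lt] at hs; constructor <;> linarith [hs.1, hs.2]
    · rw [abs_lt] at ht; constructor <;> linarith [ht.1, ht.2]
  -- A left cusp becomes a right cusp under the reflection `neg_xz`. It keeps y and reverses z, so
  -- at left cusps the higher branch has the larger slope instead of the smaller one.
  have sides : ∀ {x y z : ℝ → ℝ}, FrontCurve x y z → IsLocalMax x θ₀ →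
      ∃ η > 0, (∀ s t, |s - θ₀| < η → |t - θ₀| < η → x s = x t → s ≠ t →
        (z t < z s ∧ y s < y t) ∨ (z s < z t ∧ y t < y s)) := by
    intro x y z h hc
    obtain ⟨δ, hδ, -, hm, ha, H⟩ := h.exists_right_cusp_window hc one_pos
    have hcl : θ₀ ∈ Icc (θ₀ - δ) θ₀ := ⟨by linarith, le_rfl⟩
    have hcr : θ₀ ∈ Icc θ₀ (θ₀ + δ) := ⟨le_rfl, by linarith⟩
    have key : ∀ s t, |s - θ₀| < δ → |t - θ₀| < δ → x s = x t → s < t →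
        (z t < z s ∧ y s < y t) ∨ (z s < z t ∧ y t < y s) := by
      intro s t hs ht hst hlt
      rw [abs_lt] at hs ht
      have h1 : s < θ₀ := by
        by_contra h1
        push Not at h1
        exact hlt.ne (ha.injOn ⟨h1, by linarith⟩ ⟨by linarith, by linarith⟩ hst)
      have h2 : θ₀ < t := by
        by_contra h2
        push Not at h2
        exact hlt.ne (hm.injOn ⟨by linarith, h1.le⟩ ⟨by linarith, h2⟩ hst)
      have hsm : s ∈ Icc (θ₀ - δ) θ₀ := ⟨by linarith, h1.le⟩
      have htm : t ∈ Icc θ₀ (θ₀ + δ) := ⟨h2.le, by linarith⟩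
      have hsc := hm hsm hcl h1
      rcases H with H | H
      · have := H s hsm t htm hst hsc
        exact Or.inl ⟨this.2.1, this.1⟩
      · have := H s hsm t htm hst hsc
        exact Or.inr ⟨this.2.1, this.1⟩
    refine ⟨δ, hδ, fun s t hs ht hst hne => ?_⟩
    rcases hne.lt_or_gt with hlt | hlt
    · exact key s t hs ht hst hlt
    · exact (key t s ht hs hst.symm hlt).symm
  by_cases h1 : IsLocalMax x θ₀
  · obtain ⟨η, hη, H⟩ := sides h h1
    refine ⟨η, hη, fun s t hs ht hst hne => ⟨?_, fun h2 => absurd h1 h2⟩⟩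
    rcases H s t hs ht hst hne with h2 | h2
    · exact h2.1.ne'
    · exact h2.1.ne
  · have h2 : IsLocalMin x θ₀ := h0.resolve_right h1
    obtain ⟨η, hη, H⟩ := sides h.neg_xz (by simpa using h2.neg)
    refine ⟨η, hη, fun s t hs ht hst hne => ?_⟩
    rcases H s t hs ht (by simp [hst]) hne with h3 | h3
    · exact ⟨by intro h4; simp [h4] at h3, fun _ h4 => h3.2⟩
    · exact ⟨by intro h4; simp [h4] at h3, fun _ h4 => by linarith [h3.1]⟩

/-- The parameter pairs of the right cusps and the crossings of a front; at a crossing the strand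
of smaller slope comes first. -/
def _root_.IsFeaturePair (x y z : ℝ → ℝ) (i : ℝ × ℝ) : Prop :=
  x i.1 = x i.2 ∧ z i.1 = z i.2 ∧ ((i.1 = i.2 ∧ IsLocalMax x i.1) ∨ y i.1 < y i.2)

/-- No cusp lies on a crossing, so both strands are locally graphs over x, and holding each slope
within a third of the slope difference separates the two ranges. The last clause says that the
strands capture all pairs near the crossing that share an abscissa; the compactness argument in
`exists_featureSystem` needs it. -/
theorem exists_feature_crossing (h : FrontCurve x y z) {s₀ t₀ : ℝ} (hx0 : x s₀ = x t₀)
    (hz0 : z s₀ = z t₀) (hy0 : y s₀ < y t₀) {ρ : ℝ} (hρ : 0 < ρ) :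
    ∃ p q A B, IsFeature x y z (x s₀) p q A B ∧
      (∀ u ∈ Ico p q, |A u - s₀| < ρ ∧ |B u - t₀| < ρ) ∧ A (x s₀) = s₀ ∧ B (x s₀) = t₀ ∧
      x s₀ < q ∧
      ∀ p' ∈ Ico p (x s₀), ∃ η > 0, ∀ s t, |s - s₀| < η → |t - t₀| < η → x s = x t →
        OnStrands x A B (Ico p' q) s t := by
  have hns : ¬ SameCirclePoint s₀ t₀ := fun h1 => hy0.ne (h1.periodic_eq h.py)
  have hs : ¬ IsLocalExtr x s₀ := fun h1 => hns (h.cusp_simple _ _ h1 hx0 hz0)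
  have ht : ¬ IsLocalExtr x t₀ := fun h1 =>
    hns (h.cusp_simple _ _ h1 hx0.symm hz0.symm).symm
  have arc : ∀ c, ¬ IsLocalExtr x c → ∀ ε > 0, ∃ α β s, ∃ p q, α < c ∧ c < β ∧ p < x c ∧ x c < q ∧
      InjOn x (Icc α β) ∧ IsStrand x s (Icc p q) ∧ (∀ u ∈ Icc p q, s u ∈ Icc α β) ∧
      (∀ θ ∈ Icc α β, s (x θ) = θ) ∧
      (∀ θ ∈ Icc α β, |θ - c| < ρ ∧ y c - ε ≤ y θ ∧ y θ ≤ y c + ε) := by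
    intro c hc ε hε
    obtain ⟨δ₁, hδ₁, hi⟩ := h.exists_injOn_of_not_extr hc
    obtain ⟨δ₂, hδ₂, hy⟩ := exists_pos_of_eventually_nhds
      (h.hy.continuous.continuousAt.eventually_mem (Icc_mem_nhds (sub_lt_self (y c) hε)
        (lt_add_of_pos_right (y c) hε)))
    set δ := min δ₁ (min (δ₂ / 2) (ρ / 2)) with hδ
    have h0 : 0 < δ := lt_min hδ₁ (lt_min (by linarith) (by linarith))
    have h1 : δ ≤ δ₁ := min_le_left _ _
    have h2 : δ ≤ δ₂ / 2 := (min_le_right _ _).trans (min_le_left _ _)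
    have h3 : δ ≤ ρ / 2 := (min_le_right _ _).trans (min_le_right _ _)
    have hi' : InjOn x (Icc (c - δ) (c + δ)) := hi.mono (Icc_subset_Icc (by linarith) (by linarith))
    obtain ⟨s, hs1, hs2, hs3⟩ := exists_strand h.hx.continuous hi'
    have him : ∃ p q, p < x c ∧ x c < q ∧ Icc p q ⊆ x '' Icc (c - δ) (c + δ) := by
      have hle : c - δ ≤ c + δ := by linarith
      have m1 : c - δ ∈ Icc (c - δ) (c + δ) := ⟨le_rfl, hle⟩
      have m2 : c + δ ∈ Icc (c - δ) (c + δ) := ⟨hle, le_rfl⟩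
      have m3 : c ∈ Icc (c - δ) (c + δ) := ⟨by linarith, by linarith⟩
      rcases h.hx.continuous.continuousOn.strictMonoOn_of_injOn_Icc' hle hi' with hm | hm
      · exact ⟨_, _, hm m1 m3 (by linarith), hm m3 m2 (by linarith),
          intermediate_value_Icc hle h.hx.continuous.continuousOn⟩
      · exact ⟨_, _, hm m3 m2 (by linarith), hm m1 m3 (by linarith),
          intermediate_value_Icc' hle h.hx.continuous.continuousOn⟩
    obtain ⟨p, q, hp, hq, hpq⟩ := him
    refine ⟨c - δ, c + δ, s, p, q, by linarith, by linarith, hp, hq, hi', hs1.mono hpq,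
      fun u hu => hs2 u (hpq hu), hs3, ?_⟩
    intro θ hθ
    have : |θ - c| ≤ δ := by rw [abs_le]; constructor <;> linarith [hθ.1, hθ.2]
    exact ⟨by linarith, hy θ (by linarith)⟩
  set ε := (y t₀ - y s₀) / 3 with hε
  have hε0 : 0 < ε := by simp only [hε]; linarith
  obtain ⟨α, β, A, p₁, q₁, a1, a2, a3, a4, a5, a6, a7, a8, a9⟩ := arc s₀ hs ε hε0
  obtain ⟨α', β', B, p₂, q₂, b1, b2, b3, b4, b5, b6, b7, b8, b9⟩ := arc t₀ ht ε hε0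
  rw [← hx0] at b3 b4
  set p := max p₁ p₂ with hp
  set q := min q₁ q₂ with hq
  have hpe : p < x s₀ := max_lt a3 b3
  have hqe : x s₀ < q := lt_min a4 b4
  have sA : Ico p q ⊆ Icc p₁ q₁ := fun u hu =>
    ⟨(le_max_left _ _).trans hu.1, hu.2.le.trans (min_le_left _ _)⟩
  have sB : Ico p q ⊆ Icc p₂ q₂ := fun u hu =>
    ⟨(le_max_right _ _).trans hu.1, hu.2.le.trans (min_le_right _ _)⟩
  have hAe : A (x s₀) = s₀ := a8 s₀ ⟨a1.le, a2.le⟩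
  have hBe : B (x s₀) = t₀ := by rw [hx0]; exact b8 t₀ ⟨b1.le, b2.le⟩
  have hA := a6.mono sA
  have hB := b6.mono sB
  refine ⟨p, q, A, B, ?_, ?_, hAe, hBe, hqe, ?_⟩
  · refine IsFeature.of_crossing hpe hqe hA hB
      (K := y s₀ - ε) (L := y s₀ + ε) (K' := y t₀ - ε) (L' := y t₀ + ε) ?_ ?_ ?_ ?_ ?_ ?_
    · simp only [hε]; linarith
    · exact fun u hu => (a9 _ (a7 u (sA hu))).2
    · exact fun u hu => (b9 _ (b7 u (sB hu))).2
    · intro u hu v hv huv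
      have := height_of_monotone h.hx h.hz h.leg a5 (fun θ hθ => (a9 θ hθ).2)
        (a7 u (sA hu)) (a7 v (sA hv)) (by rwa [hA.section_eq u hu, hA.section_eq v hv])
      rwa [hA.section_eq u hu, hA.section_eq v hv] at this
    · intro u hu v hv huv
      have := height_of_monotone h.hx h.hz h.leg b5 (fun θ hθ => (b9 θ hθ).2)
        (b7 u (sB hu)) (b7 v (sB hv)) (by rwa [hB.section_eq u hu, hB.section_eq v hv])
      rwa [hB.section_eq u hu, hB.section_eq v hv] at this
    · rw [hAe, hBe, hz0]
  · exact fun u hu => ⟨(a9 _ (a7 u (sA hu))).1, (b9 _ (b7 u (sB hu))).1⟩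
  · intro p' hp'
    have e0 : ∀ᶠ s in 𝓝 s₀, s ∈ Icc α β := Icc_mem_nhds a1 a2
    have e1 : ∀ᶠ s in 𝓝 s₀, s ∈ Icc α β ∧ x s ∈ Ico p' q :=
      e0.and (h.hx.continuous.continuousAt.eventually_mem (Ico_mem_nhds hp'.2 hqe))
    have e2 : ∀ᶠ t in 𝓝 t₀, t ∈ Icc α' β' := Icc_mem_nhds b1 b2
    obtain ⟨η₁, hη₁, h1⟩ := exists_pos_of_eventually_nhds e1
    obtain ⟨η₂, hη₂, h2⟩ := exists_pos_of_eventually_nhds e2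
    refine ⟨min η₁ η₂, lt_min hη₁ hη₂, fun s t hs ht hst => ?_⟩
    have h3 := h1 s (hs.trans_le (min_le_left _ _))
    have h4 := h2 t (ht.trans_le (min_le_right _ _))
    refine ⟨h3.2, hst, ?_, ?_⟩
    · rw [a8 s h3.1]; exact SameCirclePoint.refl _
    · rw [hst, b8 t h4]; exact SameCirclePoint.refl _

/-- The sign of y' at the cusp decides whether the branch before or after c has the smaller slope
and so plays the part of A. Hence a captured pair may come in either order. -/
theorem exists_feature_cusp (h : FrontCurve x y z) {c : ℝ} (hc : IsLocalMax x c) {ρ : ℝ}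
    (hρ : 0 < ρ) :
    ∃ p A B, IsFeature x y z (x c) p (x c) A B ∧
      (∀ u ∈ Ico p (x c), |A u - c| < ρ ∧ |B u - c| < ρ) ∧
      ∀ p' ∈ Ico p (x c), ∃ η > 0, ∀ s t, |s - c| < η → |t - c| < η → x s = x t → s ≠ t →
        OnStrands x A B (Ico p' (x c)) s t ∨ OnStrands x A B (Ico p' (x c)) t s := by
  obtain ⟨δ, hδ, hδρ, hm, ha, H⟩ := h.exists_right_cusp_window hc hρ
  have hcl : c ∈ Icc (c - δ) c := ⟨by linarith, le_rfl⟩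
  have hcr : c ∈ Icc c (c + δ) := ⟨le_rfl, by linarith⟩
  have m1 : c - δ ∈ Icc (c - δ) c := ⟨le_rfl, by linarith⟩
  have m2 : c + δ ∈ Icc c (c + δ) := ⟨by linarith, le_rfl⟩
  obtain ⟨L, hL1, hL2, hL3⟩ := exists_strand h.hx.continuous hm.injOn
  obtain ⟨Q, hQ1, hQ2, hQ3⟩ := exists_strand h.hx.continuous ha.injOn
  set p := max (x (c - δ)) (x (c + δ)) with hp
  have hpe : p < x c := max_lt (hm m1 hcl (by linarith)) (ha hcr m2 (by linarith))
  have sL : Ico p (x c) ⊆ x '' Icc (c - δ) c := fun u hu =>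
    intermediate_value_Icc m1.2 h.hx.continuous.continuousOn
      ⟨(le_max_left _ _).trans hu.1, hu.2.le⟩
  have sR : Ico p (x c) ⊆ x '' Icc c (c + δ) := fun u hu =>
    intermediate_value_Icc' m2.1 h.hx.continuous.continuousOn
      ⟨(le_max_right _ _).trans hu.1, hu.2.le⟩
  have hL := hL1.mono sL
  have hQ := hQ1.mono sR
  have hLρ : ∀ u ∈ Ico p (x c), |L u - c| < ρ := fun u hu => by
    have := hL2 u (sL hu)
    rw [abs_lt]; constructor <;> linarith [this.1, this.2]
  have hQρ : ∀ u ∈ Ico p (x c), |Q u - c| < ρ := fun u hu => by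
    have := hQ2 u (sR hu)
    rw [abs_lt]; constructor <;> linarith [this.1, this.2]
  have cap : ∀ p' ∈ Ico p (x c), ∃ η > 0, ∀ s t, |s - c| < η → |t - c| < η → x s = x t → s < t →
      x s ∈ Ico p' (x c) ∧ L (x s) = s ∧ Q (x s) = t := by
    intro p' hp'
    obtain ⟨η₁, hη₁, h1⟩ := exists_pos_of_eventually_nhds
      (h.hx.continuous.continuousAt.eventually_const_lt hp'.2)
    refine ⟨min η₁ δ, lt_min hη₁ hδ, fun s t hs ht hst hlt => ?_⟩
    have h2 := h1 s (hs.trans_le (min_le_left _ _))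
    replace hs := abs_lt.mp (hs.trans_le (min_le_right _ _))
    replace ht := abs_lt.mp (ht.trans_le (min_le_right _ _))
    have h1 : s < c := by
      by_contra h1
      push Not at h1
      exact hlt.ne (ha.injOn ⟨h1, by linarith⟩ ⟨by linarith, by linarith⟩ hst)
    have h3 : c < t := by
      by_contra h2
      push Not at h2
      exact hlt.ne (hm.injOn ⟨by linarith, h1.le⟩ ⟨by linarith, h2⟩ hst)
    have hsm : s ∈ Icc (c - δ) c := ⟨by linarith, h1.le⟩
    have htm : t ∈ Icc c (c + δ) := ⟨h3.le, by linarith⟩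
    exact ⟨⟨h2.le, hm hsm hcl h1⟩, hL3 s hsm, by rw [hst]; exact hQ3 t htm⟩
  rcases H with H | H
  · refine ⟨p, L, Q, IsFeature.of_cusp hpe hL hQ fun u hu => ?_,
      fun u hu => ⟨hLρ u hu, hQρ u hu⟩, fun p' hp' => ?_⟩
    · have := H (L u) (hL2 u (sL hu)) (Q u) (hQ2 u (sR hu))
        (by rw [hL.section_eq u hu, hQ.section_eq u hu]) (by rw [hL.section_eq u hu]; exact hu.2)
      rwa [hL.section_eq u hu] at this
    · obtain ⟨η, hη, hcap⟩ := cap p' hp'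
      refine ⟨η, hη, fun s t hs ht hst hne => ?_⟩
      rcases hne.lt_or_gt with hlt | hlt
      · obtain ⟨h1, h2, h3⟩ := hcap s t hs ht hst hlt
        exact Or.inl ⟨h1, hst, SameCirclePoint.of_eq h2, SameCirclePoint.of_eq h3⟩
      · obtain ⟨h1, h2, h3⟩ := hcap t s ht hs hst.symm hlt
        exact Or.inr ⟨h1, hst.symm, SameCirclePoint.of_eq h2, SameCirclePoint.of_eq h3⟩
  · refine ⟨p, Q, L, IsFeature.of_cusp hpe hQ hL fun u hu => ?_,
      fun u hu => ⟨hQρ u hu, hLρ u hu⟩, fun p' hp' => ?_⟩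
    · have := H (L u) (hL2 u (sL hu)) (Q u) (hQ2 u (sR hu))
        (by rw [hL.section_eq u hu, hQ.section_eq u hu]) (by rw [hL.section_eq u hu]; exact hu.2)
      rwa [hL.section_eq u hu] at this
    · obtain ⟨η, hη, hcap⟩ := cap p' hp'
      refine ⟨η, hη, fun s t hs ht hst hne => ?_⟩
      rcases hne.lt_or_gt with hlt | hlt
      · obtain ⟨h1, h2, h3⟩ := hcap s t hs ht hst hlt
        exact Or.inr ⟨hst ▸ h1, hst.symm, SameCirclePoint.of_eq (hst ▸ h3),
          SameCirclePoint.of_eq (hst ▸ h2)⟩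
      · obtain ⟨h1, h2, h3⟩ := hcap t s ht hs hst.symm hlt
        exact Or.inl ⟨hst.symm ▸ h1, hst, SameCirclePoint.of_eq (hst.symm ▸ h3),
          SameCirclePoint.of_eq (hst.symm ▸ h2)⟩

end FrontCurve

/-! ### Collecting the features of a front -/

/-- Finitely many points of the circle have disjoint neighbourhoods. -/
theorem exists_separation {C : Set ℝ} (hC : C.Finite) (hI : C ⊆ Ico (0 : ℝ) 1) :
    ∃ ρ > 0, ρ ≤ 1 / 4 ∧ ∀ c ∈ C, ∀ c' ∈ C, ∀ s s', SameCirclePoint s s' →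
      |s - c| < ρ → |s' - c'| < ρ → c = c' ∧ s = s' := by
  -- The term 1 − |p.1 − p.2| takes care of the distance around the other side of the circle.
  have h1 : ∀ᶠ ρ : ℝ in 𝓝[>] 0, ∀ p ∈ C ×ˢ C, p.1 ≠ p.2 →
      2 * ρ < min |p.1 - p.2| (1 - |p.1 - p.2|) := by
    rw [Filter.eventually_all_finite (hC.prod hC)]
    rintro ⟨c, c'⟩ ⟨hc, hc'⟩
    by_cases hne : c = c'
    · exact Eventually.of_forall fun ρ h => absurd hne h
    have hpos : 0 < min |c - c'| (1 - |c - c'|) := by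
      refine lt_min (abs_pos.mpr (sub_ne_zero.mpr hne)) ?_
      have h2 := hI hc
      have h3 := hI hc'
      rw [sub_pos, abs_lt]
      constructor <;> linarith [h2.1, h2.2, h3.1, h3.2]
    filter_upwards [Ioo_mem_nhdsGT (half_pos hpos)] with ρ hρ _
    linarith [hρ.2]
  have h2 : ∀ᶠ ρ : ℝ in 𝓝[>] 0, ρ ∈ Ioo (0 : ℝ) (1 / 4) := Ioo_mem_nhdsGT (by norm_num)
  obtain ⟨ρ, h3, h4⟩ := (h1.and h2).exists
  refine ⟨ρ, h4.1, h4.2.le, ?_⟩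
  rintro c hc c' hc' s s' hss hs hs'
  have hcc : c = c' := by
    by_contra hne
    have h5 := h3 (c, c') ⟨hc, hc'⟩ hne
    dsimp only at h5
    obtain ⟨n, rfl⟩ := hss
    have h6 : |c - c' + n| < 2 * ρ := by
      rw [abs_lt] at hs hs' ⊢
      constructor <;> linarith [hs.1, hs.2, hs'.1, hs'.2]
    by_cases hn : n = 0
    · subst hn
      have := h5.trans_le (min_le_left _ _)
      simp at h6
      linarith
    · have h7 : (1 : ℝ) ≤ |(n : ℝ)| := by exact_mod_cast Int.one_le_abs hn
      have h8 := h5.trans_le (min_le_right _ _)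
      have h9 : |(n : ℝ)| ≤ |c - c' + n| + |c - c'| := by
        calc |(n : ℝ)| = |(c - c' + n) - (c - c')| := by congr 1; ring
          _ ≤ _ := abs_sub _ _
      linarith
  refine ⟨hcc, hss.eq_of_abs_lt ?_⟩
  subst hcc
  rw [abs_lt] at hs hs' ⊢
  constructor <;> linarith [hs.1, hs.2, hs'.1, hs'.2, h4.2]

theorem OnStrands.congr {x A B : ℝ → ℝ} {I : Set ℝ} (px : Function.Periodic x 1) {s t s' t' : ℝ}
    (hs : SameCirclePoint s s') (ht : SameCirclePoint t t') (h : OnStrands x A B I s t) :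
    OnStrands x A B I s' t' := by
  obtain ⟨h1, h2, h3, h4⟩ := h
  have h5 := hs.periodic_eq px
  have h6 := ht.periodic_eq px
  rw [h5] at h1 h2 h3 h4
  exact ⟨h1, h2.trans h6, h3.trans hs, h4.trans ht⟩

theorem OnStrands.eq_eval {x A B f : ℝ → ℝ} {I : Set ℝ} (pf : Function.Periodic f 1) {s t : ℝ}
    (h : OnStrands x A B I s t) : f s = f (A (x s)) ∧ f t = f (B (x s)) :=
  ⟨(h.2.2.1.periodic_eq pf).symm, (h.2.2.2.periodic_eq pf).symm⟩

theorem OnStrands.mono {x A B : ℝ → ℝ} {I J : Set ℝ} (hIJ : I ⊆ J) {s t : ℝ}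
    (h : OnStrands x A B I s t) : OnStrands x A B J s t := ⟨hIJ h.1, h.2⟩

/-- All crossings and right cusps of a front, each with a pair of strands around it. -/
structure IsFeatureSystem (x y z : ℝ → ℝ) (S : Finset (ℝ × ℝ)) (A B : ℝ × ℝ → ℝ → ℝ)
    (q : ℝ × ℝ → ℝ) (d ρ M : ℝ) : Prop where
  d_pos : 0 < d
  mem_iff : ∀ i, i ∈ S ↔ i.1 ∈ Ico (0 : ℝ) 1 ∧ i.2 ∈ Ico (0 : ℝ) 1 ∧ IsFeaturePair x y z i
  feature : ∀ i ∈ S, IsFeature x y z (x i.1) (x i.1 - d) (q i) (A i) (B i)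
  near : ∀ i ∈ S, ∀ u ∈ Ico (x i.1 - d) (q i), |A i u - i.1| < ρ ∧ |B i u - i.2| < ρ
  cusp : ∀ i ∈ S, i.1 = i.2 → q i = x i.1
  crossing : ∀ i ∈ S, i.1 ≠ i.2 → x i.1 < q i ∧ A i (x i.1) = i.1 ∧ B i (x i.1) = i.2
  disjoint : ∀ i ∈ S, ∀ j ∈ S, ∀ θ, x θ ∈ Ico (x i.1 - d) (q i) → x θ ∈ Ico (x j.1 - d) (q j) →
    (SameCirclePoint (A i (x θ)) θ ∨ SameCirclePoint (B i (x θ)) θ) →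
    (SameCirclePoint (A j (x θ)) θ ∨ SameCirclePoint (B j (x θ)) θ) → i = j
  ends : ∀ i ∈ S, ∀ j ∈ S, x i.1 ≠ x j.1 → 3 * d < |x i.1 - x j.1|
  M_pos : 0 < M
  other : ∀ s t, x s = x t → ¬ SameCirclePoint s t →
    (∀ i ∈ S, ¬ OnStrands x (A i) (B i) (Ico (x i.1 - d) (q i)) s t ∧
      ¬ OnStrands x (A i) (B i) (Ico (x i.1 - d) (q i)) t s) →
    z s ≠ z t ∧ (z s < z t → ∀ F ≥ M, F * z s + y s < F * z t + y t)

namespace FrontCurve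

variable {x y z : ℝ → ℝ}

theorem isFeaturePair_fract (h : FrontCurve x y z) {i : ℝ × ℝ} (hi : IsFeaturePair x y z i) : IsFeaturePair x y z (Int.fract i.1, Int.fract i.2) := by
  have a1 := SameCirclePoint.fract i.1
  have a2 := SameCirclePoint.fract i.2
  obtain ⟨h1, h2, h3⟩ := hi
  refine ⟨?_, ?_, ?_⟩
  · dsimp only; rw [← a1.periodic_eq h.px, ← a2.periodic_eq h.px, h1]
  · dsimp only; rw [← a1.periodic_eq h.pz, ← a2.periodic_eq h.pz, h2]
  · rcases h3 with ⟨h3, h4⟩ | h3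
    · left
      exact ⟨by dsimp only; rw [h3], (isLocalExtr_of_sameCirclePoint h.px a1).1 h4⟩
    · right
      dsimp only; rw [← a1.periodic_eq h.py, ← a2.periodic_eq h.py]; exact h3

theorem y_ne_of_crossing (h : FrontCurve x y z) {s t : ℝ} (hne : ¬ SameCirclePoint s t)
    (hx : x s = x t) (hz : z s = z t) : y s ≠ y t := fun hy => hne (h.emb s t hx hy hz)

/-- This carries `exists_diagonal_window` to pairs of lifts of one circle point that differ by any
integer. -/
theorem eventually_not_crossing_of_same (h : FrontCurve x y z) {s₀ t₀ : ℝ}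
    (hst : SameCirclePoint s₀ t₀) :
    ∀ᶠ p : ℝ × ℝ in 𝓝 (s₀, t₀), x p.1 = x p.2 → ¬ SameCirclePoint p.1 p.2 →
      z p.1 ≠ z p.2 ∧ (¬ IsLocalMax x s₀ → z p.1 < z p.2 → y p.1 < y p.2) := by
  obtain ⟨n, rfl⟩ := hst
  obtain ⟨η, hη, H⟩ := h.exists_diagonal_window s₀
  have hb : Metric.ball s₀ η ×ˢ Metric.ball (s₀ + n) η ∈ 𝓝 (s₀, s₀ + n) :=
    prod_mem_nhds (Metric.ball_mem_nhds _ hη) (Metric.ball_mem_nhds _ hη)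
  filter_upwards [hb] with p hp hx hne
  have h1 : |p.1 - s₀| < η := by have := hp.1; rwa [Metric.mem_ball, Real.dist_eq] at this
  have h2 : |p.2 - n - s₀| < η := by
    have := hp.2; rw [Metric.mem_ball, Real.dist_eq] at this
    rwa [sub_sub, add_comm (n : ℝ)]
  have hs : SameCirclePoint (p.2 - n) p.2 := ⟨n, by ring⟩
  have := H p.1 (p.2 - n) h1 h2 (by rw [hx, hs.periodic_eq h.px])
    (fun h3 => hne ⟨n, by rw [h3]; ring⟩)
  rwa [hs.periodic_eq h.pz, hs.periodic_eq h.py] at this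

/-- Crossings are isolated in the parameter square: none lies near the diagonal or its integer
translates, and at a crossing the two strands meet over only one abscissa. Compactness gives
finiteness. -/
theorem finite_crossings (h : FrontCurve x y z) :
    {p : ℝ × ℝ | p.1 ∈ Icc (0 : ℝ) 1 ∧ p.2 ∈ Icc (0 : ℝ) 1 ∧ x p.1 = x p.2 ∧ z p.1 = z p.2 ∧
      ¬ SameCirclePoint p.1 p.2}.Finite := by
  set Cr : Set (ℝ × ℝ) := {p | x p.1 = x p.2 ∧ z p.1 = z p.2 ∧ ¬ SameCirclePoint p.1 p.2} with hCr
  have key : ∀ p : ℝ × ℝ, ∃ U ∈ 𝓝 p, (U ∩ Cr).Finite := by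
    rintro ⟨s₀, t₀⟩
    have hxc := h.hx.continuous
    have hzc := h.hz.continuous
    by_cases hst : SameCirclePoint s₀ t₀
    · refine ⟨_, h.eventually_not_crossing_of_same hst, ?_⟩
      refine Set.finite_empty.subset ?_
      rintro p ⟨h1, h2, h3, h4⟩
      exact (h1 h2 h4).1 h3
    by_cases hx : x s₀ = x t₀
    swap
    · have hev : ∀ᶠ p : ℝ × ℝ in 𝓝 (s₀, t₀), x p.1 ≠ x p.2 :=
        (isOpen_ne_fun (hxc.comp continuous_fst) (hxc.comp continuous_snd)).mem_nhds hx
      exact ⟨_, hev, Set.finite_empty.subset fun p hp => hp.1 hp.2.1⟩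
    by_cases hz : z s₀ = z t₀
    swap
    · have hev : ∀ᶠ p : ℝ × ℝ in 𝓝 (s₀, t₀), z p.1 ≠ z p.2 :=
        (isOpen_ne_fun (hzc.comp continuous_fst) (hzc.comp continuous_snd)).mem_nhds hz
      exact ⟨_, hev, Set.finite_empty.subset fun p hp => hp.1 hp.2.2.1⟩
    have cross : ∀ s₀ t₀, x s₀ = x t₀ → z s₀ = z t₀ → y s₀ < y t₀ → ∃ η > 0, ∀ s t,
        |s - s₀| < η → |t - t₀| < η → x s = x t → z s = z t → s = s₀ ∧ t = t₀ := by
      intro s₀ t₀ hx hz hy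
      obtain ⟨p, q, A, B, hf, -, hA, hB, hq, hcap⟩ := h.exists_feature_crossing hx hz hy one_pos
      obtain ⟨η, hη, H⟩ := hcap p ⟨le_rfl, hf.lt⟩
      refine ⟨min η 1, lt_min hη one_pos, fun s t hs ht hxst hzst => ?_⟩
      have hon := H s t (hs.trans_le (min_le_left _ _)) (ht.trans_le (min_le_left _ _)) hxst
      have hev := hon.eq_eval h.pz
      have he : x s = x s₀ := by
        by_contra hne
        have hc := hf.crosses (x s) hon.1
        rcases lt_or_gt_of_ne hne with h1 | h1
        · have := hc.1 h1; linarith [hev.1, hev.2]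
        · have := hc.2.2 h1; linarith [hev.1, hev.2]
      obtain ⟨-, -, h3, h4⟩ := hon
      rw [he, hA] at h3
      rw [he, hB] at h4
      exact ⟨(h3.eq_of_abs_lt (by rw [abs_sub_comm]; exact hs.trans_le (min_le_right _ _))).symm,
        (h4.eq_of_abs_lt (by rw [abs_sub_comm]; exact ht.trans_le (min_le_right _ _))).symm⟩
    have : ∃ η > 0, ∀ s t,
        |s - s₀| < η → |t - t₀| < η → x s = x t → z s = z t → s = s₀ ∧ t = t₀ := by
      rcases (h.y_ne_of_crossing hst hx hz).lt_or_gt with hy | hy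
      · exact cross s₀ t₀ hx hz hy
      · obtain ⟨η, hη, H⟩ := cross t₀ s₀ hx.symm hz.symm hy
        exact ⟨η, hη, fun s t hs ht h1 h2 => (H t s ht hs h1.symm h2.symm).symm⟩
    obtain ⟨η, hη, H⟩ := this
    refine ⟨Metric.ball s₀ η ×ˢ Metric.ball t₀ η,
      prod_mem_nhds (Metric.ball_mem_nhds _ hη) (Metric.ball_mem_nhds _ hη),
      (Set.finite_singleton (s₀, t₀)).subset ?_⟩
    rintro ⟨s, t⟩ ⟨⟨h1, h2⟩, h3, h4, -⟩
    rw [Metric.mem_ball, Real.dist_eq] at h1 h2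
    obtain ⟨rfl, rfl⟩ := H s t h1 h2 h3 h4
    rfl
  have hK : IsCompact (Icc (0 : ℝ) 1 ×ˢ Icc (0 : ℝ) 1) := isCompact_Icc.prod isCompact_Icc
  have hfin : ((Icc (0 : ℝ) 1 ×ˢ Icc (0 : ℝ) 1) ∩ Cr).Finite := by
    refine hK.induction_on (p := fun U => (U ∩ Cr).Finite) (by simp)
      (fun U V hUV hV => hV.subset (inter_subset_inter_left _ hUV))
      (fun U V hU hV => by rw [union_inter_distrib_right]; exact hU.union hV) ?_
    intro p _
    obtain ⟨U, hU, hf⟩ := key p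
    exact ⟨U, mem_nhdsWithin_of_mem_nhds hU, hf⟩
  refine hfin.subset ?_
  rintro p ⟨h1, h2, h3, h4, h5⟩
  exact ⟨⟨h1, h2⟩, h3, h4, h5⟩

theorem finite_featurePairs (h : FrontCurve x y z) :
    {i : ℝ × ℝ | i.1 ∈ Ico (0 : ℝ) 1 ∧ i.2 ∈ Ico (0 : ℝ) 1 ∧ IsFeaturePair x y z i}.Finite := by
  refine (h.finite_crossings.union (h.fin.image fun c => (c, c))).subset ?_
  rintro ⟨s, t⟩ ⟨h1, h2, h3, h4, h5⟩
  rcases h5 with ⟨h5, h6⟩ | h5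
  · right
    dsimp only at h5 h6 h1
    subst h5
    exact ⟨s, ⟨h1, IsLocalMax.deriv_eq_zero h6⟩, rfl⟩
  · left
    exact ⟨Ico_subset_Icc_self h1, Ico_subset_Icc_self h2, h3, h4,
      fun h6 => h5.ne (h6.periodic_eq h.py)⟩

/-- Here the absence of triple points and of cusps on other strands enters: one point of the front
carries at most one feature, and the order of its two parameters is fixed by the slopes. -/
theorem featurePair_eq_of_common (h : FrontCurve x y z) {i j : ℝ × ℝ}
    (hi : i.1 ∈ Ico (0 : ℝ) 1 ∧ i.2 ∈ Ico (0 : ℝ) 1 ∧ IsFeaturePair x y z i)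
    (hj : j.1 ∈ Ico (0 : ℝ) 1 ∧ j.2 ∈ Ico (0 : ℝ) 1 ∧ IsFeaturePair x y z j)
    (hc : i.1 = j.1 ∨ i.1 = j.2 ∨ i.2 = j.1 ∨ i.2 = j.2) : i = j := by
  obtain ⟨i1, i2⟩ := i
  obtain ⟨j1, j2⟩ := j
  obtain ⟨a1, a2, a3, a4, a5⟩ := hi
  obtain ⟨b1, b2, b3, b4, b5⟩ := hj
  dsimp only at *
  -- every parameter over this point of the front is one of the two
  have hx : x i1 = x j1 := by rcases hc with hc | hc | hc | hc <;> simp_all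
  have hz : z i1 = z j1 := by rcases hc with hc | hc | hc | hc <;> simp_all
  rcases a5 with ⟨a5, a6⟩ | a5
  · subst a5
    have e1 := (h.cusp_simple i1 j1 (Or.inr a6) hx hz).eq_of_mem_Ico a1 b1
    have e2 := (h.cusp_simple i1 j2 (Or.inr a6) (hx.trans b3) (hz.trans b4)).eq_of_mem_Ico a1 b2
    rw [← e1, ← e2]
  rcases b5 with ⟨b5, b6⟩ | b5
  · subst b5
    have e1 := (h.cusp_simple j1 i1 (Or.inr b6) hx.symm hz.symm).eq_of_mem_Ico b1 a1
    have e2 := (h.cusp_simple j1 i2 (Or.inr b6) (hx.symm.trans a3)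
      (hz.symm.trans a4)).eq_of_mem_Ico b1 a2
    rw [← e1, ← e2]
  have ni : ¬ SameCirclePoint i1 i2 := fun h6 => a5.ne (h6.periodic_eq h.py)
  have nj : ¬ SameCirclePoint j1 j2 := fun h6 => b5.ne (h6.periodic_eq h.py)
  have t1 := h.no_triple i1 i2 j1 a3 a4 hx hz
  have t2 := h.no_triple i1 i2 j2 a3 a4 (hx.trans b3) (hz.trans b4)
  have f1 : j1 = i1 ∨ j1 = i2 := by
    rcases t1 with t | t | t
    · exact absurd t ni
    · exact Or.inl (t.eq_of_mem_Ico a1 b1).symm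
    · exact Or.inr (t.eq_of_mem_Ico a2 b1).symm
  have f2 : j2 = i1 ∨ j2 = i2 := by
    rcases t2 with t | t | t
    · exact absurd t ni
    · exact Or.inl (t.eq_of_mem_Ico a1 b2).symm
    · exact Or.inr (t.eq_of_mem_Ico a2 b2).symm
  rcases f1 with f1 | f1 <;> rcases f2 with f2 | f2
  · exact absurd (SameCirclePoint.of_eq (f1.trans f2.symm)) nj
  · rw [f1, f2]
  · rw [f1, f2] at b5; linarith
  · exact absurd (SameCirclePoint.of_eq (f1.trans f2.symm)) nj

end FrontCurve

theorem exists_bound_of_periodic {f : ℝ → ℝ} (hf : Continuous f) (pf : Function.Periodic f 1) :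
    ∃ C > 0, ∀ θ, |f θ| ≤ C := by
  obtain ⟨C, hC⟩ := (isCompact_Icc.image (f := fun θ => |f θ|) (s := Icc (0 : ℝ) 1)
    (by fun_prop)).bddAbove
  refine ⟨max C 1, by positivity, fun θ => ?_⟩
  rw [(SameCirclePoint.fract θ).periodic_eq pf]
  exact (hC (mem_image_of_mem _ ⟨Int.fract_nonneg θ, (Int.fract_lt_one θ).le⟩)).trans
    (le_max_left _ _)

namespace FrontCurve

variable {x y z : ℝ → ℝ}

theorem exists_feature (h : FrontCurve x y z) {i : ℝ × ℝ} (hi : IsFeaturePair x y z i) {ρ : ℝ}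
    (hρ : 0 < ρ) :
    ∃ p q A B, IsFeature x y z (x i.1) p q A B ∧
      (∀ u ∈ Ico p q, |A u - i.1| < ρ ∧ |B u - i.2| < ρ) ∧ (i.1 = i.2 → q = x i.1) ∧
      (i.1 ≠ i.2 → x i.1 < q ∧ A (x i.1) = i.1 ∧ B (x i.1) = i.2) ∧
      ∀ p' ∈ Ico p (x i.1), ∃ η > 0, ∀ s t, |s - i.1| < η → |t - i.2| < η → x s = x t →
        ¬ SameCirclePoint s t →
        OnStrands x A B (Ico p' q) s t ∨ OnStrands x A B (Ico p' q) t s := by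
  obtain ⟨s, t⟩ := i
  obtain ⟨h1, h2, ⟨h3, h4⟩ | h3⟩ := hi
  · dsimp only at h3 h4
    subst h3
    obtain ⟨p, A, B, hf, hn, hcap⟩ := h.exists_feature_cusp h4 hρ
    refine ⟨p, x s, A, B, hf, hn, fun _ => rfl, fun h5 => absurd rfl h5, fun p' hp' => ?_⟩
    obtain ⟨η, hη, H⟩ := hcap p' hp'
    exact ⟨η, hη, fun s t hs ht hst hne => H s t hs ht hst fun h6 => hne (SameCirclePoint.of_eq h6)⟩
  · obtain ⟨p, q, A, B, hf, hn, hA, hB, hq, hcap⟩ := h.exists_feature_crossing h1 h2 h3 hρ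
    refine ⟨p, q, A, B, hf, hn, fun h4 => ?_, fun _ => ⟨hq, hA, hB⟩, fun p' hp' => ?_⟩
    · dsimp only at h4; rw [h4] at h3; exact absurd h3 (lt_irrefl _)
    · obtain ⟨η, hη, H⟩ := hcap p' hp'
      exact ⟨η, hη, fun s t hs ht hst _ => Or.inl (H s t hs ht hst)⟩

/-- Separated neighbourhoods of the feature parameters make the strands of different features
disjoint, and d is taken small for finitely many conditions. The constant M comes from compactness
of the parameter square. Near a feature all relevant pairs are captured by its strands; near other
diagonal points y and z agree; near pairs over different abscissas there is nothing to show; and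
near pairs of different heights a large factor lets z decide. -/
theorem exists_featureSystem (h : FrontCurve x y z) {ρ₀ : ℝ} (hρ₀ : 0 < ρ₀) :
    ∃ S A B q d ρ M, ρ ≤ ρ₀ ∧ IsFeatureSystem x y z S A B q d ρ M := by
  have hxc := h.hx.continuous
  have hyc := h.hy.continuous
  have hzc := h.hz.continuous
  set S := h.finite_featurePairs.toFinset with hS
  have hmem : ∀ i, i ∈ S ↔ i.1 ∈ Ico (0 : ℝ) 1 ∧ i.2 ∈ Ico (0 : ℝ) 1 ∧ IsFeaturePair x y z i := by
    intro i; rw [hS, Set.Finite.mem_toFinset]; rfl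
  obtain ⟨ρ₁, hρ₁, -, hsep⟩ := exists_separation
    (C := Prod.fst '' (S : Set (ℝ × ℝ)) ∪ Prod.snd '' (S : Set (ℝ × ℝ)))
    ((S.finite_toSet.image _).union (S.finite_toSet.image _)) (by
      rintro _ (⟨i, hi, rfl⟩ | ⟨i, hi, rfl⟩)
      · exact ((hmem i).1 hi).1
      · exact ((hmem i).1 hi).2.1)
  set ρ := min ρ₀ ρ₁ with hρdef
  have hρ : 0 < ρ := lt_min hρ₀ hρ₁
  have hex : ∀ i : ℝ × ℝ, ∃ p q A B, i ∈ S → (IsFeature x y z (x i.1) p q A B ∧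
      (∀ u ∈ Ico p q, |A u - i.1| < ρ ∧ |B u - i.2| < ρ) ∧ (i.1 = i.2 → q = x i.1) ∧
      (i.1 ≠ i.2 → x i.1 < q ∧ A (x i.1) = i.1 ∧ B (x i.1) = i.2) ∧
      ∀ p' ∈ Ico p (x i.1), ∃ η > 0, ∀ s t, |s - i.1| < η → |t - i.2| < η → x s = x t →
        ¬ SameCirclePoint s t →
        OnStrands x A B (Ico p' q) s t ∨ OnStrands x A B (Ico p' q) t s) := by
    intro i
    by_cases hi : i ∈ S
    · obtain ⟨p, q, A, B, H⟩ := h.exists_feature ((hmem i).1 hi).2.2 hρ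
      exact ⟨p, q, A, B, fun _ => H⟩
    · exact ⟨0, 0, id, id, fun h => absurd h hi⟩
  choose p q A B hfeat using hex
  have hd : ∀ᶠ d : ℝ in 𝓝[>] 0, (∀ i ∈ S, p i ≤ x i.1 - d) ∧
      (∀ i ∈ S, ∀ j ∈ S, x i.1 ≠ x j.1 → 3 * d < |x i.1 - x j.1|) := by
    refine Eventually.and ?_ ?_
    · rw [Filter.eventually_all_finset]
      intro i hi
      have : 0 < x i.1 - p i := sub_pos.mpr (hfeat i hi).1.lt
      filter_upwards [Ioo_mem_nhdsGT this] with d hd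
      linarith [hd.2]
    · rw [Filter.eventually_all_finset]
      intro i hi
      rw [Filter.eventually_all_finset]
      intro j hj
      by_cases hne : x i.1 = x j.1
      · exact Eventually.of_forall fun d h => absurd hne h
      have : 0 < |x i.1 - x j.1| / 3 := by
        have := abs_pos.mpr (sub_ne_zero.mpr hne); linarith
      filter_upwards [Ioo_mem_nhdsGT this] with d hd _
      linarith [hd.2]
  obtain ⟨d, ⟨hd1, hd2⟩, hd0⟩ := (hd.and self_mem_nhdsWithin).exists
  replace hd0 : 0 < d := hd0
  have hsub : ∀ i ∈ S, Ico (x i.1 - d) (q i) ⊆ Ico (p i) (q i) := fun i hi =>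
    Ico_subset_Ico_left (hd1 i hi)
  obtain ⟨Y, hY, hYb⟩ := exists_bound_of_periodic hyc h.py
  set good : ℝ → ℝ × ℝ → Prop := fun M r => x r.1 = x r.2 → ¬ SameCirclePoint r.1 r.2 →
    (∀ i ∈ S, ¬ OnStrands x (A i) (B i) (Ico (x i.1 - d) (q i)) r.1 r.2 ∧
      ¬ OnStrands x (A i) (B i) (Ico (x i.1 - d) (q i)) r.2 r.1) →
    z r.1 ≠ z r.2 ∧ (z r.1 < z r.2 → ∀ F ≥ M, F * z r.1 + y r.1 < F * z r.2 + y r.2) with hgood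
  have good_mono : ∀ {M M' r}, M ≤ M' → good M r → good M' r := fun hM hg h1 h2 h3 =>
    ⟨(hg h1 h2 h3).1, fun h4 F hF => (hg h1 h2 h3).2 h4 F (hM.trans hF)⟩
  have hlocal : ∀ r : ℝ × ℝ, ∃ M > 0, ∀ᶠ r' in 𝓝 r, good M r' := by
    rintro ⟨s₀, t₀⟩
    have captured : ∀ i ∈ S, ∀ s₀ t₀, SameCirclePoint s₀ i.1 → SameCirclePoint t₀ i.2 →
        ∀ᶠ r' in 𝓝 (s₀, t₀), x r'.1 = x r'.2 → ¬ SameCirclePoint r'.1 r'.2 →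
          OnStrands x (A i) (B i) (Ico (x i.1 - d) (q i)) r'.1 r'.2 ∨
          OnStrands x (A i) (B i) (Ico (x i.1 - d) (q i)) r'.2 r'.1 := by
      rintro i hi s₀ t₀ ⟨n, hn⟩ ⟨m, hm⟩
      obtain ⟨η, hη, H⟩ := (hfeat i hi).2.2.2.2 (x i.1 - d)
        ⟨hd1 i hi, by linarith⟩
      filter_upwards [prod_mem_nhds (Metric.ball_mem_nhds s₀ hη) (Metric.ball_mem_nhds t₀ hη)]
        with r' hr' hx hne
      have h1 := hr'.1
      have h2 := hr'.2
      rw [Metric.mem_ball, Real.dist_eq] at h1 h2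
      have e1 : SameCirclePoint r'.1 (r'.1 + n) := ⟨n, rfl⟩
      have e2 : SameCirclePoint r'.2 (r'.2 + m) := ⟨m, rfl⟩
      have h3 := H (r'.1 + n) (r'.2 + m)
        (by rw [hn]; convert h1 using 2; ring) (by rw [hm]; convert h2 using 2; ring)
        (by rw [← e1.periodic_eq h.px, ← e2.periodic_eq h.px, hx])
        (fun h4 => hne (e1.trans (h4.trans e2.symm)))
      exact h3.imp (OnStrands.congr h.px e1.symm e2.symm) (OnStrands.congr h.px e2.symm e1.symm)
    have of_pair : ∀ i, IsFeaturePair x y z i →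
        ∀ᶠ r' in 𝓝 (i.1, i.2), x r'.1 = x r'.2 → ¬ SameCirclePoint r'.1 r'.2 →
          ∃ i ∈ S, OnStrands x (A i) (B i) (Ico (x i.1 - d) (q i)) r'.1 r'.2 ∨
          OnStrands x (A i) (B i) (Ico (x i.1 - d) (q i)) r'.2 r'.1 := by
      intro i hi
      have hiS : (Int.fract i.1, Int.fract i.2) ∈ S := (hmem _).2
        ⟨⟨Int.fract_nonneg _, Int.fract_lt_one _⟩, ⟨Int.fract_nonneg _, Int.fract_lt_one _⟩,
          h.isFeaturePair_fract hi⟩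
      filter_upwards [captured _ hiS i.1 i.2 (SameCirclePoint.fract _) (SameCirclePoint.fract _)]
        with r' hr' h1 h2
      exact ⟨_, hiS, hr' h1 h2⟩
    have of_captured : (∀ᶠ r' in 𝓝 (s₀, t₀), x r'.1 = x r'.2 → ¬ SameCirclePoint r'.1 r'.2 →
          ∃ i ∈ S, OnStrands x (A i) (B i) (Ico (x i.1 - d) (q i)) r'.1 r'.2 ∨
          OnStrands x (A i) (B i) (Ico (x i.1 - d) (q i)) r'.2 r'.1) →
        ∃ M > 0, ∀ᶠ r' in 𝓝 (s₀, t₀), good M r' := by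
      intro hev
      refine ⟨1, one_pos, ?_⟩
      filter_upwards [hev] with r' hr' h1 h2 h3
      obtain ⟨i, hi, h4 | h4⟩ := hr' h1 h2
      · exact absurd h4 (h3 i hi).1
      · exact absurd h4 (h3 i hi).2
    by_cases hst : SameCirclePoint s₀ t₀
    · by_cases hmax : IsLocalMax x s₀
      · obtain ⟨n, rfl⟩ := hst
        have hp := of_pair (s₀, s₀) ⟨rfl, rfl, Or.inl ⟨rfl, hmax⟩⟩
        refine of_captured ?_
        have ht : Tendsto (fun r : ℝ × ℝ => (r.1, r.2 - n)) (𝓝 (s₀, s₀ + n)) (𝓝 (s₀, s₀)) := by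
          have : Continuous fun r : ℝ × ℝ => (r.1, r.2 - n) := by fun_prop
          simpa using this.tendsto (s₀, s₀ + n)
        filter_upwards [ht.eventually hp] with r' hr' h1 h2
        have e2 : SameCirclePoint (r'.2 - n) r'.2 := ⟨n, by ring⟩
        obtain ⟨i, hi, h3⟩ := hr' (by rw [h1, e2.periodic_eq h.px])
          (fun h4 => h2 (h4.trans e2))
        exact ⟨i, hi, h3.imp (OnStrands.congr h.px (SameCirclePoint.refl _) e2)
          (OnStrands.congr h.px e2 (SameCirclePoint.refl _))⟩
      · refine ⟨1, one_pos, ?_⟩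
        filter_upwards [h.eventually_not_crossing_of_same hst] with r' hr' h1 h2 _
        obtain ⟨h3, h4⟩ := hr' h1 h2
        refine ⟨h3, fun h5 F hF => ?_⟩
        have := h4 hmax h5
        have := mul_lt_mul_of_pos_left h5 (by linarith : (0 : ℝ) < F)
        linarith
    by_cases hx : x s₀ = x t₀
    swap
    · refine ⟨1, one_pos, ?_⟩
      filter_upwards [(isOpen_ne_fun (hxc.comp continuous_fst)
        (hxc.comp continuous_snd)).mem_nhds hx] with r' hr' h1
      exact absurd h1 hr'
    by_cases hz : z s₀ = z t₀
    swap
    · set κ := |z s₀ - z t₀| / 2 with hκ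
      have hκ0 : 0 < κ := by
        have := abs_pos.mpr (sub_ne_zero.mpr hz); simp only [hκ]; linarith
      -- Slopes differ by at most 2Y and heights by more than κ, so with such a factor the height
      -- decides.
      refine ⟨(2 * Y + 1) / κ, by positivity, ?_⟩
      have hev : ∀ᶠ r' : ℝ × ℝ in 𝓝 (s₀, t₀), κ < |z r'.1 - z r'.2| := by
        have hc : Continuous fun r' : ℝ × ℝ => |z r'.1 - z r'.2| := by fun_prop
        exact hc.continuousAt.eventually_const_lt (by simp only [hκ] at hκ0 ⊢; linarith)
      filter_upwards [hev] with r' hr' h1 h2 _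
      refine ⟨fun h3 => by rw [h3, sub_self, abs_zero] at hr'; linarith, fun h3 F hF => ?_⟩
      rw [abs_sub_comm, abs_of_pos (sub_pos.mpr h3)] at hr'
      have h4 : 2 * Y + 1 ≤ F * κ := by
        have := mul_le_mul_of_nonneg_right hF hκ0.le
        rwa [div_mul_cancel₀ _ hκ0.ne'] at this
      have hF0 : 0 < F := by
        have : 0 < (2 * Y + 1) / κ := by positivity
        linarith
      have h5 := mul_lt_mul_of_pos_left hr' hF0
      have h6 := abs_le.mp (hYb r'.1)
      have h7 := abs_le.mp (hYb r'.2)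
      linarith [h6.1, h6.2, h7.1, h7.2]
    refine of_captured ?_
    rcases (h.y_ne_of_crossing hst hx hz).lt_or_gt with hy | hy
    · exact of_pair (s₀, t₀) ⟨hx, hz, Or.inr hy⟩
    · have hp := of_pair (t₀, s₀) ⟨hx.symm, hz.symm, Or.inr hy⟩
      have ht : Tendsto Prod.swap (𝓝 (s₀, t₀)) (𝓝 (t₀, s₀)) := continuous_swap.tendsto (s₀, t₀)
      filter_upwards [ht.eventually hp] with r' hr' h1 h2
      obtain ⟨i, hi, h3⟩ := hr' h1.symm fun h4 => h2 h4.symm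
      exact ⟨i, hi, h3.symm⟩
  have hK : IsCompact (Icc (0 : ℝ) 1 ×ˢ Icc (0 : ℝ) 1) := isCompact_Icc.prod isCompact_Icc
  obtain ⟨M, hM, hMg⟩ : ∃ M > 0, ∀ r ∈ Icc (0 : ℝ) 1 ×ˢ Icc (0 : ℝ) 1, good M r := by
    refine hK.induction_on (p := fun U => ∃ M > 0, ∀ r ∈ U, good M r) ⟨1, one_pos, by simp⟩ ?_ ?_ ?_
    · rintro U V hUV ⟨M, hM, H⟩
      exact ⟨M, hM, fun r hr => H r (hUV hr)⟩
    · rintro U V ⟨M, hM, H⟩ ⟨M', hM', H'⟩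
      refine ⟨max M M', lt_max_of_lt_left hM, ?_⟩
      rintro r (hr | hr)
      · exact good_mono (le_max_left _ _) (H r hr)
      · exact good_mono (le_max_right _ _) (H' r hr)
    · intro r _
      obtain ⟨M, hM, hev⟩ := hlocal r
      exact ⟨{r' | good M r'}, mem_nhdsWithin_of_mem_nhds hev, M, hM, fun r' hr' => hr'⟩
  refine ⟨S, A, B, q, d, ρ, M, min_le_left _ _, hd0, hmem,
    fun i hi => (hfeat i hi).1.restrict (hd1 i hi) (by linarith),
    fun i hi u hu => (hfeat i hi).2.1 u (hsub i hi hu), fun i hi => (hfeat i hi).2.2.1,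
    fun i hi => (hfeat i hi).2.2.2.1, ?_, hd2, hM, ?_⟩
  · intro i hi j hj θ hθi hθj hci hcj
    have hn1 := (hfeat i hi).2.1 _ (hsub i hi hθi)
    have hn2 := (hfeat j hj).2.1 _ (hsub j hj hθj)
    have hρ1 : ρ ≤ ρ₁ := min_le_right _ _
    have m : ∀ i ∈ S, i.1 ∈ Prod.fst '' (S : Set (ℝ × ℝ)) ∪ Prod.snd '' (S : Set (ℝ × ℝ)) ∧
        i.2 ∈ Prod.fst '' (S : Set (ℝ × ℝ)) ∪ Prod.snd '' (S : Set (ℝ × ℝ)) := fun i hi =>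
      ⟨Or.inl ⟨i, hi, rfl⟩, Or.inr ⟨i, hi, rfl⟩⟩
    refine h.featurePair_eq_of_common ((hmem i).1 hi) ((hmem j).1 hj) ?_
    rcases hci with hci | hci <;> rcases hcj with hcj | hcj
    · exact Or.inl (hsep _ (m i hi).1 _ (m j hj).1 _ _ (hci.trans hcj.symm)
        (hn1.1.trans_le hρ1) (hn2.1.trans_le hρ1)).1
    · exact Or.inr (Or.inl (hsep _ (m i hi).1 _ (m j hj).2 _ _ (hci.trans hcj.symm)
        (hn1.1.trans_le hρ1) (hn2.2.trans_le hρ1)).1)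
    · exact Or.inr (Or.inr (Or.inl (hsep _ (m i hi).2 _ (m j hj).1 _ _ (hci.trans hcj.symm)
        (hn1.2.trans_le hρ1) (hn2.1.trans_le hρ1)).1))
    · exact Or.inr (Or.inr (Or.inr (hsep _ (m i hi).2 _ (m j hj).2 _ _ (hci.trans hcj.symm)
        (hn1.2.trans_le hρ1) (hn2.2.trans_le hρ1)).1))
  · intro s t hst hne hoff
    have a1 := SameCirclePoint.fract s
    have a2 := SameCirclePoint.fract t
    have := hMg (Int.fract s, Int.fract t) ⟨⟨Int.fract_nonneg _, (Int.fract_lt_one _).le⟩,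
      ⟨Int.fract_nonneg _, (Int.fract_lt_one _).le⟩⟩
      (by dsimp only; rw [← a1.periodic_eq h.px, ← a2.periodic_eq h.px, hst])
      (fun h3 => hne (a1.trans (h3.trans a2.symm)))
      (fun i hi => ⟨fun h3 => (hoff i hi).1 (h3.congr h.px a1.symm a2.symm),
        fun h3 => (hoff i hi).2 (h3.congr h.px a2.symm a1.symm)⟩)
    dsimp only at this
    rwa [← a1.periodic_eq h.pz, ← a2.periodic_eq h.pz, ← a1.periodic_eq h.py,
      ← a2.periodic_eq h.py] at this

end FrontCurve

/-! ### The shear -/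

theorem eventually_Ico_of_eventually_left {P : ℝ → Prop} {e : ℝ} (h : ∀ᶠ u in 𝓝[<] e, P u) :
    ∀ᶠ δ in 𝓝[>] (0 : ℝ), ∀ u ∈ Ico (e - 2 * δ) e, P u := by
  obtain ⟨l, hl, hP⟩ := (mem_nhdsLT_iff_exists_Ioo_subset).1 h
  have hl' : l < e := hl
  have h1 : ∀ᶠ δ in 𝓝 (0 : ℝ), δ < (e - l) / 2 := eventually_lt_nhds (by linarith)
  filter_upwards [nhdsWithin_le_nhds h1] with δ hδ u hu
  exact hP ⟨by linarith [hu.1], hu.2⟩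

/-- A smooth function that is `u - e` on `[e - d, e]` for all `e` in a sparse finite set. -/
theorem exists_sawtooth (E : Finset ℝ) {d : ℝ} (hd : 0 < d)
    (hE : ∀ e ∈ E, ∀ e' ∈ E, e ≠ e' → 3 * d < |e - e'|) :
    ∃ V : ℝ → ℝ, (∀ n : ℕ∞, ContDiff ℝ n V) ∧ ∀ e ∈ E, ∀ u ∈ Icc (e - d) e, V u = u - e := by
  -- Points of E are more than 3d apart, so a bump of outer radius 2d around another point vanishes
  -- on [e − d, e], where the bump of e is 1.
  let b : (e : ℝ) → ContDiffBump e := fun e => ⟨d, 2 * d, hd, by linarith⟩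
  refine ⟨fun u => ∑ e ∈ E, b e u * (u - e), fun n => ?_, fun e he u hu => ?_⟩
  · refine ContDiff.sum fun e _ => ((b e).contDiff).mul (contDiff_id.sub contDiff_const)
  · dsimp only
    rw [Finset.sum_eq_single e]
    · rw [(b e).one_of_mem_closedBall, one_mul]
      rw [Metric.mem_closedBall, Real.dist_eq, abs_le]
      constructor <;> simp only [b] <;> linarith [hu.1, hu.2]
    · intro e' he' hne
      rw [(b e').zero_of_le_dist, zero_mul]
      have h1 := hE e he e' he' hne.symm
      have h2 : |e - e'| ≤ |u - e'| + |e - u| := by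
        have := abs_add_le (u - e') (e - u); simpa [add_comm] using this
      have h3 : |e - u| ≤ d := by rw [abs_le]; constructor <;> linarith [hu.1, hu.2]
      rw [Real.dist_eq]
      simp only [b]; linarith
    · intro h; exact absurd he h

theorem IsStrand.hasDerivAt {x s : ℝ → ℝ} {I : Set ℝ} (hs : IsStrand x s I) {u : ℝ}
    (hI : I ∈ 𝓝 u) (hx : DifferentiableAt ℝ x (s u)) (h0 : deriv x (s u) ≠ 0) :
    HasDerivAt s (deriv x (s u))⁻¹ u :=
  HasDerivAt.of_local_left_inverse (hs.continuousOn.continuousAt hI) hx.hasDerivAt h0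
    (by filter_upwards [hI] with v hv using hs.section_eq v hv)

namespace FrontCurve

variable {x y z : ℝ → ℝ}

/-- Only finitely many abscissas carry critical points. The value e is left out, since it is
critical itself when the feature is a cusp. -/
theorem eventually_not_critical (h : FrontCurve x y z) (e : ℝ) :
    ∀ᶠ u in 𝓝[<] e, ∀ θ, x θ = u → deriv x θ ≠ 0 := by
  have h1 : (x '' {θ ∈ Ico (0 : ℝ) 1 | deriv x θ = 0}).Finite := h.fin.image x
  have h2 : ∀ᶠ u in 𝓝[≠] e, u ∉ x '' {θ ∈ Ico (0 : ℝ) 1 | deriv x θ = 0} := by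
    have := (h1.subset (sdiff_subset (t := {e}))).isClosed.isOpen_compl.mem_nhds
      (x := e) (by simp)
    filter_upwards [nhdsWithin_le_nhds this, self_mem_nhdsWithin] with u hu hne hmem
    exact hu ⟨hmem, hne⟩
  filter_upwards [nhdsWithin_mono e (fun u (hu : u < e) => hu.ne) h2] with u hu θ hθ h0
  refine hu ⟨Int.fract θ, ⟨⟨Int.fract_nonneg _, Int.fract_lt_one _⟩, ?_⟩, ?_⟩
  · rw [← (SameCirclePoint.fract θ).periodic_eq (deriv_periodic h.px), h0]
  · rw [← (SameCirclePoint.fract θ).periodic_eq h.px, hθ]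

theorem deriv_shear (h : FrontCurve x y z) {F : ℝ → ℝ} (hF : Differentiable ℝ F) (θ : ℝ) :
    HasDerivAt (fun θ => F (x θ) * z θ + y θ)
      (deriv F (x θ) * deriv x θ * z θ + F (x θ) * (y θ * deriv x θ) + deriv y θ) θ := by
  have hx := (h.hx.differentiable one_ne_zero θ).hasDerivAt
  have hy := (h.hy.differentiable one_ne_zero θ).hasDerivAt
  have hz := (h.hz.differentiable one_ne_zero θ).hasDerivAt
  rw [h.leg] at hz
  exact (((hF (x θ)).hasDerivAt.comp θ hx).mul hz).add hy

/-- After adding `F · z` to `y` the strands of a feature cross exactly once, where `F` drops from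
large values to `N`. -/
theorem exists_shear_crossing (h : FrontCurve x y z) {e d q : ℝ} {A B : ℝ → ℝ}
    (hf : IsFeature x y z e (e - d) q A B) {N δ : ℝ} (hN : 0 ≤ N) (hδ : 0 < δ) (hδd : 2 * δ < d)
    (hst : ∀ u ∈ Ico (e - 2 * δ) e, (N + 1) * (z (A u) - z (B u)) < y (B u) - y (A u))
    (hcr : ∀ u ∈ Ico (e - 2 * δ) e, ∀ θ, x θ = u → deriv x θ ≠ 0) :
    ∀ᶠ k in atTop, ∀ F : ℝ → ℝ, Differentiable ℝ F → (∀ u, 0 < F u) →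
      (∀ u ∈ Icc (e - d) e, F u = N + Real.exp (-k * (u - e + δ))) →
      ∃ v ∈ Ioo (e - 2 * δ) e, CrossesAt (fun θ => F (x θ) * z θ + y θ) A B (Ico (e - d) q) v ∧
        deriv x (A v) * deriv (fun θ => F (x θ) * z θ + y θ) (B v) ≠
          deriv x (B v) * deriv (fun θ => F (x θ) * z θ + y θ) (A v) := by
  -- Three zones are distinguished. Up to e − 2δ the factor is at least e^{kδ} and the height gap at
  -- least μ, so z decides. From e − δ to e the factor is at most N + 1 and `hst` lets the slopes
  -- decide; from e on, heights and slopes agree. In between the difference of the two sheared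
  -- heights decreases strictly.
  have hI : Ico (e - d) e ⊆ Ico (e - d) q := fun u hu => ⟨hu.1, hu.2.trans_le hf.le⟩
  have hAc := hf.strandA.continuousOn
  have hBc := hf.strandB.continuousOn
  have hzc : ContinuousOn (fun u => z (A u) - z (B u)) (Ico (e - d) q) :=
    (h.hz.continuous.comp_continuousOn hAc).sub (h.hz.continuous.comp_continuousOn hBc)
  have hyc : ContinuousOn (fun u => y (B u) - y (A u)) (Ico (e - d) q) :=
    (h.hy.continuous.comp_continuousOn hBc).sub (h.hy.continuous.comp_continuousOn hAc)
  have hJ1 : Icc (e - d) (e - δ) ⊆ Ico (e - d) q := fun u hu =>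
    hI ⟨hu.1, by linarith [hu.2]⟩
  have hJ2 : Icc (e - 2 * δ) (e - δ) ⊆ Ico (e - d) q := fun u hu =>
    hI ⟨by linarith [hu.1], by linarith [hu.2]⟩
  have hJ3 : Icc (e - 2 * δ) (e - δ) ⊆ Ico (e - 2 * δ) e := fun u hu =>
    ⟨hu.1, by linarith [hu.2]⟩
  obtain ⟨μ, hμ, hμ'⟩ : ∃ μ > 0, ∀ u ∈ Icc (e - d) (e - δ), μ ≤ z (A u) - z (B u) := by
    obtain ⟨u₀, hu₀, hmin⟩ := isCompact_Icc.exists_isMinOn (nonempty_Icc.2 (by linarith))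
      (hzc.mono hJ1)
    exact ⟨_, sub_pos.2 ((hf.crosses u₀ (hJ1 hu₀)).1 (by linarith [hu₀.2])), fun u hu => hmin hu⟩
  obtain ⟨C, hC⟩ := isCompact_Icc.exists_bound_of_continuousOn (hyc.mono hJ1)
  have hslope : ∀ s : ℝ → ℝ, IsStrand x s (Ico (e - d) q) →
      ContinuousOn (fun u => deriv y (s u) / deriv x (s u)) (Icc (e - 2 * δ) (e - δ)) := by
    intro s hs
    refine ContinuousOn.div ?_ ?_ fun u hu => hcr u (hJ3 hu) _ (hs.section_eq u (hJ2 hu))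
    · exact (h.hy.continuous_deriv le_rfl).comp_continuousOn (hs.continuousOn.mono hJ2)
    · exact (h.hx.continuous_deriv le_rfl).comp_continuousOn (hs.continuousOn.mono hJ2)
  obtain ⟨G, hG⟩ := isCompact_Icc.exists_bound_of_continuousOn
    ((hslope B hf.strandB).sub (hslope A hf.strandA))
  have hk1 : ∀ᶠ k in atTop, C < Real.exp (k * δ) * μ :=
    ((Real.tendsto_exp_atTop.comp (tendsto_id.atTop_mul_const hδ)).atTop_mul_const hμ).eventually_gt_atTop C
  have hk2 : ∀ᶠ k in atTop, G < k * μ := (tendsto_id.atTop_mul_const hμ).eventually_gt_atTop G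
  filter_upwards [hk1, hk2, eventually_gt_atTop 0] with k hk1 hk2 hk0 F hFd hFp hF
  set W : ℝ → ℝ := fun θ => F (x θ) * z θ + y θ with hW
  have hWA : ∀ u ∈ Ico (e - d) q, W (A u) - W (B u) =
      F u * (z (A u) - z (B u)) - (y (B u) - y (A u)) := by
    intro u hu
    simp only [hW, hf.strandA.section_eq u hu, hf.strandB.section_eq u hu]; ring
  -- before the window
  have hbefore : ∀ u ∈ Icc (e - d) (e - 2 * δ), W (B u) < W (A u) := by
    intro u hu
    have hu' : u ∈ Icc (e - d) (e - δ) := ⟨hu.1, by linarith [hu.2]⟩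
    have h1 := hWA u (hJ1 hu')
    have h2 : Real.exp (k * δ) ≤ F u := by
      rw [hF u ⟨hu.1, by linarith [hu.2]⟩]
      have : Real.exp (k * δ) ≤ Real.exp (-k * (u - e + δ)) := by
        apply Real.exp_le_exp.2; nlinarith [hu.2]
      linarith
    have h3 := hμ' u hu'
    have h4 := (abs_le.1 (hC u hu')).2
    have h5 : Real.exp (k * δ) * μ ≤ F u * (z (A u) - z (B u)) :=
      mul_le_mul h2 h3 hμ.le (hFp u).le
    linarith
  have hafter : ∀ u ∈ Ico (e - δ) q, W (A u) < W (B u) := by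
    intro u hu
    have huI : u ∈ Ico (e - d) q := ⟨by linarith [hu.1], hu.2⟩
    have h1 := hWA u huI
    have h4 := hf.y_lt u huI
    rcases lt_or_ge u e with hue | hue
    · have h2 : F u ≤ N + 1 := by
        rw [hF u ⟨huI.1, hue.le⟩]
        have : Real.exp (-k * (u - e + δ)) ≤ 1 := by
          apply Real.exp_le_one_iff.2; nlinarith [hu.1]
        linarith
      have h3 := hst u ⟨by linarith [hu.1], hue⟩
      have h5 := (hf.crosses u huI).1 hue
      have h6 := mul_le_mul_of_nonneg_right h2 (sub_pos.2 h5).le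
      linarith
    · have h5 : z (A u) ≤ z (B u) := by
        rcases hue.eq_or_lt with h | h
        · exact ((hf.crosses u huI).2.1 h.symm).le
        · exact ((hf.crosses u huI).2.2 h).le
      have := mul_nonneg (hFp u).le (sub_nonneg.2 h5)
      nlinarith
  have hder : ∀ s : ℝ → ℝ, IsStrand x s (Ico (e - d) q) → ∀ u ∈ Icc (e - 2 * δ) (e - δ),
      HasDerivAt (fun u => W (s u)) (deriv W (s u) / deriv x (s u)) u := by
    intro s hs u hu
    have hnhd : Ico (e - d) q ∈ 𝓝 u :=
      Ico_mem_nhds (by linarith [hu.1]) (by linarith [hu.2, hf.le])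
    have h1 := hs.hasDerivAt hnhd (h.hx.differentiable one_ne_zero _)
      (hcr u (hJ3 hu) _ (hs.section_eq u (hJ2 hu)))
    have h2 := (h.deriv_shear hFd (s u)).differentiableAt.hasDerivAt
    exact h2.comp u h1
  -- Along a strand the derivative of W in u is F'z + Fy + y'/x'. In the difference of A and B the
  -- first term is at most −kμ and the second is negative, so a large k beats the bound G on the
  -- last one.
  have hneg : ∀ u ∈ Icc (e - 2 * δ) (e - δ),
      deriv W (A u) / deriv x (A u) - deriv W (B u) / deriv x (B u) < 0 := by
    intro u hu
    have hA0 := hcr u (hJ3 hu) _ (hf.strandA.section_eq u (hJ2 hu))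
    have hB0 := hcr u (hJ3 hu) _ (hf.strandB.section_eq u (hJ2 hu))
    have hdF : deriv F u = -k * Real.exp (-k * (u - e + δ)) := by
      have hev : F =ᶠ[𝓝 u] fun u => N + Real.exp (-k * (u - e + δ)) := by
        filter_upwards [Icc_mem_nhds (a := e - d) (b := e) (by linarith [hu.1])
          (by linarith [hu.2])] with v hv using hF v hv
      rw [hev.deriv_eq]
      have h1 : HasDerivAt (fun u : ℝ => -k * (u - e + δ)) (-k) u := by
        simpa using (((hasDerivAt_id u).sub_const e).add_const δ).const_mul (-k)
      rw [(h1.exp.const_add N).deriv]; ring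
    have h1 : deriv W (A u) / deriv x (A u) - deriv W (B u) / deriv x (B u) =
        deriv F u * (z (A u) - z (B u)) - F u * (y (B u) - y (A u)) -
          (deriv y (B u) / deriv x (B u) - deriv y (A u) / deriv x (A u)) := by
      rw [(h.deriv_shear hFd (A u)).deriv, (h.deriv_shear hFd (B u)).deriv,
        hf.strandA.section_eq u (hJ2 hu), hf.strandB.section_eq u (hJ2 hu)]
      field_simp
      ring
    have h2 := hμ' u ⟨by linarith [hu.1], hu.2⟩
    have h3 := (abs_le.1 (hG u hu)).1
    simp only [Pi.sub_apply] at h3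
    have h4 := mul_pos (hFp u) (sub_pos.2 (hf.y_lt u (hJ2 hu)))
    have h5 : 1 ≤ Real.exp (-k * (u - e + δ)) := by
      apply Real.one_le_exp; nlinarith [hu.2]
    have h6 : k * μ ≤ k * Real.exp (-k * (u - e + δ)) * (z (A u) - z (B u)) := by
      have := mul_le_mul h5 h2 hμ.le (by linarith)
      nlinarith
    rw [h1, hdF]
    linarith
  have hderE : ∀ u ∈ Icc (e - 2 * δ) (e - δ), HasDerivAt (fun u => W (A u) - W (B u))
      (deriv W (A u) / deriv x (A u) - deriv W (B u) / deriv x (B u)) u := fun u hu =>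
    (hder A hf.strandA u hu).sub (hder B hf.strandB u hu)
  have hEc : ContinuousOn (fun u => W (A u) - W (B u)) (Icc (e - 2 * δ) (e - δ)) := fun u hu =>
    (hderE u hu).continuousAt.continuousWithinAt
  have hanti : StrictAntiOn (fun u => W (A u) - W (B u)) (Icc (e - 2 * δ) (e - δ)) := by
    refine strictAntiOn_of_deriv_neg (convex_Icc _ _) hEc fun u hu => ?_
    rw [interior_Icc] at hu
    rw [(hderE u (Ioo_subset_Icc_self hu)).deriv]
    exact hneg u (Ioo_subset_Icc_self hu)
  have hl := hbefore (e - 2 * δ) ⟨by linarith, le_rfl⟩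
  have hr := hafter (e - δ) ⟨le_rfl, by linarith [hf.le]⟩
  obtain ⟨v, hv, hv0⟩ := intermediate_value_Ioo' (by linarith) hEc
    (show (0 : ℝ) ∈ Ioo (W (A (e - δ)) - W (B (e - δ))) (W (A (e - 2 * δ)) - W (B (e - 2 * δ))) from
      ⟨by linarith, by linarith⟩)
  have hv' := Ioo_subset_Icc_self hv
  dsimp only at hv0
  refine ⟨v, ⟨hv.1, by linarith [hv.2]⟩, fun u hu => ⟨fun huv => ?_, fun huv => ?_, fun huv => ?_⟩, ?_⟩
  · rcases le_total u (e - 2 * δ) with h1 | h1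
    · exact hbefore u ⟨hu.1, h1⟩
    · have := hanti ⟨h1, by linarith [hv.2]⟩ hv' huv
      dsimp only at this
      linarith
  · rw [huv]; linarith
  · rcases le_total (e - δ) u with h1 | h1
    · exact hafter u ⟨h1, hu.2⟩
    · have := hanti hv' ⟨by linarith [hv.1], h1⟩ huv
      dsimp only at this
      linarith
  · intro heq
    have hA0 := hcr v (hJ3 hv') _ (hf.strandA.section_eq v (hJ2 hv'))
    have hB0 := hcr v (hJ3 hv') _ (hf.strandB.section_eq v (hJ2 hv'))
    have := hneg v hv'
    rw [div_sub_div _ _ hA0 hB0] at this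
    rw [show deriv W (A v) * deriv x (B v) - deriv x (A v) * deriv W (B v) = 0 by linarith] at this
    simp at this

/-- The shear that turns the fibre order of the front into that of a knot diagram. -/
theorem exists_shear (h : FrontCurve x y z) {S : Finset (ℝ × ℝ)} {A B : ℝ × ℝ → ℝ → ℝ}
    {q : ℝ × ℝ → ℝ} {d ρ M N δ₀ : ℝ} (hS : IsFeatureSystem x y z S A B q d ρ M) (hN : M ≤ N)
    (hδ₀ : 0 < δ₀) :
    ∃ (F : ℝ → ℝ) (v : ℝ × ℝ → ℝ), (∀ n : ℕ∞, ContDiff ℝ n F) ∧ (∀ u, N ≤ F u) ∧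
      ∀ i ∈ S, v i ∈ Ioo (x i.1 - d) (x i.1) ∧ x i.1 - δ₀ < v i ∧
        CrossesAt (fun θ => F (x θ) * z θ + y θ) (A i) (B i) (Ico (x i.1 - d) (q i)) (v i) ∧
        deriv x (A i (v i)) * deriv (fun θ => F (x θ) * z θ + y θ) (B i (v i)) ≠
          deriv x (B i (v i)) * deriv (fun θ => F (x θ) * z θ + y θ) (A i (v i)) := by
  classical
  have hN0 : 0 < N := hS.M_pos.trans_le hN
  have hd := hS.d_pos
  obtain ⟨V, hV, hVe⟩ := exists_sawtooth (S.image fun i => x i.1) hd (by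
    intro e he e' he' hne
    obtain ⟨i, hi, rfl⟩ := Finset.mem_image.1 he
    obtain ⟨j, hj, rfl⟩ := Finset.mem_image.1 he'
    exact hS.ends i hi j hj hne)
  have h1 : ∀ᶠ δ in 𝓝[>] (0 : ℝ), ∀ i ∈ S, ∀ u ∈ Ico (x i.1 - 2 * δ) (x i.1),
      (N + 1) * (z (A i u) - z (B i u)) < y (B i u) - y (A i u) ∧
        ∀ θ, x θ = u → deriv x θ ≠ 0 := by
    rw [eventually_all_finset]
    exact fun i hi => eventually_Ico_of_eventually_left
      (((hS.feature i hi).steep (N + 1)).and (h.eventually_not_critical (x i.1)))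
  have h2 : ∀ᶠ δ in 𝓝[>] (0 : ℝ), δ < min d δ₀ / 2 :=
    nhdsWithin_le_nhds (eventually_lt_nhds (by positivity))
  obtain ⟨δ, ⟨h1, h2⟩, hδ⟩ := ((h1.and h2).and self_mem_nhdsWithin).exists
  have hδ : 0 < δ := hδ
  have h3 := min_le_left d δ₀
  have h4 := min_le_right d δ₀
  have h5 : ∀ᶠ k in atTop, ∀ i ∈ S, ∀ F : ℝ → ℝ, Differentiable ℝ F → (∀ u, 0 < F u) →
      (∀ u ∈ Icc (x i.1 - d) (x i.1), F u = N + Real.exp (-k * (u - x i.1 + δ))) →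
      ∃ v ∈ Ioo (x i.1 - 2 * δ) (x i.1),
        CrossesAt (fun θ => F (x θ) * z θ + y θ) (A i) (B i) (Ico (x i.1 - d) (q i)) v ∧
        deriv x (A i v) * deriv (fun θ => F (x θ) * z θ + y θ) (B i v) ≠
          deriv x (B i v) * deriv (fun θ => F (x θ) * z θ + y θ) (A i v) := by
    rw [eventually_all_finset]
    exact fun i hi => h.exists_shear_crossing (hS.feature i hi) hN0.le hδ (by linarith)
      (fun u hu => (h1 i hi u hu).1) fun u hu => (h1 i hi u hu).2
  obtain ⟨k, hk⟩ := h5.exists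
  -- One rate k serves all features, and V equals u − e to the left of each feature abscissa e, so
  -- this single F has the required form at all of them, including several features over the same
  -- abscissa.
  set F : ℝ → ℝ := fun u => N + Real.exp (-k * (V u + δ)) with hFdef
  have hFs : ∀ n : ℕ∞, ContDiff ℝ n F := fun n =>
    contDiff_const.add (contDiff_const.mul ((hV n).add contDiff_const)).exp
  have hFN : ∀ u, N ≤ F u := fun u => by
    have := Real.exp_pos (-k * (V u + δ))
    simp only [hFdef]; linarith
  have hv : ∀ i ∈ S, _ := fun i hi => hk i hi F ((hFs 1).differentiable one_ne_zero)
    (fun u => hN0.trans_le (hFN u)) (fun u hu => by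
      simp only [hFdef]; rw [hVe _ (Finset.mem_image_of_mem _ hi) u hu])
  choose! v hv1 hv2 hv3 using hv
  exact ⟨F, v, hFs, hFN, fun i hi => ⟨⟨by linarith [(hv1 i hi).1], (hv1 i hi).2⟩,
    by linarith [(hv1 i hi).1], hv2 i hi, hv3 i hi⟩⟩

end FrontCurve

/-! ### Regularity and the Legendrian isotopy -/

theorem exists_smooth_primitive {F : ℝ → ℝ} (hF : ∀ n : ℕ∞, ContDiff ℝ n F) :
    ∃ f : ℝ → ℝ, (∀ n : ℕ∞, ContDiff ℝ n f) ∧ ∀ u, HasDerivAt f (F u) u := by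
  have hd : ∀ u, HasDerivAt (fun u => ∫ t in (0 : ℝ)..u, F t) (F u) u := fun u =>
    ((hF 0).continuous.integral_hasStrictDerivAt 0 u).hasDerivAt
  refine ⟨_, fun n => ?_, hd⟩
  have h : ContDiff ℝ (⊤ : ℕ∞) fun u => ∫ t in (0 : ℝ)..u, F t := by
    rw [contDiff_infty_iff_deriv]
    refine ⟨fun u => (hd u).differentiableAt, ?_⟩
    rw [show deriv (fun u => ∫ t in (0 : ℝ)..u, F t) = F from funext fun u => (hd u).deriv]
    exact hF ⊤
  exact h.of_le (by exact_mod_cast le_top)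

/-- A smooth positive factor `F` for which `F · z + y` orders the strands as a knot diagram: it
follows `z` except at the features, whose strands cross once, transversally, over `v`. -/
structure IsShear (x y z : ℝ → ℝ) (S : Finset (ℝ × ℝ)) (A B : ℝ × ℝ → ℝ → ℝ) (q : ℝ × ℝ → ℝ)
    (d ρ M : ℝ) (F : ℝ → ℝ) (v : ℝ × ℝ → ℝ) : Prop where
  system : IsFeatureSystem x y z S A B q d ρ M
  smooth : ∀ n : ℕ∞, ContDiff ℝ n F
  le : ∀ u, M ≤ F u
  mem : ∀ i ∈ S, v i ∈ Ioo (x i.1 - d) (x i.1)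
  crosses : ∀ i ∈ S, CrossesAt (fun θ => F (x θ) * z θ + y θ) (A i) (B i)
    (Ico (x i.1 - d) (q i)) (v i)
  transverse : ∀ i ∈ S, deriv x (A i (v i)) * deriv (fun θ => F (x θ) * z θ + y θ) (B i (v i)) ≠
    deriv x (B i (v i)) * deriv (fun θ => F (x θ) * z θ + y θ) (A i (v i))

namespace IsShear

variable {x y z F : ℝ → ℝ} {S : Finset (ℝ × ℝ)} {A B : ℝ × ℝ → ℝ → ℝ} {q v : ℝ × ℝ → ℝ} {d ρ M : ℝ}

theorem pos (hF : IsShear x y z S A B q d ρ M F v) (u : ℝ) : 0 < F u :=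
  hF.system.M_pos.trans_le (hF.le u)

theorem mem_Ico (hF : IsShear x y z S A B q d ρ M F v) {i : ℝ × ℝ} (hi : i ∈ S) :
    v i ∈ Ico (x i.1 - d) (q i) :=
  ⟨(hF.mem i hi).1.le, (hF.mem i hi).2.trans_le (hF.system.feature i hi).le⟩

/-- The heights differ, so the implication from the order of z to that of W, applied to the pair in
both orders, becomes an equivalence. -/
theorem order_of_not_onStrands (hF : IsShear x y z S A B q d ρ M F v) {s t : ℝ} (hx : x s = x t)
    (hne : ¬ SameCirclePoint s t)
    (h : ∀ i ∈ S, ¬ OnStrands x (A i) (B i) (Ico (x i.1 - d) (q i)) s t ∧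
      ¬ OnStrands x (A i) (B i) (Ico (x i.1 - d) (q i)) t s) :
    z s ≠ z t ∧ (z s < z t ↔ F (x s) * z s + y s < F (x t) * z t + y t) := by
  have h1 := hF.system.other s t hx hne h
  have h2 := hF.system.other t s hx.symm (fun h => hne h.symm) fun i hi => (h i hi).symm
  refine ⟨h1.1, fun hlt => ?_, fun hlt => ?_⟩
  · have := h1.2 hlt _ (hF.le (x s)); rwa [← hx]
  · by_contra hcon
    have h3 := h2.2 (lt_of_le_of_ne (not_lt.1 hcon) h1.1.symm) _ (hF.le (x s))
    rw [← hx] at hlt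
    linarith

/-- Pairs off the features are strictly ordered by W, and the strands of a feature have equal W only
over v i. So the new diagram has exactly the double points prescribed by the features. -/
theorem exists_of_crossing (hF : IsShear x y z S A B q d ρ M F v) {s t : ℝ} (hx : x s = x t)
    (hne : ¬ SameCirclePoint s t) (hW : F (x s) * z s + y s = F (x t) * z t + y t)
    (py : Function.Periodic y 1) (pz : Function.Periodic z 1) (px : Function.Periodic x 1) :
    ∃ i ∈ S, x s = v i ∧ ((SameCirclePoint (A i (v i)) s ∧ SameCirclePoint (B i (v i)) t) ∨
      (SameCirclePoint (A i (v i)) t ∧ SameCirclePoint (B i (v i)) s)) := by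
  have pW : Function.Periodic (fun θ => F (x θ) * z θ + y θ) 1 := fun θ => by
    simp only [px θ, py θ, pz θ]
  by_contra hcon
  push Not at hcon
  have key : ∀ s t, F (x s) * z s + y s = F (x t) * z t + y t → ∀ i ∈ S,
      OnStrands x (A i) (B i) (Ico (x i.1 - d) (q i)) s t → x s = v i := by
    intro s t hW i hi hon
    have h1 := hF.crosses i hi (x s) hon.1
    have h2 := hon.eq_eval pW
    dsimp only at h1 h2
    rw [← h2.1, ← h2.2] at h1
    rcases lt_trichotomy (x s) (v i) with h3 | h3 | h3
    · exact absurd (h1.1 h3) (by rw [hW]; exact lt_irrefl _)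
    · exact h3
    · exact absurd (h1.2.2 h3) (by rw [hW]; exact lt_irrefl _)
  have h1 := hF.order_of_not_onStrands hx hne fun i hi => by
    constructor
    · intro hon
      have h := key s t hW i hi hon
      exact (hcon i hi h).1 (h ▸ hon.2.2.1) (h ▸ hon.2.2.2)
    · intro hon
      have h := key t s hW.symm i hi hon
      exact (hcon i hi (hx.trans h)).2 (h ▸ hon.2.2.1) (h ▸ hon.2.2.2)
  have h2 := hF.order_of_not_onStrands hx.symm (fun h => hne h.symm) fun i hi => by
    constructor
    · intro hon
      have h := key t s hW.symm i hi hon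
      exact (hcon i hi (hx.trans h)).2 (h ▸ hon.2.2.1) (h ▸ hon.2.2.2)
    · intro hon
      have h := key s t hW i hi hon
      exact (hcon i hi h).1 (h ▸ hon.2.2.1) (h ▸ hon.2.2.2)
  rcases lt_or_gt_of_ne h1.1 with h3 | h3
  · exact absurd (h1.2.1 h3) (by rw [hW]; exact lt_irrefl _)
  · exact absurd (h2.2.1 h3) (by rw [hW]; exact lt_irrefl _)

theorem det_ne_zero (hF : IsShear x y z S A B q d ρ M F v) (h : FrontCurve x y z) {s t : ℝ}
    (hx : x s = x t) (hne : ¬ SameCirclePoint s t)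
    (hW : F (x s) * z s + y s = F (x t) * z t + y t) :
    deriv x s * deriv (fun θ => F (x θ) * z θ + y θ) t ≠
      deriv x t * deriv (fun θ => F (x θ) * z θ + y θ) s := by
  have pW : Function.Periodic (fun θ => F (x θ) * z θ + y θ) 1 := fun θ => by
    simp only [h.px θ, h.py θ, h.pz θ]
  obtain ⟨i, hi, -, ⟨h1, h2⟩ | ⟨h1, h2⟩⟩ := hF.exists_of_crossing hx hne hW h.py h.pz h.px
  · have := hF.transverse i hi
    rwa [h1.periodic_eq (deriv_periodic h.px), h2.periodic_eq (deriv_periodic h.px),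
      h1.periodic_eq (deriv_periodic pW), h2.periodic_eq (deriv_periodic pW)] at this
  · have := (hF.transverse i hi).symm
    rwa [h1.periodic_eq (deriv_periodic h.px), h2.periodic_eq (deriv_periodic h.px),
      h1.periodic_eq (deriv_periodic pW), h2.periodic_eq (deriv_periodic pW)] at this

/-- The positive factor depends on x alone, so double points and transversality reduce to those of
W. Where x' = 0 the second velocity component is the factor times y', hence nonzero. A triple point
would put one parameter on two features or force two parameters to coincide. Equal z at a double
point of W would give equal y and contradict embeddedness. -/
theorem isRegular (hF : IsShear x y z S A B q d ρ M F v) (h : FrontCurve x y z) {f : ℝ → ℝ}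
    (hf : ∀ u, HasDerivAt f (F u) u) (hfs : ContDiff ℝ 1 f) :
    PlaneDiagram.IsRegular
      ⟨fun θ => (x θ, Real.exp (f (x θ)) * (F (x θ) * z θ + y θ)),
        fun s t => Real.exp (f (x t)) * z t < Real.exp (f (x s)) * z s⟩ := by
  have hexp : ∀ {s t}, x s = x t → Real.exp (f (x s)) * (F (x s) * z s + y s) =
      Real.exp (f (x t)) * (F (x t) * z t + y t) → F (x s) * z s + y s = F (x t) * z t + y t := by
    intro s t hx he
    rw [hx] at he ⊢
    exact mul_left_cancel₀ (Real.exp_ne_zero _) he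
  have hcross : ∀ {s t}, (x s, Real.exp (f (x s)) * (F (x s) * z s + y s)) =
      (x t, Real.exp (f (x t)) * (F (x t) * z t + y t)) →
      x s = x t ∧ F (x s) * z s + y s = F (x t) * z t + y t := by
    intro s t he
    have h1 := (Prod.ext_iff.1 he).1
    exact ⟨h1, hexp h1 (Prod.ext_iff.1 he).2⟩
  have hFd : Differentiable ℝ F := (hF.smooth 1).differentiable one_ne_zero
  have hder : ∀ θ, HasDerivAt (fun θ => (x θ, Real.exp (f (x θ)) * (F (x θ) * z θ + y θ)))
      (deriv x θ, Real.exp (f (x θ)) * (F (x θ) * deriv x θ) * (F (x θ) * z θ + y θ) +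
        Real.exp (f (x θ)) * deriv (fun θ => F (x θ) * z θ + y θ) θ) θ := by
    intro θ
    have hx := (h.hx.differentiable one_ne_zero θ).hasDerivAt
    exact hx.prodMk ((((hf (x θ)).comp θ hx).exp).mul
      (h.deriv_shear hFd θ).differentiableAt.hasDerivAt)
  have hsm : ContDiff ℝ 1 fun θ => F (x θ) * z θ + y θ :=
    (((hF.smooth 1).comp h.hx).mul h.hz).add h.hy
  refine ⟨h.hx.prodMk ((hfs.comp h.hx).exp.mul hsm), fun θ => ?_, fun θ => ?_, ?_, ?_, ?_, ?_⟩
  · simp only [h.px θ, h.py θ, h.pz θ]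
  · dsimp only
    rw [(hder θ).deriv, (h.deriv_shear hFd θ).deriv]
    intro h0
    have h1 := (Prod.ext_iff.1 h0).1
    have h2 := (Prod.ext_iff.1 h0).2
    simp only [Prod.fst_zero, Prod.snd_zero] at h1 h2
    rw [h1] at h2
    simp only [mul_zero, zero_mul, zero_add, mul_eq_zero, Real.exp_ne_zero, false_or] at h2
    exact h.imm θ h1 h2
  · refine ((S.finite_toSet.image fun i => (Int.fract (A i (v i)), Int.fract (B i (v i)))).union
      (S.finite_toSet.image fun i => (Int.fract (B i (v i)), Int.fract (A i (v i))))).subset ?_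
    rintro ⟨s, t⟩ ⟨hs, ht, hne, he⟩
    obtain ⟨hx, hW⟩ := hcross he
    have hfr : ∀ {a s : ℝ}, s ∈ Ico (0 : ℝ) 1 → SameCirclePoint a s → Int.fract a = s :=
      fun hs has => ((SameCirclePoint.fract _).symm.trans has).eq_of_mem_Ico
        ⟨Int.fract_nonneg _, Int.fract_lt_one _⟩ hs
    obtain ⟨i, hi, -, ⟨h1, h2⟩ | ⟨h1, h2⟩⟩ := hF.exists_of_crossing hx hne hW h.py h.pz h.px
    · exact Or.inl ⟨i, hi, Prod.ext (hfr hs h1) (hfr ht h2)⟩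
    · exact Or.inr ⟨i, hi, Prod.ext (hfr hs h2) (hfr ht h1)⟩
  · rintro s t ⟨hne, he⟩
    obtain ⟨hx, hW⟩ := hcross he
    have hdet := hF.det_ne_zero h hx hne hW
    dsimp only
    rw [LinearIndependent.pair_iff, (hder s).deriv, (hder t).deriv]
    intro a b hab
    obtain ⟨h1, h2⟩ := Prod.ext_iff.1 hab
    simp only [Prod.fst_add, Prod.snd_add, Prod.smul_fst, Prod.smul_snd, smul_eq_mul,
      Prod.fst_zero, Prod.snd_zero] at h1 h2
    have h3 : a * deriv (fun θ => F (x θ) * z θ + y θ) s +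
        b * deriv (fun θ => F (x θ) * z θ + y θ) t = 0 := by
      rw [hW, hx] at h2
      -- Differentiating the exponential factor only adds a multiple of the relation `h1` between
      -- the first components.
      have h4 : Real.exp (f (x t)) * (F (x t)) * (F (x t) * z t + y t) *
          (a * deriv x s + b * deriv x t) + Real.exp (f (x t)) *
          (a * deriv (fun θ => F (x θ) * z θ + y θ) s +
          b * deriv (fun θ => F (x θ) * z θ + y θ) t) = 0 := by
        rw [← h2]; ring
      rw [h1, mul_zero, zero_add] at h4
      exact (mul_eq_zero.1 h4).resolve_left (Real.exp_ne_zero _)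
    have hsub := sub_ne_zero.2 hdet
    constructor
    · refine (mul_eq_zero.1 (?_ : a * _ = 0)).resolve_right hsub
      linear_combination deriv (fun θ => F (x θ) * z θ + y θ) t * h1 - deriv x t * h3
    · refine (mul_eq_zero.1 (?_ : b * _ = 0)).resolve_right hsub
      linear_combination deriv x s * h3 - deriv (fun θ => F (x θ) * z θ + y θ) s * h1
  · intro s t u hst hsu
    obtain ⟨hx, hW⟩ := hcross hst
    obtain ⟨hx', hW'⟩ := hcross hsu
    by_contra hcon
    push Not at hcon
    obtain ⟨i, hi, h1, h2⟩ := hF.exists_of_crossing hx hcon.1 hW h.py h.pz h.px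
    obtain ⟨j, hj, h3, h4⟩ := hF.exists_of_crossing hx' hcon.2.1 hW' h.py h.pz h.px
    have hij : i = j := by
      refine hF.system.disjoint i hi j hj s (h1 ▸ hF.mem_Ico hi) (h3 ▸ hF.mem_Ico hj) ?_ ?_
      · rw [h1]; rcases h2 with h2 | h2
        exacts [Or.inl h2.1, Or.inr h2.2]
      · rw [h3]; rcases h4 with h4 | h4
        exacts [Or.inl h4.1, Or.inr h4.2]
    subst hij
    rcases h2 with h2 | h2 <;> rcases h4 with h4 | h4
    · exact hcon.2.2 (h2.2.symm.trans h4.2)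
    · exact hcon.1 (h4.2.symm.trans h2.2)
    · exact hcon.1 (h4.1.symm.trans h2.1)
    · exact hcon.2.2 (h2.1.symm.trans h4.1)
  · rintro s t ⟨hne, he⟩
    obtain ⟨hx, hW⟩ := hcross he
    have hz : z s ≠ z t := by
      intro hz
      rw [hx, hz] at hW
      exact hne (h.emb s t hx (by linarith) hz)
    dsimp only
    rw [hx, mul_lt_mul_iff_right₀ (Real.exp_pos _), mul_lt_mul_iff_right₀ (Real.exp_pos _)]
    rcases lt_or_gt_of_ne hz with h1 | h1
    · exact Or.inr ⟨h1, h1.asymm⟩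
    · exact Or.inl ⟨h1, h1.asymm⟩

end IsShear

theorem IsLegendrianKnot.of_coords {r : ℕ∞} (hr : 1 ≤ r) {x y z : ℝ → ℝ} (hx : ContDiff ℝ r x)
    (hy : ContDiff ℝ r y) (hz : ContDiff ℝ r z) (px : Function.Periodic x 1)
    (py : Function.Periodic y 1) (pz : Function.Periodic z 1)
    (leg : ∀ θ, deriv z θ = y θ * deriv x θ) (imm : ∀ θ, deriv x θ = 0 → deriv y θ ≠ 0)
    (emb : ∀ s t, x s = x t → y s = y t → z s = z t → SameCirclePoint s t) :
    IsLegendrianKnot r fun θ => (x θ, y θ, z θ) := by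
  have hr0 : (r : WithTop ℕ∞) ≠ 0 := by
    intro h
    have : r = 0 := by exact_mod_cast h
    rw [this] at hr
    exact absurd hr (by simp)
  have hder : ∀ θ, HasDerivAt (fun θ => (x θ, y θ, z θ)) (deriv x θ, deriv y θ, deriv z θ) θ :=
    fun θ => (hx.differentiable hr0 θ).hasDerivAt.prodMk
      ((hy.differentiable hr0 θ).hasDerivAt.prodMk (hz.differentiable hr0 θ).hasDerivAt)
  refine ⟨hx.prodMk (hy.prodMk hz), fun θ => by simp only [px θ, py θ, pz θ], fun θ => ?_,
    fun s t hst => ?_, fun θ => ?_⟩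
  · rw [(hder θ).deriv]
    intro h
    simp only [Prod.mk_eq_zero] at h
    exact imm θ h.1 h.2.1
  · simp only [Prod.mk.injEq] at hst
    exact emb s t hst.1 hst.2.1 hst.2.2
  · rw [(hder θ).deriv, xiStd, Submodule.mem_span_pair]
    refine ⟨deriv y θ, deriv x θ, ?_⟩
    simp only [leg θ, Prod.smul_mk, smul_eq_mul, Prod.mk_add_mk, Prod.mk.injEq]
    refine ⟨?_, ?_, ?_⟩ <;> ring

theorem IsLegendrianKnot.hasDerivAt_coords {r : ℕ∞} (hr : 1 ≤ r) {φ : ℝ → ℝ × ℝ × ℝ}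
    (h : IsLegendrianKnot r φ) (θ : ℝ) :
    HasDerivAt (xCoord φ) (deriv φ θ).1 θ ∧ HasDerivAt (yCoord φ) (deriv φ θ).2.1 θ ∧
      HasDerivAt (zCoord φ) (deriv φ θ).2.2 θ := by
  have hd : HasDerivAt φ (deriv φ θ) θ :=
    ((h.contDiff.of_le (by exact_mod_cast hr)).differentiable one_ne_zero θ).hasDerivAt
  have h1 := hd.hasFDerivAt.fst.hasDerivAt
  have h2 := hd.hasFDerivAt.snd
  have h3 := h2.fst.hasDerivAt
  have h4 := h2.snd.hasDerivAt
  simp only [ContinuousLinearMap.comp_apply, ContinuousLinearMap.coe_fst',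
    ContinuousLinearMap.coe_snd', ContinuousLinearMap.toSpanSingleton_apply, one_smul] at h1 h3 h4
  exact ⟨h1, h3, h4⟩

/-- Membership in the contact plane means z' = y x', and a vector of that plane with vanishing x and
y components is zero. This turns the immersion condition into the one on x' and y'. -/
theorem IsLegendrianKnot.frontCurve {r : ℕ∞} (hr : 1 ≤ r) {φ : ℝ → ℝ × ℝ × ℝ}
    (h : IsLegendrianKnot r φ) (hg : HasGenericFront φ) :
    FrontCurve (xCoord φ) (yCoord φ) (zCoord φ) where
  hx := (h.contDiff.of_le (by exact_mod_cast hr)).fst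
  hy := (h.contDiff.of_le (by exact_mod_cast hr)).snd.fst
  hz := (h.contDiff.of_le (by exact_mod_cast hr)).snd.snd
  px θ := by simp only [xCoord, h.periodic θ]
  py θ := by simp only [yCoord, h.periodic θ]
  pz θ := by simp only [zCoord, h.periodic θ]
  leg θ := by
    obtain ⟨h1, -, h3⟩ := h.hasDerivAt_coords hr θ
    obtain ⟨a, b, hab⟩ := Submodule.mem_span_pair.1 (h.legendrian θ)
    rw [h1.deriv, h3.deriv, ← hab, yCoord]
    simp [mul_comm]
  imm θ := by
    obtain ⟨h1, h2, -⟩ := h.hasDerivAt_coords hr θ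
    obtain ⟨a, b, hab⟩ := Submodule.mem_span_pair.1 (h.legendrian θ)
    intro h4 h5
    refine h.immersion θ ?_
    rw [h1.deriv, ← hab] at h4
    rw [h2.deriv, ← hab] at h5
    simp at h4 h5
    rw [← hab, h4, h5]; simp
  emb s t h1 h2 h3 := h.embedding s t (Prod.ext h1 (Prod.ext h2 h3))
  fin := hg.finite_singular
  no_triple s t u h1 h2 h3 h4 := hg.no_triple s t u (Prod.ext h1 h2) (Prod.ext h3 h4)
  cusp_simple c t hc h1 h2 := hg.cusp_simple c t hc (Prod.ext h1 h2)

/-- Shearing is a Legendrian isotopy. -/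
theorem IsLegendrianKnot.isotopic_shear {r : ℕ∞} (hr : 1 ≤ r) {φ : ℝ → ℝ × ℝ × ℝ}
    (h : IsLegendrianKnot r φ) (hg : HasGenericFront φ) {f F : ℝ → ℝ}
    (hf : ∀ u, HasDerivAt f (F u) u) (hfs : ∀ n : ℕ∞, ContDiff ℝ n f)
    (hFs : ∀ n : ℕ∞, ContDiff ℝ n F) :
    LegendrianIsotopic r φ fun θ => (xCoord φ θ,
      Real.exp (f (xCoord φ θ)) * (F (xCoord φ θ) * zCoord φ θ + yCoord φ θ),
      Real.exp (f (xCoord φ θ)) * zCoord φ θ) := by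
  have hc := h.frontCurve hr hg
  have hx : ContDiff ℝ r (xCoord φ) := h.contDiff.fst
  have hy : ContDiff ℝ r (yCoord φ) := h.contDiff.snd.fst
  have hz : ContDiff ℝ r (zCoord φ) := h.contDiff.snd.snd
  set x := xCoord φ
  set y := yCoord φ
  set z := zCoord φ
  -- At time τ the shear belongs to the function τf. The nonzero factor and the shear can be undone
  -- fibrewise, so each stage remains embedded; where x' = 0 the derivative of the new y is a
  -- nonzero multiple of the old one.
  refine ⟨fun τ θ => (x θ, Real.exp (τ * f (x θ)) * (τ * F (x θ) * z θ + y θ),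
    Real.exp (τ * f (x θ)) * z θ), ContDiff.contDiffOn ?_, fun τ _ => ?_, ?_, ?_⟩
  · have hx' : ContDiff ℝ r fun p : ℝ × ℝ => x p.2 := hx.comp contDiff_snd
    have hy' : ContDiff ℝ r fun p : ℝ × ℝ => y p.2 := hy.comp contDiff_snd
    have hz' : ContDiff ℝ r fun p : ℝ × ℝ => z p.2 := hz.comp contDiff_snd
    have he : ContDiff ℝ r fun p : ℝ × ℝ => Real.exp (p.1 * f (x p.2)) :=
      (contDiff_fst.mul ((hfs r).comp hx')).exp
    exact hx'.prodMk ((he.mul (((contDiff_fst.mul ((hFs r).comp hx')).mul hz').add hy')).prodMk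
      (he.mul hz'))
  · have he : ContDiff ℝ r fun θ => Real.exp (τ * f (x θ)) :=
      (contDiff_const.mul ((hfs r).comp hx)).exp
    have hF : ContDiff ℝ r fun θ => τ * F (x θ) := contDiff_const.mul ((hFs r).comp hx)
    have hdx : ∀ θ, HasDerivAt x (deriv x θ) θ := fun θ =>
      (hc.hx.differentiable one_ne_zero θ).hasDerivAt
    have hdy : ∀ θ, HasDerivAt y (deriv y θ) θ := fun θ =>
      (hc.hy.differentiable one_ne_zero θ).hasDerivAt
    have hdz : ∀ θ, HasDerivAt z (y θ * deriv x θ) θ := fun θ =>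
      hc.leg θ ▸ (hc.hz.differentiable one_ne_zero θ).hasDerivAt
    have hde : ∀ θ, HasDerivAt (fun θ => Real.exp (τ * f (x θ)))
        (Real.exp (τ * f (x θ)) * (τ * (F (x θ) * deriv x θ))) θ := fun θ =>
      (((hf (x θ)).comp θ (hdx θ)).const_mul τ).exp
    refine IsLegendrianKnot.of_coords hr hx (he.mul ((hF.mul hz).add hy)) (he.mul hz) hc.px
      (fun θ => ?_) (fun θ => ?_) (fun θ => ?_) (fun θ h0 => ?_) fun s t h1 h2 h3 => ?_
    · simp only [hc.px θ, hc.py θ, hc.pz θ]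
    · simp only [hc.px θ, hc.pz θ]
    · exact ((hde θ).mul (hdz θ)).deriv.trans (by ring)
    · have hdF : HasDerivAt (fun θ => τ * F (x θ)) (τ * (deriv F (x θ) * deriv x θ)) θ :=
        ((((hFs 1).differentiable one_ne_zero (x θ)).hasDerivAt).comp θ (hdx θ)).const_mul τ
      refine ne_of_eq_of_ne ((hde θ).mul ((hdF.mul (hdz θ)).add (hdy θ))).deriv ?_
      rw [h0]
      simpa using hc.imm θ h0
    · rw [h1] at h2 h3
      have h4 : z s = z t := mul_left_cancel₀ (Real.exp_ne_zero _) h3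
      have h5 := mul_left_cancel₀ (Real.exp_ne_zero _) h2
      rw [h4] at h5
      exact hc.emb s t h1 (by linarith) h4
  · funext θ
    simp only [zero_mul, Real.exp_zero, one_mul, zero_add]
    rfl
  · simp only [one_mul]

/-! ### Windows around the cusps -/

/-- The `ε`-windows around the cusps are disjoint and contain no crossing. -/
structure IsWindowRadius (x z : ℝ → ℝ) (ε : ℝ) : Prop where
  pos : 0 < ε
  separated : ∀ c c', IsLocalExtr x c → IsLocalExtr x c' → c ≠ c' → 2 * ε ≤ |c - c'|
  crossing_free : ∀ c s t, IsLocalExtr x c → |s - c| < ε → x s = x t → z s = z t →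
    SameCirclePoint s t

namespace IsWindowRadius

variable {x z : ℝ → ℝ} {ε : ℝ}

theorem max (h : IsWindowRadius x z ε) {ε' : ℝ} (h' : IsWindowRadius x z ε') :
    IsWindowRadius x z (max ε ε') := by
  rcases le_total ε ε' with hle | hle
  · rwa [max_eq_right hle]
  · rwa [max_eq_left hle]

theorem eq_of_common (h : IsWindowRadius x z ε) {c c' θ : ℝ} (hc : IsLocalExtr x c)
    (hc' : IsLocalExtr x c') (h1 : |θ - c| < ε) (h2 : |θ - c'| < ε) : c = c' := by
  by_contra hne
  have h3 := h.separated c c' hc hc' hne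
  have h4 : |c - c'| ≤ |θ - c'| + |θ - c| := by
    have := abs_sub (θ - c') (θ - c); simpa using this
  linarith

end IsWindowRadius

theorem IsLocalExtr.of_sameCirclePoint {x : ℝ → ℝ} (px : Function.Periodic x 1) {s t : ℝ}
    (hs : IsLocalExtr x s) (h : SameCirclePoint s t) : IsLocalExtr x t :=
  hs.elim (fun hs => Or.inl ((isLocalExtr_of_sameCirclePoint px h).2 hs))
    fun hs => Or.inr ((isLocalExtr_of_sameCirclePoint px h).1 hs)

namespace FrontCurve

variable {x y z : ℝ → ℝ}

theorem finite_extr (h : FrontCurve x y z) : {c ∈ Ico (0 : ℝ) 1 | IsLocalExtr x c}.Finite :=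
  h.fin.subset fun _ hc => ⟨hc.1, hc.2.deriv_eq_zero⟩

/-- The integer translate of a cusp is again a cusp, so a window is no longer than one period. -/
theorem two_mul_le_one (h : FrontCurve x y z) {ε c : ℝ} (hε : IsWindowRadius x z ε)
    (hc : IsLocalExtr x c) : 2 * ε ≤ 1 := by
  have := hε.separated c (c + 1) hc (hc.of_sameCirclePoint h.px ⟨1, by simp⟩) (by simp)
  simpa using this

/-- One separation radius for critical parameters and crossing parameters gives disjoint windows
free of crossings. The additional clause says that at a left cusp the slopes are ordered as the
heights. -/
theorem exists_windowRadius (h : FrontCurve x y z) : ∃ ε, IsWindowRadius x z ε ∧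
    ∀ c, ¬ IsLocalMax x c → IsLocalExtr x c → ∀ s t, |s - c| < ε → |t - c| < ε → x s = x t →
      z s < z t → y s < y t := by
  set C : Set ℝ := {θ ∈ Ico (0 : ℝ) 1 | deriv x θ = 0} ∪
    (Prod.fst '' {p : ℝ × ℝ | p.1 ∈ Icc (0 : ℝ) 1 ∧ p.2 ∈ Icc (0 : ℝ) 1 ∧ x p.1 = x p.2 ∧
      z p.1 = z p.2 ∧ ¬ SameCirclePoint p.1 p.2} ∩ Ico (0 : ℝ) 1) with hC
  have hCf : C.Finite := h.fin.union ((h.finite_crossings.image _).inter_of_left _)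
  obtain ⟨ρ, hρ, -, hsep⟩ := exists_separation hCf
    (union_subset (fun _ h => h.1) inter_subset_right)
  choose η hη hηw using h.exists_diagonal_window
  have h1 : ∀ᶠ ε in 𝓝[>] (0 : ℝ), ∀ c ∈ h.finite_extr.toFinset, ε < η c := by
    rw [eventually_all_finset]
    exact fun c _ => nhdsWithin_le_nhds (eventually_lt_nhds (hη c))
  obtain ⟨ε, ⟨h1, h2⟩, hε⟩ := ((h1.and (nhdsWithin_le_nhds (eventually_lt_nhds hρ))).and
    self_mem_nhdsWithin).exists
  have hε : 0 < ε := hε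
  have hmemC : ∀ c, IsLocalExtr x c → Int.fract c ∈ C := fun c hc =>
    Or.inl ⟨⟨Int.fract_nonneg _, Int.fract_lt_one _⟩,
      (hc.of_sameCirclePoint h.px (SameCirclePoint.fract c)).deriv_eq_zero⟩
  have hshift : ∀ c s : ℝ, |s - c| < ε → |s - ⌊c⌋ - Int.fract c| < ρ := fun c s hs => by
    rw [Int.fract]; rw [show s - ⌊c⌋ - (c - ⌊c⌋) = s - c by ring]; linarith
  refine ⟨ε, ⟨hε, fun c c' hc hc' hne => ?_, fun c s t hc hs hx hz => ?_⟩,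
    fun c hc hc' s t hs ht hx hz => ?_⟩
  · by_contra hlt
    push Not at hlt
    have h3 : |(c + c') / 2 - c| < ε := by
      rw [show (c + c') / 2 - c = -((c - c') / 2) by ring, abs_neg, abs_div]
      norm_num; linarith
    have h4 : |(c + c') / 2 - c'| < ε := by
      rw [show (c + c') / 2 - c' = (c - c') / 2 by ring, abs_div]
      norm_num; linarith
    obtain ⟨h5, h6⟩ := hsep _ (hmemC c hc) _ (hmemC c' hc') _ _
      ⟨⌊c⌋ - ⌊c'⌋, by push_cast; ring⟩ (hshift _ _ h3) (hshift _ _ h4)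
    apply hne
    rw [Int.fract, Int.fract] at h5
    linarith
  · by_contra hne
    have h3 : Int.fract s ∈ C := by
      refine Or.inr ⟨⟨(Int.fract s, Int.fract t), ⟨⟨Int.fract_nonneg _, (Int.fract_lt_one _).le⟩,
        ⟨Int.fract_nonneg _, (Int.fract_lt_one _).le⟩, ?_, ?_, ?_⟩, rfl⟩,
        ⟨Int.fract_nonneg _, Int.fract_lt_one _⟩⟩
      · dsimp only
        rw [← (SameCirclePoint.fract s).periodic_eq h.px,
          ← (SameCirclePoint.fract t).periodic_eq h.px, hx]
      · dsimp only
        rw [← (SameCirclePoint.fract s).periodic_eq h.pz,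
          ← (SameCirclePoint.fract t).periodic_eq h.pz, hz]
      · exact fun h4 => hne (((SameCirclePoint.fract s).trans h4).trans
          (SameCirclePoint.fract t).symm)
    obtain ⟨h5, -⟩ := hsep _ (hmemC c hc) _ h3 (s - ⌊c⌋) (Int.fract s)
      ⟨⌊c⌋ - ⌊s⌋, by rw [Int.fract]; push_cast; ring⟩ (hshift _ _ hs) (by simpa using hρ)
    -- A crossing parameter inside the window would have to be the cusp parameter itself modulo 1,
    -- but no other strand passes through a cusp.
    refine hne (h.cusp_simple s t (hc.of_sameCirclePoint h.px ?_) hx hz)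
    exact ((SameCirclePoint.fract c).trans (SameCirclePoint.of_eq h5)).trans
      (SameCirclePoint.fract s).symm
  · have hcf : Int.fract c ∈ h.finite_extr.toFinset := by
      simp only [Finite.mem_toFinset]
      exact ⟨⟨Int.fract_nonneg _, Int.fract_lt_one _⟩,
        hc'.of_sameCirclePoint h.px (SameCirclePoint.fract c)⟩
    have h3 := h1 _ hcf
    have e : ∀ s : ℝ, |s - c| < ε → |s - ⌊c⌋ - Int.fract c| < η (Int.fract c) := fun s hs => by
      rw [Int.fract] at h3 ⊢; rw [show s - ⌊c⌋ - (c - ⌊c⌋) = s - c by ring]; linarith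
    have hS : ∀ s : ℝ, SameCirclePoint (s - ⌊c⌋) s := fun s => ⟨⌊c⌋, by ring⟩
    have h4 := (hηw (Int.fract c) _ _ (e s hs) (e t ht)
      (by rw [(hS s).periodic_eq h.px, (hS t).periodic_eq h.px, hx])
      (fun heq => by rw [sub_left_inj.1 heq] at hz; exact lt_irrefl _ hz)).2
      (fun hm => hc ((isLocalExtr_of_sameCirclePoint h.px (SameCirclePoint.fract c).symm).1 hm))
    rw [(hS s).periodic_eq h.pz, (hS t).periodic_eq h.pz, (hS s).periodic_eq h.py,
      (hS t).periodic_eq h.py] at h4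
    exact h4 hz

/-- The two branches at a right cusp. -/
theorem exists_right_cusp_strands (h : FrontCurve x y z) {c ε : ℝ} (hc : IsLocalMax x c)
    (hε : IsWindowRadius x z ε) :
    ∃ p < x c, ∃ A B, IsStrand x A (Ioo p (x c)) ∧ IsStrand x B (Ioo p (x c)) ∧
      (∀ u ∈ Ioo p (x c), |A u - c| < ε ∧ |B u - c| < ε ∧ z (B u) < z (A u)) ∧
      ∀ s t, |s - c| < ε → |t - c| < ε → x s = x t → z t < z s →
        x s ∈ Ioo p (x c) ∧ A (x s) = s ∧ B (x s) = t := by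
  have hce : IsLocalExtr x c := Or.inr hc
  have hxc := h.hx.continuous
  have hno : ∀ θ, |θ - c| < 2 * ε → θ ≠ c → ¬ IsLocalExtr x θ := fun θ hθ hne he => by
    linarith [hε.separated θ c he hce hne]
  have hpos := hε.pos
  have hL : StrictMonoOn x (Icc (c - ε) c) := strictMonoOn_left_of_isLocalMax hxc (by linarith)
    (fun θ hθ => hno θ (by rw [abs_lt]; constructor <;> linarith [hθ.1, hθ.2]) hθ.2.ne) hc
  have hR : StrictAntiOn x (Icc c (c + ε)) := strictAntiOn_right_of_isLocalMax hxc (by linarith)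
    (fun θ hθ => hno θ (by rw [abs_lt]; constructor <;> linarith [hθ.1, hθ.2]) hθ.1.ne') hc
  have hcL : c ∈ Icc (c - ε) c := ⟨by linarith, le_rfl⟩
  have hcR : c ∈ Icc c (c + ε) := ⟨le_rfl, by linarith⟩
  have hl : c - ε ∈ Icc (c - ε) c := ⟨le_rfl, by linarith⟩
  have hr : c + ε ∈ Icc c (c + ε) := ⟨by linarith, le_rfl⟩
  obtain ⟨a, ha, hamem, hainv⟩ := exists_strand hxc hL.injOn
  obtain ⟨b, hb, hbmem, hbinv⟩ := exists_strand hxc hR.injOn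
  set p := Max.max (x (c - ε)) (x (c + ε)) with hp
  have hpl : x (c - ε) ≤ p := le_max_left _ _
  have hpr : x (c + ε) ≤ p := le_max_right _ _
  have hpc : p < x c := max_lt (hL hl hcL (by linarith)) (hR hcR hr (by linarith))
  have hIa : Ioo p (x c) ⊆ x '' Icc (c - ε) c := fun u hu =>
    intermediate_value_Icc (by linarith) hxc.continuousOn ⟨by linarith [hu.1], hu.2.le⟩
  have hIb : Ioo p (x c) ⊆ x '' Icc c (c + ε) := fun u hu =>
    intermediate_value_Icc' (by linarith) hxc.continuousOn ⟨by linarith [hu.1], hu.2.le⟩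
  have ha' := ha.mono hIa
  have hb' := hb.mono hIb
  have habs : ∀ u ∈ Ioo p (x c), (c - ε < a u ∧ a u < c) ∧ c < b u ∧ b u < c + ε := by
    intro u hu
    have h1 := hamem u (hIa hu)
    have h2 := hbmem u (hIb hu)
    have h3 := ha'.section_eq u hu
    have h4 := hb'.section_eq u hu
    refine ⟨⟨lt_of_le_of_ne h1.1 fun e => ?_, lt_of_le_of_ne h1.2 fun e => ?_⟩,
      lt_of_le_of_ne h2.1 fun e => ?_, lt_of_le_of_ne h2.2 fun e => ?_⟩
    · rw [← e] at h3; linarith [hu.1]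
    · rw [e] at h3; linarith [hu.2]
    · rw [← e] at h4; linarith [hu.2]
    · rw [e] at h4; linarith [hu.1]
  have hone := h.two_mul_le_one hε hce
  have hne : ∀ u ∈ Ioo p (x c), z (a u) ≠ z (b u) := by
    intro u hu hz
    obtain ⟨⟨h1, h2⟩, h3, h4⟩ := habs u hu
    have h5 := hε.crossing_free c (a u) (b u) hce (by rw [abs_lt]; constructor <;> linarith)
      (by rw [ha'.section_eq u hu, hb'.section_eq u hu]) hz
    have := h5.eq_of_abs_lt (by rw [abs_lt]; constructor <;> linarith)
    linarith
  have hcls : ∀ s t, |s - c| < ε → |t - c| < ε → x s = x t → s ≠ t → x s ∈ Ioo p (x c) ∧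
      ((a (x s) = s ∧ b (x s) = t) ∨ (b (x s) = s ∧ a (x s) = t)) := by
    have key : ∀ s t, |s - c| < ε → |t - c| < ε → x s = x t → s ≠ t → s ≤ c →
        x s ∈ Ioo p (x c) ∧ a (x s) = s ∧ b (x s) = t := by
      intro s t hs ht hx hst hsc
      rw [abs_lt] at hs ht
      have hsI : s ∈ Icc (c - ε) c := ⟨by linarith, hsc⟩
      have htc : c < t := by
        by_contra htc
        exact hst (hL.injOn hsI ⟨by linarith, not_lt.1 htc⟩ hx)
      have htI : t ∈ Icc c (c + ε) := ⟨htc.le, by linarith⟩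
      refine ⟨⟨max_lt (hL hl hsI (by linarith)) (hx ▸ hR htI hr (by linarith)),
        hx ▸ hR hcR htI htc⟩, hainv s hsI, by rw [hx]; exact hbinv t htI⟩
    intro s t hs ht hx hst
    rcases le_total s c with hsc | hsc
    · exact ⟨(key s t hs ht hx hst hsc).1, Or.inl (key s t hs ht hx hst hsc).2⟩
    · have htc : t ≤ c := by
        by_contra htc
        rw [abs_lt] at hs ht
        exact hst (hR.injOn ⟨hsc, by linarith⟩ ⟨(not_le.1 htc).le, by linarith⟩ hx)
      have := key t s ht hs hx.symm hst.symm htc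
      rw [← hx] at this
      exact ⟨this.1, Or.inr this.2.symm⟩
  have hza : ContinuousOn (fun u => z (a u)) (Ioo p (x c)) :=
    h.hz.continuous.comp_continuousOn ha'.continuousOn
  have hzb : ContinuousOn (fun u => z (b u)) (Ioo p (x c)) :=
    h.hz.continuous.comp_continuousOn hb'.continuousOn
  have hwin : ∀ u ∈ Ioo p (x c), |a u - c| < ε ∧ |b u - c| < ε := fun u hu => by
    obtain ⟨⟨h1, h2⟩, h3, h4⟩ := habs u hu
    constructor <;> rw [abs_lt] <;> constructor <;> linarith
  -- The branches do not meet inside the window, so the height difference keeps its sign on the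
  -- connected interval. This works for windows of any admissible size, not only very small ones.
  have hsign : (∀ u ∈ Ioo p (x c), z (b u) < z (a u)) ∨ ∀ u ∈ Ioo p (x c), z (a u) < z (b u) := by
    by_contra hcon
    push Not at hcon
    obtain ⟨⟨u, hu, h1⟩, w, hw, h2⟩ := hcon
    obtain ⟨v, hv, hv'⟩ := isPreconnected_Ioo.intermediate_value₂ hu hw hza hzb h1 h2
    exact hne v hv hv'
  rcases hsign with hsg | hsg
  · refine ⟨p, hpc, a, b, ha', hb', fun u hu => ⟨(hwin u hu).1, (hwin u hu).2, hsg u hu⟩,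
      fun s t hs ht hx hz => ?_⟩
    obtain ⟨h1, h2 | h2⟩ := hcls s t hs ht hx (fun e => by rw [e] at hz; exact lt_irrefl _ hz)
    · exact ⟨h1, h2⟩
    · have := hsg _ h1
      rw [h2.1, h2.2] at this
      exact absurd this hz.asymm
  · refine ⟨p, hpc, b, a, hb', ha', fun u hu => ⟨(hwin u hu).2, (hwin u hu).1, hsg u hu⟩,
      fun s t hs ht hx hz => ?_⟩
    obtain ⟨h1, h2 | h2⟩ := hcls s t hs ht hx (fun e => by rw [e] at hz; exact lt_irrefl _ hz)
    · have := hsg _ h1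
      rw [h2.1, h2.2] at this
      exact absurd this hz.asymm
    · exact ⟨h1, h2⟩

end FrontCurve

namespace IsFeatureSystem

variable {x y z : ℝ → ℝ} {S : Finset (ℝ × ℝ)} {A B : ℝ × ℝ → ℝ → ℝ} {q : ℝ × ℝ → ℝ} {d ρ M : ℝ}

theorem mem_of_isLocalMax (hS : IsFeatureSystem x y z S A B q d ρ M) (h : FrontCurve x y z) {c : ℝ}
    (hc : IsLocalMax x c) : (Int.fract c, Int.fract c) ∈ S :=
  (hS.mem_iff _).2 ⟨⟨Int.fract_nonneg _, Int.fract_lt_one _⟩,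
    ⟨Int.fract_nonneg _, Int.fract_lt_one _⟩, rfl, rfl,
    Or.inl ⟨rfl, (isLocalExtr_of_sameCirclePoint h.px (SameCirclePoint.fract c)).1 hc⟩⟩

/-- The branches at a right cusp are the strands of its feature. -/
theorem onStrands_of_window (hS : IsFeatureSystem x y z S A B q d ρ M) (h : FrontCurve x y z)
    {ε c : ℝ} (hε : IsWindowRadius x z ε) (hρ : ρ ≤ ε) (hc : IsLocalMax x c) {s t : ℝ}
    (hs : |s - c| < ε) (ht : |t - c| < ε) (hx : x s = x t) (hz : z t < z s)
    (hd : x c - d ≤ x s) :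
    x s < x c ∧ OnStrands x (A (Int.fract c, Int.fract c)) (B (Int.fract c, Int.fract c))
      (Ico (x (Int.fract c) - d) (q (Int.fract c, Int.fract c))) s t := by
  obtain ⟨p, -, a, b, ha, hb, hab, huniq⟩ := h.exists_right_cusp_strands hc hε
  have hi := hS.mem_of_isLocalMax h hc
  set i := (Int.fract c, Int.fract c) with hidef
  have hxi : x (Int.fract c) = x c := ((SameCirclePoint.fract c).periodic_eq h.px).symm
  have hqi : q i = x c := (hS.cusp i hi rfl).trans hxi
  obtain ⟨h1, h2, h3⟩ := huniq s t hs ht hx hz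
  have hI : x s ∈ Ico (x i.1 - d) (q i) := by
    rw [hqi]; exact ⟨by simp only [hidef, hxi]; exact hd, h1.2⟩
  have hf := hS.feature i hi
  have hA := hf.strandA.section_eq _ hI
  have hB := hf.strandB.section_eq _ hI
  have hSP : ∀ θ : ℝ, SameCirclePoint θ (θ + ⌊c⌋) := fun θ => ⟨⌊c⌋, rfl⟩
  have hw : ∀ θ : ℝ, |θ - Int.fract c| < ρ → |θ + ⌊c⌋ - c| < ε := fun θ hθ => by
    rw [Int.fract] at hθ
    rw [show θ + ⌊c⌋ - c = θ - (c - ⌊c⌋) by ring]; linarith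
  -- The feature belongs to the representative of c in [0, 1). Translated by ⌊c⌋ its strands lie in
  -- the window, and uniqueness of the pair over one abscissa identifies them with s and t.
  have h4 := huniq (A i (x s) + ⌊c⌋) (B i (x s) + ⌊c⌋) (hw _ (hS.near i hi _ hI).1)
    (hw _ (hS.near i hi _ hI).2)
    (by rw [← (hSP _).periodic_eq h.px, ← (hSP _).periodic_eq h.px, hA, hB])
    (by rw [← (hSP _).periodic_eq h.pz, ← (hSP _).periodic_eq h.pz]
        exact (hf.crosses _ hI).1 (by simp only [hidef, hxi]; exact h1.2))
  rw [← (hSP _).periodic_eq h.px, hA, h2, h3] at h4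
  exact ⟨h1.2, hI, hx, ⟨⌊c⌋, h4.2.1⟩, ⟨⌊c⌋, h4.2.2⟩⟩

end IsFeatureSystem

namespace FrontCurve

variable {x y z : ℝ → ℝ}

/-- A point of a half window and a point outside all translates of the window have different heights
over a common abscissa; compactness makes the gap uniform. A change of height by less than half the
gap then moves no strand of the half window across an outer one. -/
theorem exists_height_gap (h : FrontCurve x y z) {ε : ℝ} (hε : IsWindowRadius x z ε) :
    ∃ κ > 0, ∀ c, IsLocalExtr x c → ∀ s t, |s - c| ≤ ε / 2 → x s = x t →
      (∀ n : ℤ, ε ≤ |t - (c + n)|) → κ ≤ |z s - z t| := by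
  have hpos := hε.pos
  have key : ∀ c, IsLocalExtr x c → ∃ κ > 0, ∀ s t, |s - c| ≤ ε / 2 → x s = x t →
      (∀ n : ℤ, ε ≤ |t - (c + n)|) → κ ≤ |z s - z t| := by
    intro c hc
    set K : Set (ℝ × ℝ) := (Icc (c - ε / 2) (c + ε / 2) ×ˢ Icc 0 1) ∩
      {p | x p.1 = x p.2 ∧ ∀ n : ℤ, ε ≤ |p.2 - (c + n)|} with hK
    have hKc : IsCompact K := by
      refine (isCompact_Icc.prod isCompact_Icc).inter_right ?_
      have h1 : IsClosed {p : ℝ × ℝ | ∀ n : ℤ, ε ≤ |p.2 - (c + n)|} := by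
        simp only [ofPred_forall]
        exact isClosed_iInter fun n => isClosed_le continuous_const (by fun_prop)
      exact (isClosed_eq (h.hx.continuous.comp continuous_fst)
        (h.hx.continuous.comp continuous_snd)).inter h1
    have hc1 : Continuous fun p : ℝ × ℝ => |z p.1 - z p.2| :=
      ((h.hz.continuous.comp continuous_fst).sub (h.hz.continuous.comp continuous_snd)).abs
    have hred : ∀ s t, |s - c| ≤ ε / 2 → x s = x t → (∀ n : ℤ, ε ≤ |t - (c + n)|) →
        (s, Int.fract t) ∈ K := by
      intro s t hs hx ht
      rw [abs_le] at hs
      refine ⟨⟨⟨by linarith, by linarith⟩, Int.fract_nonneg _, (Int.fract_lt_one _).le⟩, ?_,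
        fun n => ?_⟩
      · dsimp only; rw [← (SameCirclePoint.fract t).periodic_eq h.px, hx]
      · have := ht (n + ⌊t⌋)
        dsimp only
        rw [Int.fract]
        push_cast at this
        rwa [show t - ⌊t⌋ - (c + n) = t - (c + (n + ⌊t⌋)) by ring]
    rcases K.eq_empty_or_nonempty with h0 | h0
    · exact ⟨1, one_pos, fun s t hs hx ht => absurd (hred s t hs hx ht) (h0 ▸ notMem_empty _)⟩
    · obtain ⟨p, hp, hmin⟩ := hKc.exists_isMinOn h0 hc1.continuousOn
      refine ⟨|z p.1 - z p.2|, ?_, fun s t hs hx ht => ?_⟩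
      · refine abs_pos.2 (sub_ne_zero.2 fun hz => ?_)
        obtain ⟨⟨hp1, -⟩, hp2, hp3⟩ := hp
        have hpc : |p.1 - c| ≤ ε / 2 := by
          rw [abs_le]; constructor <;> linarith [hp1.1, hp1.2]
        obtain ⟨n, hn⟩ := hε.crossing_free c p.1 p.2 hc (by linarith) hp2 hz
        have := hp3 n
        rw [hn, show p.1 + n - (c + n) = p.1 - c by ring] at this
        linarith
      · have := hmin (hred s t hs hx ht)
        simp only [mem_ofPred_eq] at this
        rwa [← (SameCirclePoint.fract t).periodic_eq h.pz] at this
  choose! κ hκ hκ' using key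
  have h1 : ∀ᶠ k in 𝓝[>] (0 : ℝ), ∀ c ∈ h.finite_extr.toFinset, k < κ c := by
    rw [eventually_all_finset]
    intro c hc
    exact nhdsWithin_le_nhds (eventually_lt_nhds (hκ c (by simpa using ((Finite.mem_toFinset _).1 hc).2)))
  obtain ⟨k, h1, hk⟩ := (h1.and self_mem_nhdsWithin).exists
  refine ⟨k, hk, fun c hc s t hs hx ht => ?_⟩
  have hcf := hc.of_sameCirclePoint h.px (SameCirclePoint.fract c)
  have hsp : SameCirclePoint (s - ⌊c⌋) s := ⟨⌊c⌋, by ring⟩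
  have h2 := hκ' (Int.fract c) hcf (s - ⌊c⌋) t
    (by rw [Int.fract, show s - ⌊c⌋ - (c - ⌊c⌋) = s - c by ring]; exact hs)
    (by rw [hsp.periodic_eq h.px, hx])
    (fun n => by
      have := ht (n - ⌊c⌋)
      rw [Int.fract, show t - (c - ⌊c⌋ + n) = t - (c + (n - ⌊c⌋ : ℤ)) by push_cast; ring]
      exact this)
  rw [hsp.periodic_eq h.pz] at h2
  exact (h1 _ ((Finite.mem_toFinset _).2 ⟨⟨Int.fract_nonneg _, Int.fract_lt_one _⟩, hcf⟩)).le.trans h2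

/-- Since x is injective on each side of the cusp, it stays away from x c on the outer half of the
window. A cutoff in x − x c therefore vanishes before the window ends. -/
theorem exists_abscissa_gap (h : FrontCurve x y z) {ε : ℝ} (hε : IsWindowRadius x z ε) :
    ∃ κ > 0, ∀ c, IsLocalExtr x c → ∀ θ, ε / 2 ≤ |θ - c| → |θ - c| ≤ ε → κ ≤ |x θ - x c| := by
  have hpos := hε.pos
  have key : ∀ c, IsLocalExtr x c → ∃ κ > 0, ∀ θ, ε / 2 ≤ |θ - c| → |θ - c| ≤ ε →
      κ ≤ |x θ - x c| := by
    intro c hc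
    have hno : ∀ θ, |θ - c| < 2 * ε → θ ≠ c → ¬ IsLocalExtr x θ := fun θ hθ hne he => by
      linarith [hε.separated θ c he hc hne]
    have hL : InjOn x (Icc (c - ε) c) := injOn_Icc_of_no_extr h.hx.continuous fun θ hθ =>
      hno θ (by rw [abs_lt]; constructor <;> linarith [hθ.1, hθ.2]) hθ.2.ne
    have hR : InjOn x (Icc c (c + ε)) := injOn_Icc_of_no_extr h.hx.continuous fun θ hθ =>
      hno θ (by rw [abs_lt]; constructor <;> linarith [hθ.1, hθ.2]) hθ.1.ne'
    set K : Set ℝ := Icc (c - ε) (c + ε) ∩ {θ | ε / 2 ≤ |θ - c|} with hK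
    have hKc : IsCompact K :=
      isCompact_Icc.inter_right (isClosed_le continuous_const (by fun_prop))
    have hKn : K.Nonempty := ⟨c + ε, ⟨by linarith, le_rfl⟩, by
      simp only [mem_ofPred_eq, add_sub_cancel_left, abs_of_pos hpos]; linarith⟩
    obtain ⟨θ₀, hθ₀, hmin⟩ := hKc.exists_isMinOn hKn
      (f := fun θ => |x θ - x c|) (h.hx.continuous.sub continuous_const).abs.continuousOn
    refine ⟨|x θ₀ - x c|, abs_pos.2 (sub_ne_zero.2 fun he => ?_), fun θ h1 h2 => ?_⟩
    · have hne : θ₀ ≠ c := fun e => by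
        have := hθ₀.2
        simp only [mem_ofPred_eq, e, sub_self, abs_zero] at this
        linarith
      rcases le_total θ₀ c with h1 | h1
      · exact hne (hL ⟨hθ₀.1.1, h1⟩ ⟨by linarith, le_rfl⟩ he)
      · exact hne (hR ⟨h1, hθ₀.1.2⟩ ⟨le_rfl, by linarith⟩ he)
    · have h3 := abs_le.1 h2
      exact hmin ⟨⟨by linarith, by linarith⟩, h1⟩
  choose! κ hκ hκ' using key
  have h1 : ∀ᶠ k in 𝓝[>] (0 : ℝ), ∀ c ∈ h.finite_extr.toFinset, k < κ c := by
    rw [eventually_all_finset]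
    intro c hc
    exact nhdsWithin_le_nhds (eventually_lt_nhds (hκ c (by simpa using ((Finite.mem_toFinset _).1 hc).2)))
  obtain ⟨k, h1, hk⟩ := (h1.and self_mem_nhdsWithin).exists
  refine ⟨k, hk, fun c hc θ h2 h3 => ?_⟩
  have hcf := hc.of_sameCirclePoint h.px (SameCirclePoint.fract c)
  have hsp : SameCirclePoint (θ - ⌊c⌋) θ := ⟨⌊c⌋, by ring⟩
  have e : θ - ⌊c⌋ - Int.fract c = θ - c := by rw [Int.fract]; ring
  have h4 := hκ' (Int.fract c) hcf (θ - ⌊c⌋) (by rwa [e]) (by rwa [e])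
  rw [hsp.periodic_eq h.px, ← (SameCirclePoint.fract c).periodic_eq h.px] at h4
  exact (h1 _ ((Finite.mem_toFinset _).2 ⟨⟨Int.fract_nonneg _, Int.fract_lt_one _⟩, hcf⟩)).le.trans h4

end FrontCurve

/-! ### Existence of resolutions -/

/-- A function that is given by `g c` on the window around the cusp `c` and vanishes elsewhere. -/
theorem IsWindowRadius.exists_glue {x z : ℝ → ℝ} {ε : ℝ} (hε : IsWindowRadius x z ε)
    (g : ℝ → ℝ → ℝ) :
    ∃ β : ℝ → ℝ, (∀ c θ, IsLocalExtr x c → |θ - c| < ε → β θ = g c θ) ∧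
      ∀ θ, (∀ c, IsLocalExtr x c → ε ≤ |θ - c|) → β θ = 0 := by
  classical
  refine ⟨fun θ => if h : ∃ c, IsLocalExtr x c ∧ |θ - c| < ε then g h.choose θ else 0,
    fun c θ hc hθ => ?_, fun θ hθ => ?_⟩
  · have h : ∃ c, IsLocalExtr x c ∧ |θ - c| < ε := ⟨c, hc, hθ⟩
    simp only [dif_pos h]
    rw [hε.eq_of_common h.choose_spec.1 hc h.choose_spec.2 hθ]
  · have h : ¬ ∃ c, IsLocalExtr x c ∧ |θ - c| < ε := by
      rintro ⟨c, hc, h1⟩; linarith [hθ c hc]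
    simp only [dif_neg h]

/-- The two descriptions overlap on the outer halves of the windows, so around each point β agrees
with one smooth function. -/
theorem contDiff_of_windows {x z β : ℝ → ℝ} {g : ℝ → ℝ → ℝ} {ε : ℝ} (hε : IsWindowRadius x z ε)
    {n : WithTop ℕ∞} (hg : ∀ c, ContDiff ℝ n (g c))
    (h1 : ∀ c θ, IsLocalExtr x c → |θ - c| < ε → β θ = g c θ)
    (h0 : ∀ θ, (∀ c, IsLocalExtr x c → ε / 2 ≤ |θ - c|) → β θ = 0) : ContDiff ℝ n β := by
  rw [contDiff_iff_contDiffAt]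
  intro θ₀
  by_cases hw : ∃ c, IsLocalExtr x c ∧ |θ₀ - c| < ε
  · obtain ⟨c, hc, hθ⟩ := hw
    refine (hg c).contDiffAt.congr_of_eventuallyEq ?_
    have : ∀ᶠ θ in 𝓝 θ₀, |θ - c| < ε :=
      (by fun_prop : Continuous fun θ => |θ - c|).continuousAt.eventually (eventually_lt_nhds hθ)
    filter_upwards [this] with θ hθ using h1 c θ hc hθ
  · push Not at hw
    refine (contDiffAt_const (c := (0 : ℝ))).congr_of_eventuallyEq ?_
    have : ∀ᶠ θ in 𝓝 θ₀, |θ - θ₀| < ε / 2 :=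
      (by fun_prop : Continuous fun θ => |θ - θ₀|).continuousAt.eventually
        (eventually_lt_nhds (by simpa using hε.pos))
    filter_upwards [this] with θ hθ
    refine h0 θ fun c hc => ?_
    have h2 := hw c hc
    have h3 : |θ₀ - c| ≤ |θ - c| + |θ - θ₀| := by
      have := abs_sub (θ - c) (θ - θ₀); simpa using this
    linarith

/-- Take w = z + β with β = b(x − x c)(y − y c)/F(x) in the window of c. Where the cutoff b is 1,
F·w = W − y c, so w orders each vertical line as W does within the window. The exchange at right
cusps, its transversality and the vertical tangent are thus inherited from the shear. -/
theorem exists_isCuspResolution {r : ℕ∞} (hr : 1 ≤ r) {φ : ℝ → ℝ × ℝ × ℝ}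
    (hφ : IsLegendrianKnot r φ) (hg : HasGenericFront φ) : ∃ w, IsCuspResolution r φ w := by
  have h := hφ.frontCurve hr hg
  have hxr : ContDiff ℝ r (xCoord φ) := hφ.contDiff.fst
  have hyr : ContDiff ℝ r (yCoord φ) := hφ.contDiff.snd.fst
  have hzr : ContDiff ℝ r (zCoord φ) := hφ.contDiff.snd.snd
  set x := xCoord φ with hxdef
  set y := yCoord φ
  set z := zCoord φ with hzdef
  obtain ⟨ε, hε, hdiag⟩ := h.exists_windowRadius
  obtain ⟨S, A, B, q, d, ρ, M, hρ, hS⟩ := h.exists_featureSystem hε.pos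
  obtain ⟨κ, hκ, hgap⟩ := h.exists_height_gap hε
  obtain ⟨δ', hδ', hxgap⟩ := h.exists_abscissa_gap hε
  obtain ⟨Cy, hCy, hyb⟩ := exists_bound_of_periodic h.hy.continuous h.py
  set δ := min δ' d with hδdef
  have hδ : 0 < δ := lt_min hδ' hS.d_pos
  -- The second entry makes |β| at most 2·Cy/F < κ/2, half the height gap to strands outside the
  -- window.
  set N := max M (4 * Cy / κ + 1) with hNdef
  obtain ⟨F, v, hFs, hFN, hv⟩ := h.exists_shear hS (le_max_left M (4 * Cy / κ + 1))
    (half_pos hδ)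
  have hN0 : 0 < N := hS.M_pos.trans_le (le_max_left _ _)
  have hF0 : ∀ u, 0 < F u := fun u => hN0.trans_le (hFN u)
  let b : ContDiffBump (0 : ℝ) := ⟨δ / 2, δ, half_pos hδ, by linarith⟩
  have hb1 : ∀ u, |u| ≤ δ / 2 → b u = 1 := fun u hu => b.one_of_mem_closedBall
    (by simpa [Metric.mem_closedBall, Real.dist_eq] using hu)
  have hb0 : ∀ u, δ ≤ |u| → b u = 0 := fun u hu => b.zero_of_le_dist
    (by simpa [Real.dist_eq] using hu)
  obtain ⟨β, hβ1, hβ0⟩ := hε.exists_glue fun c θ => b (x θ - x c) * (y θ - y c) / F (x θ)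
  have hβ2 : ∀ c θ, IsLocalExtr x c → ε / 2 ≤ |θ - c| → |θ - c| < ε → β θ = 0 := by
    intro c θ hc h1 h2
    rw [hβ1 c θ hc h2, hb0 _ ((min_le_left _ _).trans (hxgap c hc θ h1 h2.le)), zero_mul, zero_div]
  have hβ3 : ∀ θ, (∀ c, IsLocalExtr x c → ε / 2 ≤ |θ - c|) → β θ = 0 := by
    intro θ hθ
    by_cases hw : ∃ c, IsLocalExtr x c ∧ |θ - c| < ε
    · obtain ⟨c, hc, h1⟩ := hw
      exact hβ2 c θ hc (hθ c hc) h1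
    · push Not at hw
      exact hβ0 θ hw
  have hβs : ContDiff ℝ r β := contDiff_of_windows hε (fun c =>
    ((b.contDiff.comp (hxr.sub contDiff_const)).mul (hyr.sub contDiff_const)).div
      ((hFs r).comp hxr) fun θ => (hF0 _).ne') hβ1 hβ3
  have hβp : Function.Periodic β 1 := by
    intro θ
    have hs : ∀ c, SameCirclePoint c (c + 1) := fun c => ⟨1, by simp⟩
    by_cases hw : ∃ c, IsLocalExtr x c ∧ |θ - c| < ε
    · obtain ⟨c, hc, h1⟩ := hw
      rw [hβ1 c θ hc h1, hβ1 (c + 1) (θ + 1) (hc.of_sameCirclePoint h.px (hs c))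
        (by simpa using h1)]
      simp only [h.px θ, h.py θ, h.px c, h.py c]
    · push Not at hw
      rw [hβ0 θ hw, hβ0 (θ + 1) fun c hc => ?_]
      have := hw (c - 1) (hc.of_sameCirclePoint h.px ⟨-1, by push_cast; ring⟩)
      rwa [show θ + 1 - c = θ - (c - 1) by ring]
  have hβb : ∀ θ, |β θ| < κ / 2 := by
    intro θ
    by_cases hw : ∃ c, IsLocalExtr x c ∧ |θ - c| < ε
    · obtain ⟨c, hc, h1⟩ := hw
      rw [hβ1 c θ hc h1, abs_div, abs_mul, abs_of_nonneg b.nonneg, abs_of_pos (hF0 _),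
        div_lt_iff₀ (hF0 _)]
      have h2 : |y θ - y c| ≤ 2 * Cy := by
        have := abs_sub (y θ) (y c); linarith [hyb θ, hyb c]
      have h3 : b (x θ - x c) * |y θ - y c| ≤ 1 * (2 * Cy) :=
        mul_le_mul b.le_one h2 (abs_nonneg _) zero_le_one
      have h4 : 4 * Cy / κ + 1 ≤ F (x θ) := (le_max_right _ _).trans (hFN _)
      have h5 : κ / 2 * (4 * Cy / κ + 1) ≤ κ / 2 * F (x θ) :=
        mul_le_mul_of_nonneg_left h4 (by linarith)
      have h6 : κ / 2 * (4 * Cy / κ + 1) = 2 * Cy + κ / 2 := by field_simp; ring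
      linarith
    · push Not at hw
      rw [hβ0 θ hw, abs_zero]; linarith
  have hWd := fun θ => (h.deriv_shear ((hFs 1).differentiable one_ne_zero) θ).differentiableAt
  have hws : ContDiff ℝ r fun θ => z θ + β θ := hzr.add hβs
  have hwd : Differentiable ℝ fun θ => z θ + β θ :=
    (hws.of_le (by exact_mod_cast hr)).differentiable one_ne_zero
  -- near the cusp the new height is an affine function of the sheared one on each fibre
  have hnear : ∀ c θ, IsLocalExtr x c → |θ - c| < ε → |x θ - x c| < δ / 2 →
      deriv (fun θ => F (x θ) * z θ + y θ) θ =
        F (x θ) * deriv (fun θ => z θ + β θ) θ + deriv F (x θ) * deriv x θ * (z θ + β θ) := by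
    intro c θ hc h1 h2
    have hev : (fun θ => F (x θ) * z θ + y θ) =ᶠ[𝓝 θ]
        fun θ => F (x θ) * (z θ + β θ) + y c := by
      have e1 : ∀ᶠ θ in 𝓝 θ, |θ - c| < ε :=
        (by fun_prop : Continuous fun θ => |θ - c|).continuousAt.eventually (eventually_lt_nhds h1)
      have e2 : ∀ᶠ θ in 𝓝 θ, |x θ - x c| < δ / 2 :=
        (h.hx.continuous.sub continuous_const).abs.continuousAt.eventually (eventually_lt_nhds h2)
      filter_upwards [e1, e2] with θ e1 e2
      rw [hβ1 c θ hc e1, hb1 _ e2.le]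
      have := (hF0 (x θ)).ne'
      field_simp; ring
    have hd1 := ((((hFs 1).differentiable one_ne_zero (x θ)).hasDerivAt).comp θ
      (h.hx.differentiable one_ne_zero θ).hasDerivAt)
    rw [hev.deriv_eq]
    refine ((hd1.mul (hwd θ).hasDerivAt).add_const (y c)).deriv.trans ?_
    simp only [Function.comp_apply]
    ring
  refine ⟨fun θ => z θ + β θ, hws, fun θ => by simp only [h.pz θ, hβp θ], fun c hc => ?_,
    ε, hε.pos, hε.separated, fun c s t hc hs hst => hε.crossing_free c s t hc hs
      (Prod.ext_iff.1 hst).1 (Prod.ext_iff.1 hst).2, fun θ hθ => ?_, fun s t hx hnw hz => ?_,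
      fun c hc => ?_⟩
  · have hc : IsLocalExtr x c := hc
    -- At the cusp x' = 0, so F·w' equals y', which is nonzero.
    have h1 := hnear c c hc (by simpa using hε.pos) (by simpa using half_pos hδ)
    rw [(h.deriv_shear ((hFs 1).differentiable one_ne_zero) c).deriv, hc.deriv_eq_zero] at h1
    intro h2
    rw [h2] at h1
    simp only [mul_zero, zero_mul, zero_add] at h1
    exact h.imm c hc.deriv_eq_zero h1
  · rw [hβ0 θ hθ, add_zero]
  · have hs := abs_lt.1 (hβb s)
    have ht := abs_lt.1 (hβb t)
    have hfar : κ ≤ |z s - z t| → z s + β s < z t + β t := by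
      intro h1
      rw [abs_of_neg (by linarith)] at h1
      linarith
    have hsame : ∀ c (n : ℤ), IsLocalExtr x c → |s - c| < ε → |t - (c + n)| < ε →
        z s + β s < z t + β t := by
      intro c n hc h1 h2
      have hcn : SameCirclePoint c (c + n) := ⟨n, rfl⟩
      have hnm : ¬ IsLocalMax x c := fun hm => hnw ⟨c, n, hm, h1, h2⟩
      have htn : SameCirclePoint (t - n) t := ⟨n, by ring⟩
      have h3 := hdiag c hnm hc s (t - n) h1 (by rwa [sub_sub, add_comm (n : ℝ)])
        (by rw [htn.periodic_eq h.px]; exact hx) (by rw [htn.periodic_eq h.pz]; exact hz)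
      rw [htn.periodic_eq h.py] at h3
      rw [hβ1 c s hc h1, hβ1 (c + n) t (hc.of_sameCirclePoint h.px hcn) h2,
        ← hcn.periodic_eq h.px, ← hcn.periodic_eq h.py, show x s = x t from hx]
      -- On one vertical line the correction increases with y, and away from right cusps the order
      -- of y is that of z; so the correction keeps the order.
      have : b (x t - x c) * (y s - y c) / F (x t) ≤ b (x t - x c) * (y t - y c) / F (x t) :=
        div_le_div_of_nonneg_right (mul_le_mul_of_nonneg_left (by linarith) b.nonneg) (hF0 _).le
      linarith
    by_cases h1 : ∃ c, IsLocalExtr x c ∧ |s - c| < ε / 2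
    · obtain ⟨c, hc, h1⟩ := h1
      by_cases h2 : ∃ n : ℤ, |t - (c + n)| < ε
      · obtain ⟨n, h2⟩ := h2
        exact hsame c n hc (by linarith [hε.pos]) h2
      · push Not at h2
        exact hfar (hgap c hc s t h1.le hx h2)
    · by_cases h3 : ∃ c, IsLocalExtr x c ∧ |t - c| < ε / 2
      · obtain ⟨c, hc, h3⟩ := h3
        by_cases h2 : ∃ n : ℤ, |s - (c + n)| < ε
        · obtain ⟨n, h2⟩ := h2
          exact hsame (c + n) (-n) (hc.of_sameCirclePoint h.px ⟨n, rfl⟩) h2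
            (by push_cast; rw [show t - (c + n + -n) = t - c by ring]; linarith [hε.pos])
        · push Not at h2
          have := hgap c hc t s h3.le hx.symm h2
          rw [abs_sub_comm] at this
          exact hfar this
      · push Not at h1 h3
        rw [hβ3 s h1, hβ3 t h3]
        simpa using hz
  · have hc : IsLocalMax x c := hc
    have hce : IsLocalExtr x c := Or.inr hc
    have hi := hS.mem_of_isLocalMax h hc
    set i := (Int.fract c, Int.fract c) with hidef
    have hxi : x i.1 = x c := ((SameCirclePoint.fract c).periodic_eq h.px).symm
    have hqi : q i = x c := (hS.cusp i hi rfl).trans hxi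
    obtain ⟨hv1, hv2, hv3, hv4⟩ := hv i hi
    rw [hxi] at hv1 hv2
    have hvI : v i ∈ Ico (x i.1 - d) (q i) := by rw [hxi, hqi]; exact ⟨hv1.1.le, hv1.2⟩
    have hf := hS.feature i hi
    have hSP : ∀ θ : ℝ, SameCirclePoint θ (θ + ⌊c⌋) := fun θ => ⟨⌊c⌋, rfl⟩
    have hw : ∀ θ : ℝ, |θ - Int.fract c| < ρ → |θ + ⌊c⌋ - c| < ε := fun θ hθ => by
      rw [Int.fract] at hθ
      rw [show θ + ⌊c⌋ - c = θ - (c - ⌊c⌋) by ring]; linarith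
    have pW : Function.Periodic (fun θ => F (x θ) * z θ + y θ) 1 := fun θ => by
      simp only [h.px θ, h.py θ, h.pz θ]
    have hFw : ∀ θ, |θ - c| < ε → x c - δ / 2 ≤ x θ → x θ ≤ x c →
        F (x θ) * (z θ + β θ) = F (x θ) * z θ + y θ - y c := by
      intro θ h1 h2 h3
      rw [hβ1 c θ hce h1, hb1 _ (by rw [abs_le]; constructor <;> linarith)]
      have := (hF0 (x θ)).ne'
      field_simp; ring
    refine ⟨v i, hv1.2, ⟨A i (v i) + ⌊c⌋, B i (v i) + ⌊c⌋, hw _ (hS.near i hi _ hvI).1,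
      hw _ (hS.near i hi _ hvI).2, ?_, ?_, ?_⟩, fun s t hs ht hx hz => ?_⟩
    · exact ((hSP _).periodic_eq h.px).symm.trans (hf.strandA.section_eq _ hvI)
    · exact ((hSP _).periodic_eq h.px).symm.trans (hf.strandB.section_eq _ hvI)
    · have hsv : x (A i (v i) + ⌊c⌋) = v i :=
        ((hSP _).periodic_eq h.px).symm.trans (hf.strandA.section_eq _ hvI)
      have htv : x (B i (v i) + ⌊c⌋) = v i :=
        ((hSP _).periodic_eq h.px).symm.trans (hf.strandB.section_eq _ hvI)
      have hsw := hw _ (hS.near i hi _ hvI).1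
      have htw := hw _ (hS.near i hi _ hvI).2
      have hWeq : F (x (A i (v i))) * z (A i (v i)) + y (A i (v i)) =
          F (x (B i (v i))) * z (B i (v i)) + y (B i (v i)) := (hv3 _ hvI).2.1 rfl
      have hWA := (hSP (A i (v i))).periodic_eq pW
      have hWB := (hSP (B i (v i))).periodic_eq pW
      rw [(hSP (A i (v i))).periodic_eq (deriv_periodic h.px),
        (hSP (B i (v i))).periodic_eq (deriv_periodic h.px),
        (hSP (A i (v i))).periodic_eq (deriv_periodic pW),
        (hSP (B i (v i))).periodic_eq (deriv_periodic pW)] at hv4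
      rw [hWA, hWB] at hWeq
      set s := A i (v i) + (⌊c⌋ : ℝ)
      set t := B i (v i) + (⌊c⌋ : ℝ)
      have h1 := hFw s hsw (by rw [hsv]; exact hv2.le) (by rw [hsv]; exact hv1.2.le)
      have h2 := hFw t htw (by rw [htv]; exact hv2.le) (by rw [htv]; exact hv1.2.le)
      have h3 : z s + β s = z t + β t := by
        refine mul_left_cancel₀ (hF0 (v i)).ne' ?_
        rw [hsv] at h1 hWeq
        rw [htv] at h2 hWeq
        linarith
      rw [hnear c s hce hsw (by rw [hsv, abs_lt]; constructor <;> linarith [hv1.2]),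
        hnear c t hce htw (by rw [htv, abs_lt]; constructor <;> linarith [hv1.2]), hsv, htv, h3] at hv4
      intro h4
      apply hv4
      linear_combination F (v i) * h4
    · have hx' : x s = x t := hx
      have hz' : z t < z s := hz
      obtain ⟨p, -, a, b', -, -, -, huniq⟩ := h.exists_right_cusp_strands hc hε
      have hlt : x s < x c := (huniq s t hs ht hx' hz').1.2
      have hcmp : x c - d ≤ x s → (x s < v i → F (x s) * z t + y t < F (x s) * z s + y s) ∧
          (x s = v i → F (x s) * z t + y t = F (x s) * z s + y s) ∧
          (v i < x s → F (x s) * z s + y s < F (x s) * z t + y t) := by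
        intro hd
        obtain ⟨-, hon⟩ := hS.onStrands_of_window h hε hρ hc hs ht hx' hz' hd
        have h1 := hv3 (x s) hon.1
        have h2 := hon.eq_eval pW
        dsimp only at h1 h2
        rw [← h2.1, ← h2.2, ← hx'] at h1
        exact ⟨h1.1, fun e => (h1.2.1 e).symm, h1.2.2⟩
      have hy : ∀ θ, |θ - c| < ε → F (x θ) * β θ = b (x θ - x c) * (y θ - y c) := fun θ hθ => by
        rw [hβ1 c θ hce hθ]; have := (hF0 (x θ)).ne'; field_simp
      have hys := hy s hs
      have hyt := hy t ht
      rw [← hx'] at hyt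
      change (x s < v i → _) ∧ (x s = v i → _) ∧ (v i < x s → _)
      have hFp := hF0 (x s)
      have hb01 : b (x s - x c) ≤ 1 := b.le_one
      have hbn : 0 ≤ b (x s - x c) := b.nonneg
      have hone : v i ≤ x s → b (x s - x c) = 1 ∧ x c - d ≤ x s := fun hle =>
        ⟨hb1 _ (by rw [abs_le]; constructor <;> linarith), by linarith [hv1.1]⟩
      refine ⟨fun hxv => ?_, fun hxv => ?_, fun hxv => ?_⟩
      · refine lt_of_mul_lt_mul_left (a := F (x s)) ?_ hFp.le
        have hpos := mul_pos hFp (sub_pos.2 hz')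
        -- To the left of v i the cutoff may lie strictly between 0 and 1. A correction that favours
        -- the higher branch does no harm; an opposing one is worst for b = 1, where W still has the
        -- order of z. Farther left the cutoff vanishes because δ ≤ d.
        by_cases hd : x c - d ≤ x s
        · have h1 := (hcmp hd).1 hxv
          rcases le_total (y t) (y s) with hyy | hyy
          · have := mul_nonneg hbn (sub_nonneg.2 hyy)
            nlinarith
          · have := mul_le_mul_of_nonneg_right hb01 (sub_nonneg.2 hyy)
            nlinarith
        · have h1 : b (x s - x c) = 0 := hb0 _ (by
            rw [abs_of_neg (by linarith)]
            have := min_le_right δ' d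
            rw [← hδdef] at this
            linarith)
          rw [h1, zero_mul] at hys hyt
          nlinarith
      · obtain ⟨h1, h2⟩ := hone hxv.ge
        rw [h1] at hys hyt
        refine mul_left_cancel₀ hFp.ne' ?_
        have := (hcmp h2).2.1 hxv
        linarith
      · obtain ⟨h1, h2⟩ := hone hxv.le
        rw [h1] at hys hyt
        refine lt_of_mul_lt_mul_left (a := F (x s)) ?_ hFp.le
        have := (hcmp h2).2.2 hxv
        linarith

/-! ### Isotopy of resolutions -/

theorem OnStrands.lt_iff {x w A B : ℝ → ℝ} {I : Set ℝ} {a s t : ℝ} (pw : Function.Periodic w 1)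
    (hc : CrossesAt w A B I a) (h : OnStrands x A B I s t) :
    (w s < w t ↔ a < x s) ∧ (w t < w s ↔ x s < a) := by
  have h1 := hc _ h.1
  rw [← (h.eq_eval pw).1, ← (h.eq_eval pw).2] at h1
  rcases lt_trichotomy (x s) a with h2 | h2 | h2
  · have := h1.1 h2
    exact ⟨iff_of_false this.asymm h2.asymm, iff_of_true this h2⟩
  · have := h1.2.1 h2
    rw [this, h2]; simp
  · have := h1.2.2 h2
    exact ⟨iff_of_true this h2, iff_of_false this.asymm h2.asymm⟩

/-- The two branches over `(p, x c)` at a right cusp `c`, the higher one first. -/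
structure IsCuspStrands (x z : ℝ → ℝ) (c ε p : ℝ) (A B : ℝ → ℝ) : Prop where
  strandA : IsStrand x A (Ioo p (x c))
  strandB : IsStrand x B (Ioo p (x c))
  near : ∀ u ∈ Ioo p (x c), |A u - c| < ε ∧ |B u - c| < ε ∧ z (B u) < z (A u)
  uniq : ∀ s t, |s - c| < ε → |t - c| < ε → x s = x t → z t < z s →
    x s ∈ Ioo p (x c) ∧ A (x s) = s ∧ B (x s) = t

namespace IsCuspStrands

variable {x y z A B : ℝ → ℝ} {c ε p : ℝ}

/-- Compare heights with A: a point of the window over the same abscissa that is higher or lower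
forms a pair with A and is identified by uniqueness; at equal height it is A itself, since the
window has no crossing. -/
theorem sameCirclePoint (h : IsCuspStrands x z c ε p A B) (px : Function.Periodic x 1)
    (hε : IsWindowRadius x z ε) (hc : IsLocalMax x c) {θ : ℝ} (hu : x θ ∈ Ioo p (x c)) (n : ℤ) (hθ : |θ + n - c| < ε) :
    SameCirclePoint (A (x θ)) θ ∨ SameCirclePoint (B (x θ)) θ := by
  have hn : SameCirclePoint (θ + n) θ := ⟨-n, by push_cast; ring⟩
  obtain ⟨h1, h2, h3⟩ := h.near _ hu
  have hxθ : x (θ + n) = x θ := hn.periodic_eq px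
  have hA := h.strandA.section_eq _ hu
  rcases lt_trichotomy (z (θ + n)) (z (A (x θ))) with h4 | h4 | h4
  · have := (h.uniq _ _ h1 hθ (by rw [hA, hxθ]) h4).2.2
    rw [hA] at this
    exact Or.inr (this ▸ hn)
  · exact Or.inl ((hε.crossing_free c _ _ (Or.inr hc) h1 (by rw [hA, hxθ]) h4.symm).trans hn)
  · have := (h.uniq _ _ hθ h1 (by rw [hA, hxθ]) h4).2.1
    rw [hxθ] at this
    exact Or.inl (this ▸ hn)

theorem onStrands (h : IsCuspStrands x z c ε p A B) (px : Function.Periodic x 1) {s t s' t' : ℝ}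
    (hs' : |s' - c| < ε) (ht' : |t' - c| < ε) (hs : SameCirclePoint s' s)
    (ht : SameCirclePoint t' t) (hx : x s = x t) (hz : z t' < z s') :
    OnStrands x A B (Ioo p (x c)) s t := by
  have h1 := h.uniq s' t' hs' ht' (by rw [hs.periodic_eq px, ht.periodic_eq px, hx]) hz
  rw [hs.periodic_eq px] at h1
  exact ⟨h1.1, hx, h1.2.1 ▸ hs, h1.2.2 ▸ ht⟩

theorem ne (h : IsCuspStrands x z c ε p A B) (pz : Function.Periodic z 1) {u : ℝ}
    (hu : u ∈ Ioo p (x c)) : ¬ SameCirclePoint (A u) (B u) := fun hs => by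
  have := (h.near u hu).2.2
  rw [hs.periodic_eq pz] at this
  exact lt_irrefl _ this

end IsCuspStrands

theorem InSameRightWindow.symm {φ : ℝ → ℝ × ℝ × ℝ} {ε s t : ℝ} (px : Function.Periodic (xCoord φ) 1)
    (h : InSameRightWindow φ ε s t) : InSameRightWindow φ ε t s := by
  obtain ⟨c, n, hc, h1, h2⟩ := h
  exact ⟨c + n, -n, (isLocalExtr_of_sameCirclePoint px ⟨n, rfl⟩).1 hc, h2, by
    push_cast; rwa [show s - (c + n + -n) = s - c by ring]⟩

/-- The part of a resolution that concerns one window radius `ε`. -/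
structure HasWindows (φ : ℝ → ℝ × ℝ × ℝ) (w : ℝ → ℝ) (ε : ℝ) : Prop where
  radius : IsWindowRadius (xCoord φ) (zCoord φ) ε
  eq_of_far : ∀ θ, (∀ c, IsLocalExtr (xCoord φ) c → ε ≤ |θ - c|) → w θ = zCoord φ θ
  order : ∀ s t, xCoord φ s = xCoord φ t → ¬ InSameRightWindow φ ε s t →
    zCoord φ s < zCoord φ t → w s < w t
  loop : ∀ c, IsLocalMax (xCoord φ) c → ∃ a < xCoord φ c,
    (∃ s t, |s - c| < ε ∧ |t - c| < ε ∧ xCoord φ s = a ∧ xCoord φ t = a ∧ s ≠ t) ∧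
    (∀ s t, |s - c| < ε → |t - c| < ε → xCoord φ s = xCoord φ t →
      zCoord φ t < zCoord φ s →
        (xCoord φ s < a → w t < w s) ∧ (xCoord φ s = a → w t = w s) ∧
        (a < xCoord φ s → w s < w t))

/-- The topological comparison needs no smoothness of w; of the transverse crossing it keeps only
that the two parameters are different. -/
theorem IsCuspResolution.exists_hasWindows {r : ℕ∞} {φ : ℝ → ℝ × ℝ × ℝ} {w : ℝ → ℝ}
    (h : IsCuspResolution r φ w) : ∃ ε, HasWindows φ w ε := by
  obtain ⟨ε, hε, h1, h2, h3, h4, h5⟩ := h.exists_windows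
  refine ⟨ε, ⟨hε, h1, fun c s t hc hs hx hz => h2 c s t hc hs (Prod.ext hx hz)⟩, h3, h4,
    fun c hc => ?_⟩
  obtain ⟨a, ha, ⟨s, t, hs, ht, hsa, hta, hne⟩, h6⟩ := h5 c hc
  exact ⟨a, ha, ⟨s, t, hs, ht, hsa, hta, fun e => hne (by rw [e])⟩, h6⟩

namespace HasWindows

variable {φ : ℝ → ℝ × ℝ × ℝ} {y w A B : ℝ → ℝ} {c ε D p : ℝ}

/-- The strands are taken in the larger window D, independent of the one chosen by the resolution.
Inside the ε-window the exchange is prescribed; outside it w follows the front, and such abscissas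
lie to the left of a. -/
theorem exists_cuspStrands (hw : HasWindows φ w ε) (h : FrontCurve (xCoord φ) y (zCoord φ))
    (hD : IsWindowRadius (xCoord φ) (zCoord φ) D) (hle : ε ≤ D) (hc : IsLocalMax (xCoord φ) c) :
    ∃ p A B a, IsCuspStrands (xCoord φ) (zCoord φ) c D p A B ∧ a ∈ Ioo p (xCoord φ c) ∧
      CrossesAt w A B (Ioo p (xCoord φ c)) a := by
  have hce : IsLocalExtr (xCoord φ) c := Or.inr hc
  obtain ⟨p, -, A, B, hA, hB, hAB, huniq⟩ := h.exists_right_cusp_strands hc hD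
  obtain ⟨p₁, -, A₁, B₁, hA₁, hB₁, hAB₁, huniq₁⟩ := h.exists_right_cusp_strands hc hw.radius
  obtain ⟨a, -, ⟨s, t, hs, ht, hsa, hta, hst⟩, hloop⟩ := hw.loop c hc
  have heq : ∀ u ∈ Ioo p₁ (xCoord φ c), u ∈ Ioo p (xCoord φ c) ∧ A u = A₁ u ∧ B u = B₁ u := by
    intro u hu
    obtain ⟨h1, h2, h3⟩ := hAB₁ u hu
    have h4 := huniq (A₁ u) (B₁ u) (h1.trans_le hle) (h2.trans_le hle)
      (by rw [hA₁.section_eq u hu, hB₁.section_eq u hu]) h3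
    rwa [hA₁.section_eq u hu] at h4
  have ha : a ∈ Ioo p₁ (xCoord φ c) := by
    rcases lt_trichotomy (zCoord φ s) (zCoord φ t) with h1 | h1 | h1
    · have := (huniq₁ t s ht hs (hta.trans hsa.symm) h1).1
      rwa [hta] at this
    · refine absurd ((hw.radius.crossing_free c s t hce hs (hsa.trans hta.symm) h1).eq_of_abs_lt ?_) hst
      have h2 := abs_sub (s - c) (t - c)
      have h3 := h.two_mul_le_one hw.radius hce
      rw [show s - t = s - c - (t - c) by ring]
      linarith
    · have := (huniq₁ s t hs ht (hsa.trans hta.symm) h1).1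
      rwa [hsa] at this
  refine ⟨p, A, B, a, ⟨hA, hB, hAB, huniq⟩, (heq a ha).1, fun u hu => ?_⟩
  obtain ⟨h1, h2, h3⟩ := hAB u hu
  have hxx : xCoord φ (A u) = xCoord φ (B u) := by rw [hA.section_eq u hu, hB.section_eq u hu]
  by_cases hin : |A u - c| < ε ∧ |B u - c| < ε
  · have := hloop _ _ hin.1 hin.2 hxx h3
    rw [hA.section_eq u hu] at this
    exact ⟨this.1, fun e => (this.2.1 e).symm, this.2.2⟩
  · have hlt : w (B u) < w (A u) := by
      refine hw.order _ _ hxx.symm ?_ h3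
      rintro ⟨c', n, hc', h4, h5⟩
      have e1 : c' = c := hD.eq_of_common (Or.inr hc') hce (h4.trans_le hle) h2
      subst e1
      have e2 : c' + n = c' := hD.eq_of_common
        (Or.inr ((isLocalExtr_of_sameCirclePoint h.px ⟨n, rfl⟩).1 hc')) hce (h5.trans_le hle) h1
      rw [e2] at h5
      exact hin ⟨h5, h4⟩
    have hua : u < a := by
      by_contra hua
      have hu1 : u ∈ Ioo p₁ (xCoord φ c) := ⟨ha.1.trans_le (not_lt.1 hua), hu.2⟩
      have h4 := hAB₁ u hu1
      rw [← (heq u hu1).2.1, ← (heq u hu1).2.2] at h4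
      exact hin ⟨h4.1, h4.2.1⟩
    exact ⟨fun _ => hlt, fun e => absurd e hua.ne, fun e => absurd e hua.asymm⟩

/-- Away from the branches at the cusp, `w` has the order of the front. -/
theorem order_strand (hw : HasWindows φ w ε) (h : FrontCurve (xCoord φ) y (zCoord φ))
    (hD : IsWindowRadius (xCoord φ) (zCoord φ) D) (hle : ε ≤ D) (hc : IsLocalMax (xCoord φ) c)
    (hs : IsCuspStrands (xCoord φ) (zCoord φ) c D p A B) {θ s : ℝ}
    (hu : xCoord φ θ ∈ Ioo p (xCoord φ c)) (hA : ¬ SameCirclePoint (A (xCoord φ θ)) θ)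
    (hB : ¬ SameCirclePoint (B (xCoord φ θ)) θ) (hθs : xCoord φ θ = xCoord φ s) (hsc : |s - c| < D)
    (hss : ¬ SameCirclePoint s θ) :
    zCoord φ θ ≠ zCoord φ s ∧ (zCoord φ θ < zCoord φ s → w θ < w s) ∧
      (zCoord φ s < zCoord φ θ → w s < w θ) := by
  have hce : IsLocalExtr (xCoord φ) c := Or.inr hc
  have hns : ¬ InSameRightWindow φ ε s θ := by
    rintro ⟨c', n, hc', h1, h2⟩
    have e1 : c' = c := hD.eq_of_common (Or.inr hc') hce (h1.trans_le hle) hsc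
    subst e1
    rcases hs.sameCirclePoint h.px hD hc' hu (-n) (by
      push_cast; rw [show θ + -(n : ℝ) - c' = θ - (c' + n) by ring]; exact h2.trans_le hle)
      with h3 | h3
    exacts [hA h3, hB h3]
  exact ⟨fun hz => hss (hD.crossing_free c s θ hce hsc hθs.symm hz.symm),
    hw.order _ _ hθs fun hn => hns (hn.symm h.px), hw.order _ _ hθs.symm hns⟩

end HasWindows

/-- The crossing information of a resolved front. -/
def resolvedRel (y z : ℝ → ℝ) (s t : ℝ) : Prop := (z s = z t ∧ y s < y t) ∨ z t < z s

/-- The loops at the right cusps can be moved so that they start over the abscissas `v i`. -/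
theorem HasWindows.exists_move_loops {φ : ℝ → ℝ × ℝ × ℝ} {y w F : ℝ → ℝ} {ε D d ρ M : ℝ}
    {S : Finset (ℝ × ℝ)} {A B : ℝ × ℝ → ℝ → ℝ} {q v : ℝ × ℝ → ℝ}
    (hw : HasWindows φ w ε) (h : FrontCurve (xCoord φ) y (zCoord φ))
    (hF : IsShear (xCoord φ) y (zCoord φ) S A B q d ρ M F v)
    (hD : IsWindowRadius (xCoord φ) (zCoord φ) D) (hle : ε ≤ D) (hρ : ρ ≤ D)
    (hwc : Continuous w) (pw : Function.Periodic w 1) :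
    ∃ w₁ : ℝ → ℝ, Continuous w₁ ∧ Function.Periodic w₁ 1 ∧
      (∀ i ∈ S, i.1 = i.2 → CrossesAt w₁ (A i) (B i) (Ico (xCoord φ i.1 - d) (q i)) (v i)) ∧
      (∀ s t, xCoord φ s = xCoord φ t → (∀ i ∈ S, i.1 = i.2 →
          ¬ OnStrands (xCoord φ) (A i) (B i) (Ico (xCoord φ i.1 - d) (q i)) s t ∧
          ¬ OnStrands (xCoord φ) (A i) (B i) (Ico (xCoord φ i.1 - d) (q i)) t s) →
        (zCoord φ s < zCoord φ t → w₁ s < w₁ t) ∧ (zCoord φ s = zCoord φ t → w₁ s = w₁ t)) ∧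
      PlanarIsotopic ⟨fun θ => (xCoord φ θ, w θ), resolvedRel y (zCoord φ)⟩
        ⟨fun θ => (xCoord φ θ, w₁ θ), resolvedRel y (zCoord φ)⟩ := by
  classical
  set x := xCoord φ with hx
  set z := zCoord φ with hz
  have hS := hF.system
  set T := S.filter fun i => i.1 = i.2 with hT
  have hTS : ∀ i ∈ T, i ∈ S ∧ i.1 = i.2 := fun i hi => Finset.mem_filter.1 hi
  have hmax : ∀ i ∈ T, IsLocalMax x i.1 := by
    intro i hi
    obtain ⟨h1, h2⟩ := hTS i hi
    obtain ⟨-, -, -, -, ⟨-, h3⟩ | h3⟩ := (hS.mem_iff i).1 h1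
    · exact h3
    · rw [h2] at h3; exact absurd h3 (lt_irrefl _)
  have hq : ∀ i ∈ T, q i = x i.1 := fun i hi => hS.cusp i (hTS i hi).1 (hTS i hi).2
  have hst : ∀ i ∈ T, ∃ p A B a, IsCuspStrands x z i.1 D p A B ∧ a ∈ Ioo p (x i.1) ∧
      CrossesAt w A B (Ioo p (x i.1)) a := fun i hi => hw.exists_cuspStrands h hD hle (hmax i hi)
  choose! p A' B' a hAB ha hcr using hst
  have hfeat : ∀ i ∈ T, ∀ u ∈ Ico (x i.1 - d) (q i),
      u ∈ Ioo (p i) (x i.1) ∧ A' i u = A i u ∧ B' i u = B i u := by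
    intro i hi u hu
    obtain ⟨h1, h2⟩ := hTS i hi
    have hf := hS.feature i h1
    have hn := hS.near i h1 u hu
    rw [← h2] at hn
    have := (hAB i hi).uniq (A i u) (B i u) (hn.1.trans_le hρ) (hn.2.trans_le hρ)
      (by rw [hf.strandA.section_eq u hu, hf.strandB.section_eq u hu])
      ((hf.crosses u hu).1 (hq i hi ▸ hu.2))
    rwa [hf.strandA.section_eq u hu] at this
  have hv : ∀ i ∈ T, v i ∈ Ioo (p i) (x i.1) := fun i hi =>
    (hfeat i hi _ (hF.mem_Ico (hTS i hi).1)).1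
  have hdisj : ∀ i ∈ T, ∀ j ∈ T, ∀ θ, x θ ∈ Ioo (p i) (x i.1) → x θ ∈ Ioo (p j) (x j.1) →
      (SameCirclePoint (A' i (x θ)) θ ∨ SameCirclePoint (B' i (x θ)) θ) →
      (SameCirclePoint (A' j (x θ)) θ ∨ SameCirclePoint (B' j (x θ)) θ) → i = j := by
    intro i hi j hj θ h1 h2 h3 h4
    have hnear : ∀ i ∈ T, x θ ∈ Ioo (p i) (x i.1) →
        (SameCirclePoint (A' i (x θ)) θ ∨ SameCirclePoint (B' i (x θ)) θ) →
        ∃ θ', |θ' - i.1| < D ∧ SameCirclePoint θ' θ := by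
      intro i hi h1 h3
      have := (hAB i hi).near _ h1
      rcases h3 with h3 | h3
      exacts [⟨_, this.1, h3⟩, ⟨_, this.2.1, h3⟩]
    obtain ⟨θ₁, h5, h6⟩ := hnear i hi h1 h3
    obtain ⟨θ₂, h7, h8⟩ := hnear j hj h2 h4
    obtain ⟨n, hn⟩ := h6.trans h8.symm
    have hin : SameCirclePoint i.1 (i.1 + n) := ⟨n, rfl⟩
    have h9 : i.1 + n = j.1 := hD.eq_of_common
      (Or.inr ((isLocalExtr_of_sameCirclePoint h.px hin).1 (hmax i hi))) (Or.inr (hmax j hj))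
      (by rw [hn, add_sub_add_right_eq_sub]; exact h5) h7
    have h10 : i.1 = j.1 := (h9 ▸ hin).eq_of_mem_Ico ((hS.mem_iff i).1 (hTS i hi).1).1
      ((hS.mem_iff j).1 (hTS j hj).1).1
    exact Prod.ext h10 (by rw [← (hTS i hi).2, ← (hTS j hj).2, h10])
  -- A compact interval around both a i and v i inside the domain of the branches, as `IsSlide`
  -- requires.
  set p' : ℝ × ℝ → ℝ := fun i => (p i + min (a i) (v i)) / 2 with hp'
  set q' : ℝ × ℝ → ℝ := fun i => (max (a i) (v i) + x i.1) / 2 with hq'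
  have hp1 : ∀ i ∈ T, p i < p' i ∧ p' i < a i ∧ p' i < v i := by
    intro i hi
    have h1 := lt_min (ha i hi).1 (hv i hi).1
    have h2 := min_le_left (a i) (v i)
    have h3 := min_le_right (a i) (v i)
    simp only [hp']
    refine ⟨?_, ?_, ?_⟩ <;> linarith
  have hq1 : ∀ i ∈ T, a i < q' i ∧ v i < q' i ∧ q' i < x i.1 := by
    intro i hi
    have h1 := max_lt (ha i hi).2 (hv i hi).2
    have h2 := le_max_left (a i) (v i)
    have h3 := le_max_right (a i) (v i)
    simp only [hq']
    refine ⟨?_, ?_, ?_⟩ <;> linarith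
  have hsub : ∀ i ∈ T, Icc (p' i) (q' i) ⊆ Ioo (p i) (x i.1) := fun i hi u hu =>
    ⟨(hp1 i hi).1.trans_le hu.1, hu.2.trans_lt (hq1 i hi).2.2⟩
  have hslide : ∀ i ∈ T, IsSlide x w (A' i) (B' i) (resolvedRel y z) (p' i) (q' i) (a i) (v i) := by
    intro i hi
    have hs := hAB i hi
    have hrel : ∀ s t, OnStrands x (A' i) (B' i) (Icc (p' i) (q' i)) s t → z t < z s := by
      intro s t hon
      have := (hs.near _ (hsub i hi hon.1)).2.2
      rwa [← (hon.eq_eval h.pz).1, ← (hon.eq_eval h.pz).2] at this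
    refine ⟨hs.strandA.mono (hsub i hi), hs.strandB.mono (hsub i hi),
      ⟨(hp1 i hi).2.1, (hq1 i hi).1⟩, ⟨(hp1 i hi).2.2, (hq1 i hi).2.1⟩,
      fun u hu => hs.ne h.pz (hsub i hi hu), fun u hu => hcr i hi u (hsub i hi hu),
      fun u hu θ hθ hmem => ?_, fun s t s' t' h1 h2 => ?_⟩
    -- Suppose a third strand runs between the branches. Against each of them w orders it as z does.
    -- Before the exchange in w it is strictly between them in z, hence in W, since these pairs
    -- belong to no feature; but at such an abscissa, which is at least v i, the branches are no
    -- longer in that order in W. From the exchange on, being between them in w contradicts the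
    -- order of the branches in z.
    · by_contra hcon
      push Not at hcon
      subst hθ
      have huI : x θ ∈ Ioo (p i) (x i.1) :=
        ordConnected_Ioo.uIcc_subset (ha i hi) (hv i hi) hu
      obtain ⟨n1, n2, n3⟩ := hs.near _ huI
      have hA := hs.strandA.section_eq _ huI
      have hB := hs.strandB.section_eq _ huI
      obtain ⟨oA, oA1, oA2⟩ := hw.order_strand h hD hle (hmax i hi) hs huI hcon.1 hcon.2 hA.symm n1
        hcon.1
      obtain ⟨oB, oB1, oB2⟩ := hw.order_strand h hD hle (hmax i hi) hs huI hcon.1 hcon.2 hB.symm n2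
        hcon.2
      rw [← hz] at oA oA1 oA2 oB oB1 oB2
      have hc := hcr i hi _ huI
      rcases lt_or_ge (x θ) (a i) with h1 | h1
      · have h2 := hc.1 h1
        rw [uIcc_of_ge h2.le] at hmem
        have hzA : z θ < z (A' i (x θ)) := lt_of_le_of_ne (by
          by_contra h3; exact absurd (oA2 (not_le.1 h3)) (not_lt.2 hmem.2)) oA
        have hzB : z (B' i (x θ)) < z θ := lt_of_le_of_ne (by
          by_contra h3; exact absurd (oB1 (not_le.1 h3)) (not_lt.2 hmem.1)) oB.symm
        have hvu : v i ≤ x θ := by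
          rcases mem_uIcc.1 hu with h3 | h3
          · exact absurd (h3.1.trans_lt h1) (lt_irrefl _)
          · exact h3.1
        have hiS := (hTS i hi).1
        have huF : x θ ∈ Ico (x i.1 - d) (q i) :=
          ⟨(hF.mem i hiS).1.le.trans hvu, by rw [hq i hi]; exact huI.2⟩
        obtain ⟨-, eA, eB⟩ := hfeat i hi _ huF
        rw [eA, eB] at hcon
        rw [eA] at hzA
        rw [eB] at hzB
        have hfA := (hS.feature i hiS).strandA.section_eq _ huF
        have hfB := (hS.feature i hiS).strandB.section_eq _ huF
        have hno : ∀ X, x X = x θ →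
            (SameCirclePoint (A i (x θ)) X ∨ SameCirclePoint (B i (x θ)) X) →
            ∀ j ∈ S, ¬ OnStrands x (A j) (B j) (Ico (x j.1 - d) (q j)) θ X ∧
              ¬ OnStrands x (A j) (B j) (Ico (x j.1 - d) (q j)) X θ := by
          intro X hX hXi j hj
          have key : x θ ∈ Ico (x j.1 - d) (q j) →
              (SameCirclePoint (A j (x θ)) X ∨ SameCirclePoint (B j (x θ)) X) →
              (SameCirclePoint (A j (x θ)) θ ∨ SameCirclePoint (B j (x θ)) θ) → False := by
            intro h4 h5 h6
            have := hS.disjoint i hiS j hj X (hX ▸ huF) (hX ▸ h4) (by rwa [hX]) (by rwa [hX])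
            subst this
            rcases h6 with h6 | h6
            exacts [hcon.1 h6, hcon.2 h6]
          constructor
          · rintro ⟨h4, -, h5, h6⟩
            exact key h4 (Or.inr h6) (Or.inl h5)
          · rintro ⟨h4, -, h5, h6⟩
            rw [hX] at h4 h5 h6
            exact key h4 (Or.inl h5) (Or.inr h6)
        have hWA := (hF.order_of_not_onStrands hfA.symm (fun e => hcon.1 e.symm)
          (hno _ hfA (Or.inl (SameCirclePoint.refl _)))).2.1 hzA
        have hWB := (hF.order_of_not_onStrands hfB (fun e => hcon.2 e)
          fun j hj => (hno _ hfB (Or.inr (SameCirclePoint.refl _)) j hj).symm).2.1 hzB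
        have hWc := hF.crosses i hiS _ huF
        dsimp only at hWc
        rcases hvu.eq_or_lt with h4 | h4
        · have := hWc.2.1 h4.symm
          linarith
        · have := hWc.2.2 h4
          linarith
      · have h2 : w (A' i (x θ)) ≤ w (B' i (x θ)) := by
          rcases h1.eq_or_lt with h3 | h3
          · exact (hc.2.1 h3.symm).le
          · exact (hc.2.2 h3).le
        rw [uIcc_of_le h2] at hmem
        rcases lt_or_gt_of_ne oA with h3 | h3
        · exact absurd (oA1 h3) (not_lt.2 hmem.1)
        · exact absurd (oB2 (n3.trans h3)) (not_lt.2 hmem.2)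
    · have e1 := hrel s t h1
      have e2 := hrel s' t' h2
      refine ⟨iff_of_true (Or.inr e1) (Or.inr e2), iff_of_false ?_ ?_⟩
      · rintro (⟨h3, -⟩ | h3)
        · exact e1.ne h3
        · exact e1.asymm h3
      · rintro (⟨h3, -⟩ | h3)
        · exact e2.ne h3
        · exact e2.asymm h3
  obtain ⟨w₁, hw₁c, pw₁, hcr₁, hord, hiso⟩ := exists_slides h.hx.continuous h.px hwc pw T hslide
    fun i hi j hj θ h1 h2 h3 h4 => hdisj i hi j hj θ (hsub i hi h1) (hsub j hj h2) h3 h4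
  -- Outside the slide interval the order of the two branches is unchanged, and a i and v i lie on
  -- the same side of such a point.
  have hbig : ∀ i ∈ T, CrossesAt w₁ (A' i) (B' i) (Ioo (p i) (x i.1)) (v i) := by
    intro i hi u hu
    by_cases huI : u ∈ Icc (p' i) (q' i)
    · exact hcr₁ i hi u huI
    · have hA := (hAB i hi).strandA.section_eq u hu
      have hB := (hAB i hi).strandB.section_eq u hu
      have hno : ∀ j ∈ T, ¬ OnStrands x (A' j) (B' j) (Icc (p' j) (q' j)) (A' i u) (B' i u) ∧
          ¬ OnStrands x (A' j) (B' j) (Icc (p' j) (q' j)) (B' i u) (A' i u) := by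
        intro j hj
        constructor
        · rintro ⟨h1, -, h2, -⟩
          have := hdisj i hi j hj (A' i u) (by rwa [hA]) (hsub j hj h1)
            (Or.inl (by rw [hA]; exact SameCirclePoint.refl _)) (Or.inl h2)
          subst this
          exact huI (hA ▸ h1)
        · rintro ⟨h1, h0, -, h2⟩
          rw [hB] at h1
          have := hdisj i hi j hj (A' i u) (by rwa [hA]) (by rw [hA]; exact hsub j hj h1)
            (Or.inl (by rw [hA]; exact SameCirclePoint.refl _)) (Or.inr (by rw [hA]; rwa [hB] at h2))
          subst this
          exact huI h1
      have o1 := hord _ _ (hA.trans hB.symm) hno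
      have o2 := hord _ _ (hB.trans hA.symm) fun j hj => (hno j hj).symm
      have h1 := hp1 i hi
      have h2 := hq1 i hi
      have h3 := hcr i hi u hu
      have h4 : u < p' i ∨ q' i < u := by
        by_contra h4; push Not at h4; exact huI h4
      rcases h4 with h4 | h4
      · have := o2.1 (h3.1 (by linarith))
        exact ⟨fun _ => this, fun e => by linarith, fun e => by linarith⟩
      · have := o1.1 (h3.2.2 (by linarith))
        exact ⟨fun e => by linarith, fun e => by linarith, fun _ => this⟩
  refine ⟨w₁, hw₁c, pw₁, fun i hi h12 u hu => ?_, fun s t hxx hno => ?_, hiso⟩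
  · have hiT : i ∈ T := Finset.mem_filter.2 ⟨hi, h12⟩
    obtain ⟨h1, h2, h3⟩ := hfeat i hiT u hu
    rw [← h2, ← h3]
    exact hbig i hiT u h1
  · by_cases hon : ∃ i ∈ T, OnStrands x (A' i) (B' i) (Ioo (p i) (x i.1)) s t
    · obtain ⟨i, hi, hon⟩ := hon
      have := ((hAB i hi).near _ hon.1).2.2
      rw [← (hon.eq_eval h.pz).1, ← (hon.eq_eval h.pz).2] at this
      exact ⟨fun e => absurd e this.asymm, fun e => absurd e this.ne'⟩
    by_cases hon' : ∃ i ∈ T, OnStrands x (A' i) (B' i) (Ioo (p i) (x i.1)) t s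
    · obtain ⟨i, hi, hon'⟩ := hon'
      have h1 := ((hAB i hi).near _ hon'.1).2.2
      rw [← (hon'.eq_eval h.pz).1, ← (hon'.eq_eval h.pz).2] at h1
      -- A pair on the cusp branches that is not on the feature strands lies to the left of v i,
      -- where the order is still that of the front.
      refine ⟨fun _ => (hon'.lt_iff pw₁ (hbig i hi)).2.2 ?_, fun e => absurd e h1.ne⟩
      by_contra hvu
      have hiS := (hTS i hi).1
      have huF : x t ∈ Ico (x i.1 - d) (q i) :=
        ⟨(hF.mem i hiS).1.le.trans (not_lt.1 hvu), by rw [hq i hi]; exact hon'.1.2⟩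
      obtain ⟨-, e1, e2⟩ := hfeat i hi _ huF
      refine (hno i hiS (hTS i hi).2).2 ⟨huF, hxx.symm, ?_, ?_⟩
      · rw [← e1]; exact hon'.2.2.1
      · rw [← e2]; exact hon'.2.2.2
    push Not at hon hon'
    have o1 := hord s t hxx fun i hi => ⟨fun e => hon i hi (e.mono (hsub i hi)),
      fun e => hon' i hi (e.mono (hsub i hi))⟩
    have o2 := hord t s hxx.symm fun i hi => ⟨fun e => hon' i hi (e.mono (hsub i hi)),
      fun e => hon i hi (e.mono (hsub i hi))⟩
    refine ⟨fun hzz => o1.1 (hw.order s t hxx ?_ hzz), fun hzz => ?_⟩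
    · rintro ⟨c, n, hc, h1, h2⟩
      have hi : (Int.fract c, Int.fract c) ∈ T :=
        Finset.mem_filter.2 ⟨hS.mem_of_isLocalMax h hc, rfl⟩
      have hs' : SameCirclePoint (s - ⌊c⌋) s := ⟨⌊c⌋, by ring⟩
      have ht' : SameCirclePoint (t - (n + ⌊c⌋)) t := ⟨n + ⌊c⌋, by push_cast; ring⟩
      refine hon' _ hi ((hAB _ hi).onStrands h.px (t' := s - ⌊c⌋) (s' := t - (n + ⌊c⌋)) ?_ ?_
        ht' hs' hxx.symm ?_)
      · rw [Int.fract, show t - (n + ⌊c⌋) - (c - ⌊c⌋) = t - (c + n) by ring]; linarith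
      · rw [Int.fract, show s - ⌊c⌋ - (c - ⌊c⌋) = s - c by ring]; linarith
      · rw [hs'.periodic_eq h.pz, ht'.periodic_eq h.pz]; exact hzz
    -- An old crossing lies in no window, so w = z at both parameters; the slides preserve the
    -- resulting equality.
    · by_cases hsp : SameCirclePoint s t
      · exact hsp.periodic_eq pw₁
      have hws : w s = z s := hw.eq_of_far s fun c hc => by
        by_contra hlt
        exact hsp (hw.radius.crossing_free c s t hc (not_le.1 hlt) hxx hzz)
      have hwt : w t = z t := hw.eq_of_far t fun c hc => by
        by_contra hlt
        exact hsp (hw.radius.crossing_free c t s hc (not_le.1 hlt) hxx.symm hzz.symm).symm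
      refine le_antisymm (not_lt.1 fun e => ?_) (not_lt.1 fun e => ?_)
      · have := o2.2 e
        rw [hws, hwt, hzz] at this
        exact lt_irrefl _ this
      · have := o1.2 e
        rw [hws, hwt, hzz] at this
        exact lt_irrefl _ this

/-- A strand of one feature meets no other feature. -/
theorem IsFeatureSystem.not_onStrands {x y z : ℝ → ℝ} {S : Finset (ℝ × ℝ)} {A B : ℝ × ℝ → ℝ → ℝ}
    {q : ℝ × ℝ → ℝ} {d ρ M : ℝ} (hS : IsFeatureSystem x y z S A B q d ρ M) {i j : ℝ × ℝ}
    (hi : i ∈ S) (hj : j ∈ S) {s t : ℝ} (hx : x s = x t) (hI : x s ∈ Ico (x i.1 - d) (q i))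
    (hs : SameCirclePoint (A i (x s)) s ∨ SameCirclePoint (B i (x s)) s)
    (hne : i = j → ¬ SameCirclePoint (A i (x s)) t ∧ ¬ SameCirclePoint (B i (x s)) t) :
    ¬ OnStrands x (A j) (B j) (Ico (x j.1 - d) (q j)) s t ∧
      ¬ OnStrands x (A j) (B j) (Ico (x j.1 - d) (q j)) t s := by
  constructor
  · rintro ⟨h1, -, h2, h3⟩
    have := hS.disjoint i hi j hj s hI h1 hs (Or.inl h2)
    subst this
    exact (hne rfl).2 h3
  · rintro ⟨h1, -, h2, h3⟩
    rw [← hx] at h1 h2 h3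
    have := hS.disjoint i hi j hj s hI h1 hs (Or.inr h3)
    subst this
    exact (hne rfl).1 h2

/-- The crossings of the front can be moved so that they lie over the abscissas `v i`. -/
theorem IsShear.isotopic_of_loops {x y z w F f : ℝ → ℝ} {d ρ M : ℝ} {S : Finset (ℝ × ℝ)}
    {A B : ℝ × ℝ → ℝ → ℝ} {q v : ℝ × ℝ → ℝ} (hF : IsShear x y z S A B q d ρ M F v)
    (h : FrontCurve x y z) (hf : Continuous f) (hwc : Continuous w) (pw : Function.Periodic w 1)
    (hcusp : ∀ i ∈ S, i.1 = i.2 → CrossesAt w (A i) (B i) (Ico (x i.1 - d) (q i)) (v i))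
    (hord : ∀ s t, x s = x t → (∀ i ∈ S, i.1 = i.2 →
        ¬ OnStrands x (A i) (B i) (Ico (x i.1 - d) (q i)) s t ∧
        ¬ OnStrands x (A i) (B i) (Ico (x i.1 - d) (q i)) t s) →
      (z s < z t → w s < w t) ∧ (z s = z t → w s = w t)) :
    PlanarIsotopic ⟨fun θ => (x θ, w θ), resolvedRel y z⟩
      ⟨fun θ => (x θ, Real.exp (f (x θ)) * (F (x θ) * z θ + y θ)),
        fun s t => Real.exp (f (x t)) * z t < Real.exp (f (x s)) * z s⟩ := by
  classical
  have hS := hF.system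
  have pW : Function.Periodic (fun θ => F (x θ) * z θ + y θ) 1 := fun θ => by
    simp only [h.px θ, h.py θ, h.pz θ]
  set T := S.filter fun i => i.1 ≠ i.2 with hT
  have hTS : ∀ i ∈ T, i ∈ S ∧ i.1 ≠ i.2 := fun i hi => Finset.mem_filter.1 hi
  -- The strands of a crossing are not those of any cusp feature, so w orders them as z and they
  -- still meet over the original abscissa.
  have hwz : ∀ i ∈ T, CrossesAt w (A i) (B i) (Ico (x i.1 - d) (q i)) (x i.1) := by
    intro i hi u hu
    obtain ⟨hiS, hne⟩ := hTS i hi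
    have hf := hS.feature i hiS
    have hA := hf.strandA.section_eq u hu
    have hB := hf.strandB.section_eq u hu
    have hno : ∀ j ∈ S, j.1 = j.2 →
        ¬ OnStrands x (A j) (B j) (Ico (x j.1 - d) (q j)) (A i u) (B i u) ∧
        ¬ OnStrands x (A j) (B j) (Ico (x j.1 - d) (q j)) (B i u) (A i u) := fun j hj hjc =>
      hS.not_onStrands hiS hj (hA.trans hB.symm) (by rwa [hA])
        (Or.inl (by rw [hA]; exact SameCirclePoint.refl _)) fun e => absurd (e ▸ hjc) hne
    have o1 := hord _ _ (hA.trans hB.symm) hno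
    have o2 := hord _ _ (hB.trans hA.symm) fun j hj hjc => (hno j hj hjc).symm
    have hc := hf.crosses u hu
    exact ⟨fun e => o2.1 (hc.1 e), fun e => o1.2 (hc.2.1 e), fun e => o1.1 (hc.2.2 e)⟩
  set p' : ℝ × ℝ → ℝ := fun i => (x i.1 - d + v i) / 2 with hp'
  set q' : ℝ × ℝ → ℝ := fun i => (x i.1 + q i) / 2 with hq'
  have hp1 : ∀ i ∈ T, x i.1 - d < p' i ∧ p' i < v i ∧ v i < x i.1 ∧ x i.1 < q' i ∧ q' i < q i := by
    intro i hi
    have h1 := hF.mem i (hTS i hi).1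
    have h2 := (hS.crossing i (hTS i hi).1 (hTS i hi).2).1
    simp only [hp', hq']
    refine ⟨?_, ?_, h1.2, ?_, ?_⟩ <;> linarith [h1.1]
  have hsub : ∀ i ∈ T, Icc (p' i) (q' i) ⊆ Ico (x i.1 - d) (q i) := fun i hi u hu =>
    ⟨(hp1 i hi).1.le.trans hu.1, hu.2.trans_lt (hp1 i hi).2.2.2.2⟩
  have hrel : ∀ i ∈ S, ∀ s t, OnStrands x (A i) (B i) (Ico (x i.1 - d) (q i)) s t → y s < y t := by
    intro i hi s t hon
    have := (hS.feature i hi).y_lt _ hon.1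
    rwa [← (hon.eq_eval h.py).1, ← (hon.eq_eval h.py).2] at this
  have hslide : ∀ i ∈ T, IsSlide x w (A i) (B i) (fun s t => y s < y t) (p' i) (q' i) (x i.1)
      (v i) := by
    intro i hi
    obtain ⟨h1, h2, h3, h4, h5⟩ := hp1 i hi
    have hiS := (hTS i hi).1
    have hf := hS.feature i hiS
    refine ⟨hf.strandA.mono (hsub i hi), hf.strandB.mono (hsub i hi), ⟨by linarith, h4⟩,
      ⟨h2, by linarith⟩, fun u hu hsp => ?_, fun u hu => hwz i hi u (hsub i hi hu),
      fun u hu θ hθ hmem => ?_, fun s t s' t' e1 e2 => ?_⟩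
    · have := hf.y_lt u (hsub i hi hu)
      rw [hsp.periodic_eq h.py] at this
      exact lt_irrefl _ this
    -- As for the loops: a strand between the two in w would be between them in z and then in W. But
    -- between v i and the crossing of the front the order of the two strands in W is already
    -- reversed, or equal at v i.
    · by_contra hcon
      push Not at hcon
      subst hθ
      rw [uIcc_of_ge h3.le] at hu
      have huI : x θ ∈ Ico (x i.1 - d) (q i) := ⟨by linarith [hu.1], by linarith [hu.2]⟩
      have hA := hf.strandA.section_eq _ huI
      have hB := hf.strandB.section_eq _ huI
      have hnoA := fun j (hj : j ∈ S) => hS.not_onStrands hiS hj hA (by rwa [hA])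
        (Or.inl (by rw [hA]; exact SameCirclePoint.refl _)) (fun _ => by rwa [hA])
      have hnoB := fun j (hj : j ∈ S) => hS.not_onStrands hiS hj hB (by rwa [hB])
        (Or.inr (by rw [hB]; exact SameCirclePoint.refl _)) (fun _ => by rwa [hB])
      obtain ⟨nA, oA⟩ := hF.order_of_not_onStrands hA.symm (fun e => hcon.1 e.symm)
        fun j hj => (hnoA j hj).symm
      obtain ⟨nB, oB⟩ := hF.order_of_not_onStrands hB hcon.2 hnoB
      have wA := (hord _ _ hA fun j hj _ => hnoA j hj).1
      have wB := (hord _ _ hB.symm fun j hj _ => (hnoB j hj).symm).1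
      have hc := hwz i hi _ huI
      have h6 : w (B i (x θ)) ≤ w (A i (x θ)) := by
        rcases hu.2.eq_or_lt with e | e
        · exact (hc.2.1 e).ge
        · exact (hc.1 e).le
      rw [uIcc_of_ge h6] at hmem
      have hzA := oA.1 (lt_of_le_of_ne (not_lt.1 fun e => absurd (wA e) (not_lt.2 hmem.2)) nA)
      have hzB := oB.1 (lt_of_le_of_ne (not_lt.1 fun e => absurd (wB e) (not_lt.2 hmem.1)) nB)
      have hWc := hF.crosses i hiS _ huI
      dsimp only at hWc
      rcases hu.1.eq_or_lt with e | e
      · have := hWc.2.1 e.symm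
        linarith
      · have := hWc.2.2 e
        linarith
    · have e1 := hrel i hiS s t (e1.mono (hsub i hi))
      have e2 := hrel i hiS s' t' (e2.mono (hsub i hi))
      exact ⟨iff_of_true e1 e2, iff_of_false e1.asymm e2.asymm⟩
  obtain ⟨w₂, hw₂, pw₂, hcr₂, hord₂, hiso⟩ := exists_slides h.hx.continuous h.px hwc pw T hslide
    fun i hi j hj θ h1 h2 h3 h4 => hS.disjoint i (hTS i hi).1 j (hTS j hj).1 θ (hsub i hi h1)
      (hsub j hj h2) h3 h4
  have hoff : ∀ i ∈ S, ∀ u ∈ Ico (x i.1 - d) (q i), (i ∈ T → u ∉ Icc (p' i) (q' i)) →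
      (w (A i u) < w (B i u) ↔ w₂ (A i u) < w₂ (B i u)) ∧
      (w (B i u) < w (A i u) ↔ w₂ (B i u) < w₂ (A i u)) := by
    intro i hi u hu hoff
    have hA := (hS.feature i hi).strandA.section_eq u hu
    have hB := (hS.feature i hi).strandB.section_eq u hu
    have hno : ∀ j ∈ T, ¬ OnStrands x (A j) (B j) (Icc (p' j) (q' j)) (A i u) (B i u) ∧
        ¬ OnStrands x (A j) (B j) (Icc (p' j) (q' j)) (B i u) (A i u) := by
      intro j hj
      by_cases hij : i = j
      · subst hij
        exact ⟨fun e => hoff hj (hA ▸ e.1), fun e => hoff hj (hB ▸ e.1)⟩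
      · have := hS.not_onStrands hi (hTS j hj).1 (hA.trans hB.symm) (by rwa [hA])
          (Or.inl (by rw [hA]; exact SameCirclePoint.refl _)) fun e => absurd e hij
        exact ⟨fun e => this.1 (e.mono (hsub j hj)), fun e => this.2 (e.mono (hsub j hj))⟩
    exact ⟨hord₂ _ _ (hA.trans hB.symm) hno,
      hord₂ _ _ (hB.trans hA.symm) fun j hj => (hno j hj).symm⟩
  have hcr : ∀ i ∈ S, CrossesAt w₂ (A i) (B i) (Ico (x i.1 - d) (q i)) (v i) := by
    intro i hi u hu
    by_cases hiT : i ∈ T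
    · obtain ⟨h1, h2, h3, h4, h5⟩ := hp1 i hiT
      by_cases huI : u ∈ Icc (p' i) (q' i)
      · exact hcr₂ i hiT u huI
      · obtain ⟨o1, o2⟩ := hoff i hi u hu fun _ => huI
        have hc := hwz i hiT u hu
        have h6 : u < p' i ∨ q' i < u := by
          by_contra h6; push Not at h6; exact huI h6
        rcases h6 with h6 | h6
        · have := o2.1 (hc.1 (by linarith))
          exact ⟨fun _ => this, fun e => by linarith, fun e => by linarith⟩
        · have := o1.1 (hc.2.2 (by linarith))
          exact ⟨fun e => by linarith, fun e => by linarith, fun _ => this⟩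
    · have h12 : i.1 = i.2 := by
        by_contra h12; exact hiT (Finset.mem_filter.2 ⟨hi, h12⟩)
      obtain ⟨o1, o2⟩ := hoff i hi u hu fun e => absurd e hiT
      have hc := hcusp i hi h12 u hu
      refine ⟨fun e => o2.1 (hc.1 e), fun e => ?_, fun e => o1.1 (hc.2.2 e)⟩
      have := hc.2.1 e
      refine le_antisymm (not_lt.1 fun e' => ?_) (not_lt.1 fun e' => ?_)
      · have := o2.2 e'; linarith
      · have := o1.2 e'; linarith
  -- All features are now exchanged over the same abscissas v i and all other pairs follow z in both
  -- curves, so the two fibre orders coincide.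
  have horder : ∀ s t, x s = x t →
      (w₂ s < w₂ t ↔ F (x s) * z s + y s < F (x t) * z t + y t) := by
    intro s t hxx
    by_cases hsp : SameCirclePoint s t
    · have h1 := hsp.periodic_eq pw₂
      have h2 := hsp.periodic_eq pW
      rw [h1, h2]; simp
    by_cases hon : ∃ i ∈ S, OnStrands x (A i) (B i) (Ico (x i.1 - d) (q i)) s t
    · obtain ⟨i, hi, hon⟩ := hon
      exact (hon.lt_iff pw₂ (hcr i hi)).1.trans (hon.lt_iff pW (hF.crosses i hi)).1.symm
    by_cases hon' : ∃ i ∈ S, OnStrands x (A i) (B i) (Ico (x i.1 - d) (q i)) t s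
    · obtain ⟨i, hi, hon'⟩ := hon'
      exact (hon'.lt_iff pw₂ (hcr i hi)).2.trans (hon'.lt_iff pW (hF.crosses i hi)).2.symm
    push Not at hon hon'
    obtain ⟨hz, hzW⟩ := hF.order_of_not_onStrands hxx hsp fun i hi => ⟨hon i hi, hon' i hi⟩
    have o1 := (hord s t hxx fun i hi _ => ⟨hon i hi, hon' i hi⟩).1
    have o2 := (hord t s hxx.symm fun i hi _ => ⟨hon' i hi, hon i hi⟩).1
    rw [← hzW, ← hord₂ s t hxx fun i hi => ⟨fun e => hon i (hTS i hi).1 (e.mono (hsub i hi)),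
      fun e => hon' i (hTS i hi).1 (e.mono (hsub i hi))⟩]
    refine ⟨fun e => ?_, o1⟩
    rcases lt_or_gt_of_ne hz with h1 | h1
    · exact h1
    · exact absurd (o2 h1) e.asymm
  have hcont : Continuous fun θ => F (x θ) * z θ + y θ :=
    (((hF.smooth 0).continuous.comp h.hx.continuous).mul h.hz.continuous).add h.hy.continuous
  -- At every double point the decoration reduces to the rule that the smaller slope is upper: at a
  -- new crossing the branch higher in the front has the smaller slope, and elsewhere z is equal. In
  -- this form the relation is constant along both strands of a feature, as sliding requires.
  have step1 : PlanarIsotopic ⟨fun θ => (x θ, w θ), resolvedRel y z⟩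
      ⟨fun θ => (x θ, w θ), fun s t => y s < y t⟩ := by
    refine PlanarIsotopic.of_curve_eq (fun _ => rfl) fun s t hcross => ?_
    obtain ⟨hne, hst⟩ := hcross
    have hxx : x s = x t := (Prod.ext_iff.1 hst).1
    have hww : w s = w t := (Prod.ext_iff.1 hst).2
    have hcuspz : ∀ i ∈ S, i.1 = i.2 → ∀ s t,
        OnStrands x (A i) (B i) (Ico (x i.1 - d) (q i)) s t → z t < z s ∧ y s < y t := by
      intro i hi h12 s t hon
      have h1 := ((hS.feature i hi).crosses _ hon.1).1 (hS.cusp i hi h12 ▸ hon.1.2)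
      rw [← (hon.eq_eval h.pz).1, ← (hon.eq_eval h.pz).2] at h1
      exact ⟨h1, hrel i hi s t hon⟩
    by_cases hon : ∃ i ∈ S, i.1 = i.2 ∧ OnStrands x (A i) (B i) (Ico (x i.1 - d) (q i)) s t
    · obtain ⟨i, hi, h12, hon⟩ := hon
      have := hcuspz i hi h12 s t hon
      exact iff_of_true (Or.inr this.1) this.2
    by_cases hon' : ∃ i ∈ S, i.1 = i.2 ∧ OnStrands x (A i) (B i) (Ico (x i.1 - d) (q i)) t s
    · obtain ⟨i, hi, h12, hon'⟩ := hon'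
      have := hcuspz i hi h12 t s hon'
      refine iff_of_false ?_ this.2.asymm
      rintro (⟨e, -⟩ | e)
      · exact this.1.ne e
      · exact this.1.asymm e
    push Not at hon hon'
    have o1 := (hord s t hxx fun i hi e => ⟨hon i hi e, hon' i hi e⟩).1
    have o2 := (hord t s hxx.symm fun i hi e => ⟨hon' i hi e, hon i hi e⟩).1
    have hzz : z s = z t := le_antisymm
      (not_lt.1 fun e => (o2 e).ne hww.symm) (not_lt.1 fun e => (o1 e).ne hww)
    exact ⟨fun e => e.elim And.right fun e => absurd e hzz.not_gt, fun e => Or.inl ⟨hzz, e⟩⟩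
  refine step1.trans (hiso.trans (PlanarIsotopic.of_vertical_order h.hx.continuous hw₂
    (((hf.comp h.hx.continuous).rexp).mul hcont) h.px pw₂ (fun θ => ?_) (fun s t hxx => ?_)
    fun s t hne hxx hww => ?_))
  · simp only [Function.comp_apply, Pi.mul_apply, h.px θ, h.py θ, h.pz θ]
  · rw [horder s t hxx]
    simp only [Pi.mul_apply, Function.comp_apply]
    rw [hxx, mul_lt_mul_iff_right₀ (Real.exp_pos _)]
  -- At a double point Fz + y is equal on both strands and F > 0, so smaller slope means larger z.
  · have h1 := (horder s t hxx).not.1 hww.not_lt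
    have h2 := (horder t s hxx.symm).not.1 hww.not_gt
    have hW : F (x s) * z s + y s = F (x t) * z t + y t :=
      le_antisymm (not_lt.1 h2) (not_lt.1 h1)
    rw [hxx] at hW ⊢
    rw [mul_lt_mul_iff_right₀ (Real.exp_pos _)]
    have hFp := hF.pos (x t)
    constructor
    · intro e
      refine lt_of_mul_lt_mul_left (a := F (x t)) ?_ hFp.le
      linarith
    · intro e
      have := mul_lt_mul_of_pos_left e hFp
      linarith

/-! ### The theorem -/

theorem mainTheorem5 (r : ℕ∞) (hr : 1 ≤ r) (φ : ℝ → ℝ × ℝ × ℝ)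
    (hφ : IsLegendrianKnot r φ) (hfront : HasGenericFront φ) :
    (∃ w : ℝ → ℝ, IsCuspResolution r φ w) ∧
    ∃ ψ : ℝ → ℝ × ℝ × ℝ,
      LegendrianIsotopic r φ ψ ∧
      (lagrangianDiagram ψ).IsRegular ∧
      ∀ w : ℝ → ℝ, IsCuspResolution r φ w →
        PlanarIsotopic (resolvedDiagram φ w) (lagrangianDiagram ψ) := by
  refine ⟨exists_isCuspResolution hr hφ hfront, ?_⟩
  have h := hφ.frontCurve hr hfront
  obtain ⟨ε, hε, -⟩ := h.exists_windowRadius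
  obtain ⟨S, A, B, q, d, ρ, M, hρ, hS⟩ := h.exists_featureSystem hε.pos
  -- The shear is fixed before any resolution is considered, so one knot serves for all of them. The
  -- bound on the distance of v i from the feature matters only for the existence of resolutions, so
  -- 1 will do here.
  obtain ⟨F, v, hFs, hFM, hv⟩ := h.exists_shear hS le_rfl one_pos
  have hF : IsShear (xCoord φ) (yCoord φ) (zCoord φ) S A B q d ρ M F v :=
    ⟨hS, hFs, hFM, fun i hi => (hv i hi).1, fun i hi => (hv i hi).2.2.1,
      fun i hi => (hv i hi).2.2.2⟩
  obtain ⟨f, hfs, hf⟩ := exists_smooth_primitive hFs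
  refine ⟨_, hφ.isotopic_shear hr hfront hf hfs hFs, hF.isRegular h hf (hfs 1), fun w hw => ?_⟩
  obtain ⟨ε', hw'⟩ := hw.exists_hasWindows
  -- The larger of the two window radii contains both the windows of the resolution and the
  -- ρ-neighbourhoods of the feature strands.
  obtain ⟨w₁, hw₁, pw₁, hcusp, hord, hiso⟩ := hw'.exists_move_loops h hF (hw'.radius.max hε)
    (le_max_left _ _) (hρ.trans (le_max_right _ _)) hw.contDiff.continuous hw.periodic
  exact hiso.trans (hF.isotopic_of_loops h (hfs 0).continuous hw₁ pw₁ hcusp hord)
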